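/- **Multiset types.** Multiset types are generated by $\Sigma,\Gamma ::= 1 \mid \Sigma+\Gamma \mid \Sigma\times\Gamma \mid \mathsf M\Sigma$; their sets of values are, respectively, a one-element set, the disjoint union, the product, and the set of finite multisets over $\Sigma$. **Structures.** Each type $\Sigma$ is also seen as a class of relational structures, closed under isomorphism, over a finite relational vocabulary $\mathrm{voc}(\Sigma)$ (arities may be $0$): - $1$: the one-element structure over the empty vocabulary. - $\Sigma\times\Gamma$: the vocabulary is $\mathrm{voc}(\Sigma)\sqcup\mathrm{voc}(\Gamma)$ plus a new unary $R$. The structure of a pair is the disjoint union of $A\in\Sigma$ and $B\in\Gamma$ (relation names of the other vocabulary being empty), with $R$ holding exactly for the elements of $A$. - $\Sigma+\Gamma$: the vocabulary is $\mathrm{voc}(\Sigma)\sqcup\mathrm{voc}(\Gamma)$ plus a new $0$-ary $R$. The structures are those of $\Sigma$ with $R$ true, and those of $\Gamma$ with $R$ false; relation names of the other vocabulary are empty. - $\mathsf M\Sigma$: the vocabulary is obtained from $\mathrm{voc}(\Sigma)$ by making every $0$-ary relation name unary and adding a new binary $\sim$. The structure of $\{\!\{A_1,\dots,A_n\}\!\}$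 is the disjoint union of the $A_i$, where a former $0$-ary relation holds for all elements of those $A_i$ in which it is true, and $\sim$ is the equivalence relation on this union whose classes are the universes of $A_1,\dots,A_n$, together with one extra element (the root) that participates in no relation. In this way every value of a type is represented by a structure, unique up to isomorphism. **First-order interpretations.** A function $f:\Sigma\to\Gamma$ between multiset types is a *first-order interpretation* if there are a finite set $I$ of components, a dimension $k_i\in\{0,1,\dots\}$ and a first-order formula $\varphi_i$ over $\mathrm{voc}(\Sigma)$ with $k_i$ free variables for each $i\in I$, and, for each relation name $R$ of $\mathrm{voc}(\Gamma)$, of arity $n$, and each $(i_1,\dots,i_n)\in I^n$, a first-order formula $\varphi_{R,i_1,\dots,i_n}$ over $\mathrm{voc}(\Sigma)$ with $k_{i_1}+\dots+k_{i_n}$ free variables, such that for every input $A\in\Sigma$ the structure of $f(A)$ is, up to isomorphism, the one with universe $$\coprod_{i\in I}\{\bar a\in A^{k_i} : A\models\varphi_i(\bar a)\}$$ in which $R((i_1,\bar a_1),\dots,(i_n,\bar a_n))$ holds if and only if $A\models\varphi_{R,i_1,\dots,i_n}(\bar a_1\cdots\bar a_n)$. (Formulas may use equality.) **Derivable functions.**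 The *derivable* functions are the least class of functions between multiset types that contains, for all types $\Sigma,\Sigma_1,\Sigma_2$, the prime functions - $\mathit{union}:\mathsf M\mathsf M\Sigma\to\mathsf M\Sigma$ (multiset union); - $\mathit{add}:\Sigma\times\mathsf M\Sigma\to\mathsf M\Sigma$ (add one element); - $\mathit{choices}:\mathsf M\Sigma\to\mathsf M(\Sigma\times\mathsf M\Sigma)$, $\{\!\{A_1,\dots,A_n\}\!\}\mapsto\{\!\{(A_1,B_1),\dots,(A_n,B_n)\}\!\}$ with $B_i=\{\!\{A_1,\dots,A_n\}\!\}-\{\!\{A_i\}\!\}$; - $\textit{de-singleton}:\mathsf M\Sigma\to 1+\Sigma$, which maps $\{\!\{A\}\!\}$ to $A$ and every non-singleton to the element of $1$; - $\mathit{empty}:1\to\mathsf M1$ (constant empty multiset); - $\mathit{id}:\Sigma\to\Sigma$, the projections $\pi_i:\Sigma_1\times\Sigma_2\to\Sigma_i$ and the coprojections $\iota_i:\Sigma_i\to\Sigma_1+\Sigma_2$; - $\mathit{dist}:\Sigma\times(\Sigma_1+\Sigma_2)\to\Sigma\times\Sigma_1+\Sigma\times\Sigma_2$ (distributivity); and that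 is closed under pairing (from $f_j:\Sigma\to\Gamma_j$ form $\langle f_1,f_2\rangle:\Sigma\to\Gamma_1\times\Gamma_2$), co-pairing (from $f_j:\Sigma_j\to\Gamma$ form $[f_1,f_2]:\Sigma_1+\Sigma_2\to\Gamma$), mapping (from $f:\Sigma\to\Gamma$ form $\mathsf Mf:\mathsf M\Sigma\to\mathsf M\Gamma$) and composition. **Theorem.** Let $f:\Sigma\to\Gamma$ be a function between multiset types. Then $f$ is a first-order interpretation if and only if it is derivable. -/

import Mathlib

namespace MultisetTypes

open scoped FirstOrder

/-! ### Multiset types and their values -/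

/-- The syntax of multiset types: `1`, `Σ + Γ`, `Σ × Γ` and `M Σ`. -/
inductive MType : Type
  | one : MType
  | sum (σ τ : MType) : MType
  | prod (σ τ : MType) : MType
  | mset (σ : MType) : MType

/-- The set of values of a multiset type. -/
def MType.Val : MType → Type
  | .one => Unit
  | .sum σ τ => σ.Val ⊕ τ.Val
  | .prod σ τ => σ.Val × τ.Val
  | .mset σ => Multiset σ.Val

/-! ### Vocabularies

A vocabulary is a first-order language without function symbols. -/

/-- Relation names of `voc Σ + voc Γ` plus one extra `0`-ary relation name. -/
inductive SumRel (L L' : FirstOrder.Language.{0, 0}) : ℕ → Type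
  | left {n : ℕ} (R : L.Relations n) : SumRel L L' n
  | right {n : ℕ} (R : L'.Relations n) : SumRel L L' n
  | isLeft : SumRel L L' 0

/-- Relation names of `voc Σ + voc Γ` plus one extra unary relation name. -/
inductive ProdRel (L L' : FirstOrder.Language.{0, 0}) : ℕ → Type
  | left {n : ℕ} (R : L.Relations n) : ProdRel L L' n
  | right {n : ℕ} (R : L'.Relations n) : ProdRel L L' n
  | fromLeft : ProdRel L L' 1

/-- Relation names of `voc (M Σ)`: every `0`-ary relation name of `voc Σ` becomes unary, the other
ones are kept, and one extra binary relation name is added. -/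
inductive MsetRel (L : FirstOrder.Language.{0, 0}) : ℕ → Type
  | unary (R : L.Relations 0) : MsetRel L 1
  | keep {n : ℕ} (R : L.Relations (n + 1)) : MsetRel L (n + 1)
  | sim : MsetRel L 2

/-- The vocabulary of a multiset type. -/
def MType.voc : MType → FirstOrder.Language.{0, 0}
  | .one => FirstOrder.Language.empty
  | .sum σ τ => ⟨fun _ => Empty, SumRel σ.voc τ.voc⟩
  | .prod σ τ => ⟨fun _ => Empty, ProdRel σ.voc τ.voc⟩
  | .mset σ => ⟨fun _ => Empty, MsetRel σ.voc⟩

instance MType.voc_isRelational (σ : MType) : σ.voc.IsRelational := by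
  intro n
  cases σ <;> exact inferInstanceAs (IsEmpty Empty)

/-! ### Structures -/

/-- Structures over a vocabulary. -/
abbrev Str (L : FirstOrder.Language.{0, 0}) := CategoryTheory.Bundled.{0} L.Structure

/-- The one-element structure over the empty vocabulary. -/
def Str.unit : Str FirstOrder.Language.empty :=
  ⟨Unit, FirstOrder.Language.emptyStructure⟩

/-- A structure in `Σ + Γ` that comes from `Σ`. -/
def Str.inl {L : FirstOrder.Language.{0, 0}} (L' : FirstOrder.Language.{0, 0}) (A : Str L) :
    Str ⟨fun _ => Empty, SumRel L L'⟩ where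
  α := A
  str :=
    { funMap := fun f => nomatch f
      RelMap := fun R x => match R with
        | .left R => FirstOrder.Language.Structure.RelMap R x
        | .right _ => False
        | .isLeft => True }

/-- A structure in `Σ + Γ` that comes from `Γ`. -/
def Str.inr (L : FirstOrder.Language.{0, 0}) {L' : FirstOrder.Language.{0, 0}} (B : Str L') :
    Str ⟨fun _ => Empty, SumRel L L'⟩ where
  α := B
  str :=
    { funMap := fun f => nomatch f
      RelMap := fun R x => match R with
        | .left _ => False
        | .right R => FirstOrder.Language.Structure.RelMap R x
        | .isLeft => False }

/-- The pair structure: the disjoint union of `A` and `B`, with an extra unary relation that holds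
for the elements of `A`. -/
def Str.prod {L L' : FirstOrder.Language.{0, 0}} (A : Str L) (B : Str L') :
    Str ⟨fun _ => Empty, ProdRel L L'⟩ where
  α := A ⊕ B
  str :=
    { funMap := fun f => nomatch f
      RelMap := fun R x => match R with
        | .left R => ∃ y : Fin _ → A, x = Sum.inl ∘ y ∧ FirstOrder.Language.Structure.RelMap R y
        | .right R => ∃ y : Fin _ → B, x = Sum.inr ∘ y ∧ FirstOrder.Language.Structure.RelMap R y
        | .fromLeft => ∃ a : A, x 0 = Sum.inl a }

/-- The disjoint union of the structures `A i`, together with an extra root element `none` that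
participates in no relation. -/
def Str.mset {L : FirstOrder.Language.{0, 0}} {ι : Type} (A : ι → Str L) :
    Str ⟨fun _ => Empty, MsetRel L⟩ where
  α := Option ((i : ι) × A i)
  str :=
    { funMap := fun f => nomatch f
      RelMap := fun R x => match R with
        | .unary R => ∃ (i : ι) (a : A i), x 0 = some ⟨i, a⟩ ∧
            FirstOrder.Language.Structure.RelMap R (Fin.elim0 : Fin 0 → A i)
        | .keep R => ∃ (i : ι) (y : Fin _ → A i), (∀ j, x j = some ⟨i, y j⟩) ∧
            FirstOrder.Language.Structure.RelMap R y
        | .sim => ∃ (i : ι) (a b : A i), x 0 = some ⟨i, a⟩ ∧ x 1 = some ⟨i, b⟩ }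

open Classical in
/-- The structure of a value of a multiset type. For a multiset `s`, the index set is the type `s`
of the occurrences of elements in `s` (elements are repeated according to their multiplicity). -/
noncomputable def MType.toStr : (σ : MType) → σ.Val → Str σ.voc
  | .one => fun _ => Str.unit
  | .sum σ τ => Sum.elim (fun a => (σ.toStr a).inl τ.voc) (fun b => (τ.toStr b).inr σ.voc)
  | .prod σ τ => fun p => (σ.toStr p.1).prod (τ.toStr p.2)
  | .mset σ => fun s : Multiset σ.Val => Str.mset fun x : s => σ.toStr x.1

/-- The structure `A` belongs to the class of structures of the type `σ`, and the value that it
represents is `a`. -/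
def Represents (σ : MType) (A : Str σ.voc) (a : σ.Val) : Prop :=
  Nonempty (A ≃[σ.voc] σ.toStr a)

/-! ### First-order interpretations -/

/-- The syntax of an (injective, multi-component, multi-dimensional) first-order interpretation. -/
structure Interpretation (L L' : FirstOrder.Language.{0, 0}) where
  /-- The components. -/
  I : Type
  /-- There are finitely many components. -/
  finite_I : Finite I
  /-- The dimension of a component. -/
  dim : I → ℕ
  /-- The universe formula of a component. -/
  univ (i : I) : L.Formula (Fin (dim i))
  /-- The formula that defines a relation on a tuple of components; it has one free variable for
  each pair of a position `j` in the tuple and a coordinate of the `j`-th component. -/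
  rel {n : ℕ} (R : L'.Relations n) (i : Fin n → I) : L.Formula ((j : Fin n) × Fin (dim (i j)))

/-- The output structure of an interpretation on an input structure. -/
def Interpretation.out {L L' : FirstOrder.Language.{0, 0}} [L'.IsRelational]
    (F : Interpretation L L')
    (A : Str L) : Str L' where
  α := (i : F.I) × {a : Fin (F.dim i) → A // (F.univ i).Realize a}
  str :=
    { funMap := fun f => isEmptyElim f
      RelMap := fun R x =>
        (F.rel R fun j => (x j).1).Realize fun p => (x p.1).2.1 p.2 }

/-- A function between multiset types is a first-order interpretation if there is an interpretation
which maps every structure that represents an input value to a structure that represents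
the corresponding output value. -/
def IsFOInterpretation {σ τ : MType} (f : σ.Val → τ.Val) : Prop :=
  ∃ F : Interpretation σ.voc τ.voc, ∀ (a : σ.Val) (A : Str σ.voc),
    Represents σ A a → Represents τ (F.out A) (f a)

/-! ### Derivable functions -/

section Prime

variable {α β γ : Type}

/-- Multiset union. -/
def union : Multiset (Multiset α) → Multiset α :=
  Multiset.join

/-- Add one element to a multiset. -/
def add : α × Multiset α → Multiset α :=
  fun p => p.1 ::ₘ p.2

open Classical in
/-- The multiset of pairs (an element, the remaining multiset). -/
noncomputable def choices : Multiset α → Multiset (α × Multiset α) :=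
  fun s => s.map fun a => (a, s.erase a)

open Classical in
/-- A singleton is mapped to its unique element, any other multiset to the element of `1`. -/
noncomputable def deSingleton : Multiset α → Unit ⊕ α :=
  fun s => if h : ∃ a, s = {a} then Sum.inr h.choose else Sum.inl ()

/-- The constant empty multiset. -/
def empty : Unit → Multiset Unit :=
  fun _ => 0

/-- Distribute `×` over `+`. -/
def dist : α × (β ⊕ γ) → α × β ⊕ α × γ
  | (a, Sum.inl b) => Sum.inl (a, b)
  | (a, Sum.inr c) => Sum.inr (a, c)

end Prime

/-- The derivable functions. -/
inductive Derivable : {σ τ : MType} → (σ.Val → τ.Val) → Prop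
  | union (σ : MType) :
      Derivable (σ := .mset (.mset σ)) (τ := .mset σ) (union (α := σ.Val))
  | add (σ : MType) :
      Derivable (σ := .prod σ (.mset σ)) (τ := .mset σ) (add (α := σ.Val))
  | choices (σ : MType) :
      Derivable (σ := .mset σ) (τ := .mset (.prod σ (.mset σ))) (choices (α := σ.Val))
  | deSingleton (σ : MType) :
      Derivable (σ := .mset σ) (τ := .sum .one σ) (deSingleton (α := σ.Val))
  | empty :
      Derivable (σ := .one) (τ := .mset .one) empty
  | id (σ : MType) :
      Derivable (σ := σ) (τ := σ) fun a => a
  | fst (σ₁ σ₂ : MType) :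
      Derivable (σ := .prod σ₁ σ₂) (τ := σ₁) (Prod.fst : σ₁.Val × σ₂.Val → σ₁.Val)
  | snd (σ₁ σ₂ : MType) :
      Derivable (σ := .prod σ₁ σ₂) (τ := σ₂) (Prod.snd : σ₁.Val × σ₂.Val → σ₂.Val)
  | inl (σ₁ σ₂ : MType) :
      Derivable (σ := σ₁) (τ := .sum σ₁ σ₂) (Sum.inl : σ₁.Val → σ₁.Val ⊕ σ₂.Val)
  | inr (σ₁ σ₂ : MType) :
      Derivable (σ := σ₂) (τ := .sum σ₁ σ₂) (Sum.inr : σ₂.Val → σ₁.Val ⊕ σ₂.Val)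
  | dist (σ σ₁ σ₂ : MType) :
      Derivable (σ := .prod σ (.sum σ₁ σ₂)) (τ := .sum (.prod σ σ₁) (.prod σ σ₂))
        (dist (α := σ.Val) (β := σ₁.Val) (γ := σ₂.Val))
  | pairing {σ γ₁ γ₂ : MType} {f₁ : σ.Val → γ₁.Val} {f₂ : σ.Val → γ₂.Val} :
      Derivable f₁ → Derivable f₂ →
        Derivable (σ := σ) (τ := .prod γ₁ γ₂) fun a => (f₁ a, f₂ a)
  | copairing {σ₁ σ₂ γ : MType} {f₁ : σ₁.Val → γ.Val} {f₂ : σ₂.Val → γ.Val} :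
      Derivable f₁ → Derivable f₂ →
        Derivable (σ := .sum σ₁ σ₂) (τ := γ) (Sum.elim f₁ f₂)
  | mapping {σ γ : MType} {f : σ.Val → γ.Val} :
      Derivable f → Derivable (σ := .mset σ) (τ := .mset γ) (Multiset.map f)
  | comp {σ₁ σ₂ σ₃ : MType} {f : σ₁.Val → σ₂.Val} {g : σ₂.Val → σ₃.Val} :
      Derivable f → Derivable g → Derivable fun a => g (f a)

end MultisetTypes

set_option linter.unusedSectionVars false

/-! Both directions work with interpretations of uniform dimension (`Interp`, `FOFun`). The passage
from arbitrary dimensions, `IsFOInterpretation.foFun`, rests on `exists_definesPoint`: every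
structure of a multiset type has an element picked out by a first-order formula that depends only on
the type, and superfluous coordinates are filled with that element.

Derivable functions are first-order interpretations because each prime function has an explicit
interpretation and the class has the required closure properties. Composition is the substitution
argument `Interp.pullback`: first-order queries about the output are first-order queries about the
input. Pairing and co-pairing put the components of two padded interpretations side by side. For
mapping and for `choices`, an interpretation may carry a parameter: a member of a multiset is named
by an element of its `∼`-class, and the definable point of the class gives each member exactly one
name. `Interp.bag` gathers the outputs for all names and stores the name as an additional
coordinate.

Conversely, a derivable function sees values and has no access to elements of structures. Elements
are therefore made visible by colours: `lab C σ` consists of the values of `σ` whose structure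
elements carry colours from the type `C`. By recursion on the type, the multiset of all ways to mark
a single element is derivable (`exists_marks`); `choices` and `add` handle the multiset case. An
assignment of variables becomes a colouring in which the value of each variable is marked. Equality
and relation atoms are then tests for the existence of suitably coloured elements
(`exists_some_colour`, `exists_atom`), and a quantifier over elements becomes a test on the multiset
of all markings. Hence every first-order query is a derivable property of marked values
(`exists_dpred_of_fo`).

It remains to build the output value, by induction on the output type and for interpretations with
marked parameters (`exists_derivable_out`). Sums and products reduce to smaller types by composition
with reducts and projections. For a multiset, all tuples are marked; those that represent the
definable point of a class of the output are kept, one for each occurrence, and the induction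
hypothesis turns each of them into the member that it names. The union over the finitely many
components is the required multiset. -/

namespace MultisetTypes

open FirstOrder FirstOrder.Language FirstOrder.Language.Structure

/-! ### First-order queries -/

/-- A query: a relation on every structure, with free variables from `α`. -/
abbrev Query (L : FirstOrder.Language.{0, 0}) (α : Type) := ∀ A : Str L, (α → A) → Prop

/-- A query that is defined by a first-order formula. -/
def FO {L : FirstOrder.Language.{0, 0}} {α : Type} (Q : Query L α) : Prop :=
  ∃ φ : L.Formula α, ∀ A x, φ.Realize x ↔ Q A x

namespace FO

variable {L : FirstOrder.Language.{0, 0}} {α γ : Type}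

theorem congr {Q Q' : Query L α} (h : FO Q) (e : ∀ A x, Q A x ↔ Q' A x) : FO Q' := by
  obtain ⟨φ, hφ⟩ := h
  exact ⟨φ, fun A x => (hφ A x).trans (e A x)⟩

theorem fls : FO fun (A : Str L) (_ : α → A) => False :=
  ⟨⊥, fun _ _ => Iff.rfl⟩

theorem imp {Q Q' : Query L α} (h : FO Q) (h' : FO Q') : FO fun A x => Q A x → Q' A x := by
  obtain ⟨φ, hφ⟩ := h
  obtain ⟨ψ, hψ⟩ := h'
  exact ⟨φ.imp ψ, fun A x => by rw [Formula.realize_imp, hφ, hψ]⟩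

theorem not {Q : Query L α} (h : FO Q) : FO fun A x => ¬ Q A x := h.imp fls

theorem tru : FO fun (A : Str L) (_ : α → A) => True :=
  fls.not.congr fun _ _ => by simp

theorem and {Q Q' : Query L α} (h : FO Q) (h' : FO Q') : FO fun A x => Q A x ∧ Q' A x :=
  (h.imp h'.not).not.congr fun _ _ => by tauto

theorem or {Q Q' : Query L α} (h : FO Q) (h' : FO Q') : FO fun A x => Q A x ∨ Q' A x :=
  (h.not.imp h').congr fun _ _ => by tauto

/-- The truth of `p` is decided outside the logic, which lets conditions on component indices occur
inside queries. -/
theorem const (p : Prop) : FO fun (A : Str L) (_ : α → A) => p := by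
  by_cases h : p
  · exact tru.congr fun _ _ => by simp [h]
  · exact fls.congr fun _ _ => by simp [h]

theorem eq (a b : α) : FO fun (A : Str L) (x : α → A) => x a = x b :=
  ⟨Term.equal (Term.var a) (Term.var b), fun _ _ => by simp⟩

theorem rel {n : ℕ} (R : L.Relations n) (v : Fin n → α) :
    FO fun (A : Str L) (x : α → A) => RelMap R fun j => x (v j) :=
  ⟨R.formula fun j => Term.var (v j), fun _ _ => by simp⟩

theorem rel_one (R : L.Relations 1) (a : α) :
    FO fun (A : Str L) (x : α → A) => RelMap R ![x a] :=
  (rel R ![a]).congr fun A x => by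
    rw [show (fun j => x (![a] j)) = ![x a] from funext fun j => by fin_cases j; rfl]

theorem rel_two (R : L.Relations 2) (a b : α) :
    FO fun (A : Str L) (x : α → A) => RelMap R ![x a, x b] :=
  (rel R ![a, b]).congr fun A x => by
    rw [show (fun j => x (![a, b] j)) = ![x a, x b] from funext fun j => by fin_cases j <;> rfl]

theorem relabel {Q : Query L α} (h : FO Q) (s : α → γ) :
    FO fun (A : Str L) (x : γ → A) => Q A fun a => x (s a) := by
  obtain ⟨φ, hφ⟩ := h
  exact ⟨φ.relabel s, fun A x => by rw [Formula.realize_relabel]; exact hφ A _⟩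

theorem alls {E : Type} [Finite E] {Q : ∀ A : Str L, (α → A) → (E → A) → Prop}
    (h : FO fun A (z : α ⊕ E → A) => Q A (fun a => z (Sum.inl a)) fun e => z (Sum.inr e)) :
    FO fun A x => ∀ y, Q A x y := by
  obtain ⟨φ, hφ⟩ := h
  exact ⟨φ.iAlls E, fun A x => by
    rw [Formula.realize_iAlls]; exact forall_congr' fun y => hφ A (Sum.elim x y)⟩

theorem all {Q : ∀ A : Str L, (α → A) → A → Prop}
    (h : FO fun A (z : Option α → A) => Q A (fun a => z (some a)) (z none)) :
    FO fun A x => ∀ y, Q A x y := by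
  refine (alls (E := Unit) (Q := fun A x y => Q A x (y ()))
    (h.relabel fun o => o.elim (Sum.inr ()) Sum.inl)).congr fun A x => ?_
  exact ⟨fun H y => H fun _ => y, fun H y => H _⟩

theorem ex {Q : ∀ A : Str L, (α → A) → A → Prop}
    (h : FO fun A (z : Option α → A) => Q A (fun a => z (some a)) (z none)) :
    FO fun A x => ∃ y, Q A x y :=
  (all (Q := fun A x y => ¬ Q A x y) h.not).not.congr fun _ _ => by simp

theorem forall_index {ι : Type} [Finite ι] {Q : ι → Query L α} (h : ∀ i, FO (Q i)) :
    FO fun A x => ∀ i, Q i A x := by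
  choose φ hφ using h
  exact ⟨Formula.iInf φ, fun A x => by
    rw [Formula.realize_iInf]; exact forall_congr' fun i => hφ i A x⟩

theorem exists_index {ι : Type} [Finite ι] {Q : ι → Query L α} (h : ∀ i, FO (Q i)) :
    FO fun A x => ∃ i, Q i A x :=
  (forall_index fun i => (h i).not).not.congr fun _ _ => by simp

theorem iso {Q : Query L α} (h : FO Q) {A B : Str L} (e : A ≃[L] B) (x : α → A) :
    Q B (fun a => e (x a)) ↔ Q A x := by
  obtain ⟨φ, hφ⟩ := h
  rw [← hφ, ← hφ]
  exact StrongHomClass.realize_formula e φ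

/-- An induction principle for first-order queries over a relational vocabulary. -/
theorem induction [L.IsRelational] {P : ∀ {α : Type}, Query L α → Prop}
    (fls : ∀ α : Type, P fun A (_ : α → A) => False)
    (eq : ∀ {α : Type} (a b : α), P fun A (x : α → A) => x a = x b)
    (rel : ∀ {α : Type} {n : ℕ} (R : L.Relations n) (v : Fin n → α),
      P fun A (x : α → A) => RelMap R fun j => x (v j))
    (imp : ∀ {α : Type} {Q Q' : Query L α}, P Q → P Q' → P fun A x => Q A x → Q' A x)
    (all : ∀ {α : Type} {Q : Query L (Option α)}, P Q →
      P fun A (x : α → A) => ∀ y, Q A fun o => o.elim y x)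
    (relabel : ∀ {α γ : Type} {Q : Query L α} (s : α → γ), P Q →
      P fun A (x : γ → A) => Q A fun a => x (s a))
    {Q : Query L α} (h : FO Q) : P Q := by
  obtain ⟨φ, hφ⟩ := h
  -- Without function symbols every term is a variable, so an atom is determined by a map into the
  -- variables.
  have var : ∀ {β : Type} (t : L.Term β), ∃ b, t = Term.var b := by
    intro β t
    cases t with
    | var b => exact ⟨b, rfl⟩
    | func f _ => exact isEmptyElim f
  -- Free and bound variables are merged into the single type `α ⊕ Fin n`; the quantifier step then
  -- adjoins just one variable.
  have key : ∀ n (ψ : L.BoundedFormula α n), P fun A (x : α ⊕ Fin n → A) =>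
      ψ.Realize (fun a => x (Sum.inl a)) fun j => x (Sum.inr j) := by
    intro n ψ
    induction ψ with
    | falsum => exact fls _
    | equal t₁ t₂ =>
      obtain ⟨a, rfl⟩ := var t₁
      obtain ⟨b, rfl⟩ := var t₂
      convert eq a b using 3 with A x
      simp only [BoundedFormula.Realize, Term.realize_var]
      rcases a with a | a <;> rcases b with b | b <;> rfl
    | rel R ts =>
      choose v hv using fun j => var (ts j)
      convert rel R v using 3 with A x
      simp only [BoundedFormula.Realize, hv, Term.realize_var]
      apply iff_of_eq
      congr 1
      funext j
      rcases v j with a | a <;> rfl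
    | imp _ _ ih₁ ih₂ => exact imp ih₁ ih₂
    | @all n θ ih =>
      -- The last bound variable is the quantified one and is sent to `none`; all the others are
      -- kept under `some`.
      convert all (relabel (Sum.elim (fun a => some (Sum.inl a))
        (Fin.snoc (fun j => some (Sum.inr j)) none : Fin (n + 1) → Option (α ⊕ Fin n))) ih)
        using 3 with A x
      simp only [BoundedFormula.Realize]
      refine forall_congr' fun y => ?_
      apply iff_of_eq
      congr 1
      funext j
      refine Fin.lastCases ?_ (fun j => ?_) j <;> simp
  convert relabel (Sum.elim _root_.id Fin.elim0) (key 0 φ) using 3 with A x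
  rw [← hφ A x, Formula.Realize]
  apply iff_of_eq
  congr 1
  exact Subsingleton.elim _ _

end FO

/-! ### Interpretations of uniform dimension, with parameters -/

/-- Interpretations given by first-order queries; all components have the same dimension `D`, and
the queries may refer to parameters from `β`. -/
structure Interp (L L' : FirstOrder.Language.{0, 0}) (β : Type) where
  /-- The components. -/
  I : Type
  /-- The dimension. -/
  D : Type
  finI : Finite I
  finD : Finite D
  /-- The universe of a component. -/
  U : I → ∀ A : Str L, (β → A) → (D → A) → Prop
  /-- The relations. -/
  V : ∀ {n : ℕ}, L'.Relations n → (Fin n → I) → ∀ A : Str L, (β → A) → (Fin n → D → A) → Prop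
  foU : ∀ i, FO fun A (z : β ⊕ D → A) => U i A (fun b => z (Sum.inl b)) fun d => z (Sum.inr d)
  foV : ∀ {n : ℕ} (R : L'.Relations n) (i : Fin n → I), FO fun A (z : β ⊕ Fin n × D → A) =>
    V R i A (fun b => z (Sum.inl b)) fun j d => z (Sum.inr (j, d))

attribute [instance] Interp.finI Interp.finD

/-- Two isomorphic structures. -/
def Str.Iso {L : FirstOrder.Language.{0, 0}} (A B : Str L) : Prop := Nonempty (A ≃[L] B)

namespace Str.Iso

variable {L : FirstOrder.Language.{0, 0}} {A B C : Str L}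

theorem refl (A : Str L) : A.Iso A := ⟨FirstOrder.Language.Equiv.refl L A⟩

theorem symm (h : A.Iso B) : B.Iso A := h.map FirstOrder.Language.Equiv.symm

theorem trans (h : A.Iso B) (h' : B.Iso C) : A.Iso C :=
  h.elim fun e => h'.map fun e' => e'.comp e

end Str.Iso

namespace Interp

variable {L L' L'' : FirstOrder.Language.{0, 0}} {β γ : Type} [L'.IsRelational] [L''.IsRelational]

/-- The output structure. -/
def out (F : Interp L L' β) (A : Str L) (u : β → A) : Str L' where
  α := {p : F.I × (F.D → A) // F.U p.1 A u p.2}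
  str :=
    { funMap := fun f => isEmptyElim f
      RelMap := fun R x => F.V R (fun j => (x j).1.1) A u fun j => (x j).1.2 }

/-- The element of the output structure given by a component and a tuple. -/
def elt (F : Interp L L' β) {A : Str L} {u : β → A} (i : F.I) (x : F.D → A) (h : F.U i A u x) :
    F.out A u :=
  ⟨(i, x), h⟩

theorem elt_eq_iff (F : Interp L L' β) {A : Str L} {u : β → A} {i j : F.I} {x y : F.D → A}
    (h : F.U i A u x) (h' : F.U j A u y) : F.elt i x h = F.elt j y h' ↔ i = j ∧ ∀ d, x d = y d := by
  rw [← funext_iff]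
  exact Subtype.mk_eq_mk.trans Prod.mk_inj

/-- The general way to recognise an output. The code takes values in all pairs of a component and a
tuple, and its image has to be the universe; working outside the subtype avoids carrying universe
proofs around. -/
theorem out_equiv_of_code (F : Interp L L' β) {A : Str L} {u : β → A} {B : Str L'}
    (code : B → F.I × (F.D → A)) (inj : Function.Injective code)
    (hU : ∀ i x, F.U i A u x ↔ ∃ b, code b = (i, x))
    (hV : ∀ {n : ℕ} (R : L'.Relations n) (y : Fin n → B),
      F.V R (fun j => (code (y j)).1) A u (fun j => (code (y j)).2) ↔ RelMap R y) :
    ∃ e : B ≃[L'] F.out A u, ∀ b, (e b).1 = code b := by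
  let c : B → F.out A u := fun b => ⟨code b, (hU _ _).2 ⟨b, rfl⟩⟩
  have hc : Function.Bijective c := by
    refine ⟨fun b b' h => inj (congrArg Subtype.val h), fun p => ?_⟩
    obtain ⟨b, hb⟩ := (hU _ _).1 p.2
    exact ⟨b, Subtype.ext hb⟩
  exact ⟨{ toEquiv := Equiv.ofBijective c hc
           map_fun' := fun f => isEmptyElim f
           map_rel' := fun R x => hV R x }, fun _ => rfl⟩

theorem out_iso_of_code (F : Interp L L' β) {A : Str L} {u : β → A} {B : Str L'}
    (code : B → F.I × (F.D → A)) (inj : Function.Injective code)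
    (hU : ∀ i x, F.U i A u x ↔ ∃ b, code b = (i, x))
    (hV : ∀ {n : ℕ} (R : L'.Relations n) (y : Fin n → B),
      F.V R (fun j => (code (y j)).1) A u (fun j => (code (y j)).2) ↔ RelMap R y) :
    (F.out A u).Iso B :=
  (F.out_equiv_of_code code inj hU hV).elim fun e _ => ⟨e.symm⟩

/-- First-order queries are invariant under isomorphism, so the universe and the relations are
carried along `e`. -/
theorem out_iso (F : Interp L L' β) {A B : Str L} (e : A ≃[L] B) (u : β → A) :
    (F.out A u).Iso (F.out B fun b => e (u b)) := by
  have hU : ∀ i x, F.U i B (fun b => e (u b)) (fun d => e (x d)) ↔ F.U i A u x :=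
    fun i x => (F.foU i).iso e (Sum.elim u x)
  refine F.out_iso_of_code (fun p => (p.1.1, fun d => e.symm (p.1.2 d))) ?_ ?_ ?_
  · rintro ⟨⟨i, x⟩, hx⟩ ⟨⟨j, y⟩, hy⟩ h
    obtain ⟨rfl, h⟩ := Prod.mk.inj h
    obtain rfl : x = y := funext fun d => e.symm.injective (congrFun h d)
    rfl
  · intro i x
    rw [← hU]
    constructor
    · exact fun h => ⟨⟨(i, _), h⟩, by simp⟩
    · rintro ⟨⟨⟨j, y⟩, hy⟩, h⟩
      obtain ⟨rfl, rfl⟩ := Prod.mk.inj h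
      simpa using hy
  · intro n R y
    have := (F.foV R fun j => (y j).1.1).iso e
      (Sum.elim u fun p : Fin n × F.D => e.symm ((y p.1).1.2 p.2))
    simp only [Sum.elim_inl, Sum.elim_inr, FirstOrder.Language.Equiv.apply_symm_apply] at this
    exact this.symm

/-- First-order queries on the output of an interpretation are first-order queries on its input. -/
theorem pullback (F : Interp L L' β) {Q : Query L' γ} (hQ : FO Q) (i : γ → F.I) :
    ∃ Q' : ∀ A : Str L, (β → A) → (γ → F.D → A) → Prop,
      (FO fun A (z : β ⊕ γ × F.D → A) =>
        Q' A (fun b => z (Sum.inl b)) fun g d => z (Sum.inr (g, d))) ∧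
      ∀ A u x (h : ∀ g, F.U (i g) A u (x g)),
        Q' A u x ↔ Q (F.out A u) fun g => F.elt (i g) (x g) (h g) := by
  revert i
  refine FO.induction (P := fun {γ} Q => ∀ i : γ → F.I,
    ∃ Q' : ∀ A : Str L, (β → A) → (γ → F.D → A) → Prop,
      (FO fun A (z : β ⊕ γ × F.D → A) =>
        Q' A (fun b => z (Sum.inl b)) fun g d => z (Sum.inr (g, d))) ∧
      ∀ A u x (h : ∀ g, F.U (i g) A u (x g)),
        Q' A u x ↔ Q (F.out A u) fun g => F.elt (i g) (x g) (h g)) ?_ ?_ ?_ ?_ ?_ ?_ hQ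
  · exact fun γ i => ⟨fun _ _ _ => False, FO.fls, fun _ _ _ _ => Iff.rfl⟩
  · intro γ a b i
    refine ⟨fun A u x => i a = i b ∧ ∀ d, x a d = x b d,
      (FO.const _).and (FO.forall_index fun d => FO.eq _ _), fun A u x h => ?_⟩
    exact (F.elt_eq_iff (h a) (h b)).symm
  · intro γ n R v i
    exact ⟨fun A u x => F.V R (fun j => i (v j)) A u fun j => x (v j),
      (F.foV R fun j => i (v j)).relabel (Sum.map id (Prod.map v id)), fun A u x h => Iff.rfl⟩
  · intro γ Q₁ Q₂ h₁ h₂ i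
    obtain ⟨Q₁', fo₁, h₁⟩ := h₁ i
    obtain ⟨Q₂', fo₂, h₂⟩ := h₂ i
    exact ⟨fun A u x => Q₁' A u x → Q₂' A u x, fo₁.imp fo₂, fun A u x h =>
      imp_congr (h₁ A u x h) (h₂ A u x h)⟩
  · intro γ Q h i
    choose Q' fo h using fun k : F.I => h fun o => o.elim k i
    -- An output element is a component together with a tuple in its universe. A quantifier over
    -- output elements thus becomes a finite conjunction over components of relativised quantifiers
    -- over tuples.
    refine ⟨fun A u x => ∀ (k : F.I) (y : F.D → A), F.U k A u y → Q' k A u fun o => o.elim y x,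
      FO.forall_index fun k => FO.alls (FO.imp ?_ ?_), fun A u x hx => ?_⟩
    · exact (F.foU k).relabel (Sum.map Sum.inl id)
    · refine ((fo k).relabel (Sum.elim (fun b => Sum.inl (Sum.inl b)) fun p : Option γ × F.D =>
        p.1.elim (Sum.inr p.2) fun g => Sum.inl (Sum.inr (g, p.2)))).congr fun A z => ?_
      apply iff_of_eq
      congr 1
      funext o d
      cases o <;> rfl
    · have aux : ∀ k (y : F.D → A) (hy : F.U k A u y),
          Q' k A u (fun o => o.elim y x) ↔
            Q (F.out A u) fun o => o.elim (F.elt k y hy) fun g => F.elt (i g) (x g) (hx g) := by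
        intro k y hy
        rw [h k A u _ fun o => by cases o <;> first | exact hy | exact hx _]
        apply iff_of_eq
        congr 1
        funext o
        cases o <;> rfl
      constructor
      · rintro H ⟨⟨k, y⟩, hy⟩
        exact (aux k y hy).1 (H k y hy)
      · intro H k y hy
        exact (aux k y hy).2 (H (F.elt k y hy))
  · intro γ δ Q s h i
    obtain ⟨Q', fo, h⟩ := h fun g => i (s g)
    exact ⟨fun A u x => Q' A u fun g => x (s g),
      fo.relabel (Sum.map id (Prod.map s id)), fun A u x hx => h A u _ fun g => hx (s g)⟩

/-- The composition of two interpretations. -/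
@[reducible]
def comp (G : Interp L' L'' Empty) (F : Interp L L' β) : Interp L L'' β where
  -- A `G`-tuple of output elements of `F` is a block of `F`-tuples indexed by `G.D`; the component
  -- remembers from which component of `F` each of them comes.
  I := G.I × (G.D → F.I)
  D := G.D × F.D
  finI := inferInstance
  finD := inferInstance
  U := fun i A u z => ∃ h : ∀ e, F.U (i.2 e) A u fun d => z (e, d),
    G.U i.1 (F.out A u) (fun b => b.elim) fun e => F.elt (i.2 e) (fun d => z (e, d)) (h e)
  V := fun {n} R i A u z => ∃ h : ∀ j e, F.U ((i j).2 e) A u fun d => z j (e, d),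
    G.V R (fun j => (i j).1) (F.out A u) (fun b => b.elim)
      fun j e => F.elt ((i j).2 e) (fun d => z j (e, d)) (h j e)
  foU := fun i => by
    obtain ⟨Q', fo, h⟩ := F.pullback ((G.foU i.1).relabel (Sum.elim Empty.elim id)) i.2
    refine ((FO.forall_index fun e => (F.foU (i.2 e)).relabel
      (Sum.map id fun d => (e, d))).and fo).congr fun A z => ?_
    simp only [Sum.map_inl, Sum.map_inr, id, ← exists_prop]
    refine exists_congr fun hz => ?_
    rw [h A _ _ hz]
    apply iff_of_eq
    congr 1
    funext b
    exact b.elim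
  foV := fun {n} R i => by
    obtain ⟨Q', fo, h⟩ := F.pullback ((G.foV R fun j => (i j).1).relabel (Sum.elim Empty.elim id))
      fun p : Fin n × G.D => (i p.1).2 p.2
    refine ((FO.forall_index fun j : Fin n => FO.forall_index fun e : G.D =>
      (F.foU ((i j).2 e)).relabel
      (Sum.map id fun d => (j, e, d))).and (fo.relabel (Sum.map id fun p =>
          (p.1.1, p.1.2, p.2)))).congr fun A z => ?_
    simp only [Sum.map_inl, Sum.map_inr, id, ← exists_prop]
    refine exists_congr fun hz => ?_
    rw [h A _ (fun p d => z (Sum.inr (p.1, p.2, d))) fun p => hz p.1 p.2]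
    apply iff_of_eq
    congr 1
    funext b
    exact b.elim

theorem comp_out (G : Interp L' L'' Empty) (F : Interp L L' β) (A : Str L) (u : β → A) :
    ((G.comp F).out A u).Iso (G.out (F.out A u) fun b => b.elim) := by
  refine out_iso_of_code _ (fun p => ((p.1.1, fun e => (p.1.2 e).1.1), fun q =>
      (p.1.2 q.1).1.2 q.2))
    ?_ ?_ ?_
  · rintro p q h
    obtain ⟨h, h₂⟩ := Prod.mk.inj h
    obtain ⟨h₀, h₁⟩ := Prod.mk.inj h
    exact Subtype.ext (Prod.ext h₀ (funext fun e => Subtype.ext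
      (Prod.ext (congrFun h₁ e) (funext fun d => congrFun h₂ (e, d)))))
  · rintro ⟨i, k⟩ z
    constructor
    · rintro ⟨h, hz⟩
      exact ⟨⟨(i, _), hz⟩, rfl⟩
    · rintro ⟨⟨⟨j, y⟩, hy⟩, h⟩
      obtain ⟨h, h₂⟩ := Prod.mk.inj h
      obtain ⟨h₀, h₁⟩ := Prod.mk.inj h
      subst h₀ h₁ h₂
      exact ⟨fun e => (y e).2, hy⟩
  · intro n R y
    exact ⟨fun ⟨_, h⟩ => h, fun h => ⟨fun j e => ((y j).1.2 e).2, h⟩⟩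

/-- Every component gets a larger dimension, the new coordinates being filled with an element which
satisfies `P`. -/
@[reducible]
def pad (F : Interp L L' β) {D' : Type} [Finite D'] (s : F.D → D') (P : ∀ A : Str L, A → Prop)
    (foP : FO fun A (x : Unit → A) => P A (x ())) : Interp L L' β where
  I := F.I
  D := D'
  finI := inferInstance
  finD := inferInstance
  U := fun i A u z => F.U i A u (fun d => z (s d)) ∧ ∀ d, d ∉ Set.range s → P A (z d)
  V := fun R i A u z => F.V R i A u fun j d => z j (s d)
  foU := fun i => ((F.foU i).relabel (Sum.map id s)).and
    (FO.forall_index fun d => (FO.const _).imp (foP.relabel fun _ => Sum.inr d))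
  foV := fun R i => (F.foV R i).relabel (Sum.map id (Prod.map id s))

/-- Uniqueness in `hA` forces the value of each new coordinate, so every old tuple has exactly one
padded version. -/
theorem pad_out (F : Interp L L' β) {D' : Type} [Finite D'] (s : F.D → D')
    (hs : Function.Injective s) (P : ∀ A : Str L, A → Prop)
    (foP : FO fun A (x : Unit → A) => P A (x ())) (A : Str L) (u : β → A)
    (hA : ∃! a, P A a) : ((F.pad s P foP).out A u).Iso (F.out A u) := by
  obtain ⟨a, ha, hu⟩ := hA
  let ext (x : F.D → A) : D' → A := Function.extend s x fun _ => a
  have h₁ : ∀ x, (fun d => ext x (s d)) = x := fun x => funext fun d => hs.extend_apply _ _ _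
  have h₂ : ∀ x d, d ∉ Set.range s → ext x d = a := fun x d hd => Function.extend_apply' _ _ _ hd
  refine out_iso_of_code _ (fun p => (p.1.1, ext p.1.2)) ?_ ?_ ?_
  · intro p q h
    obtain ⟨h, h'⟩ := Prod.mk.inj h
    refine Subtype.ext (Prod.ext h ?_)
    rw [← h₁ p.1.2, ← h₁ q.1.2, h']
  · intro i x
    constructor
    · rintro ⟨h, h'⟩
      refine ⟨⟨(i, fun d => x (s d)), h⟩, Prod.ext rfl (funext fun d => ?_)⟩
      by_cases hd : d ∈ Set.range s
      · obtain ⟨d, rfl⟩ := hd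
        exact congrFun (h₁ _) d
      · exact (h₂ _ d hd).trans (hu _ (h' d hd)).symm
    · rintro ⟨⟨⟨j, y⟩, hy⟩, h⟩
      obtain ⟨h, h'⟩ := Prod.mk.inj h
      subst h h'
      refine ⟨?_, fun d hd => ?_⟩
      · have := h₁ y
        exact this.symm ▸ hy
      · exact (h₂ y d hd).symm ▸ ha
  · intro n R y
    apply iff_of_eq
    exact congrArg (F.V R (fun j => (y j).1.1) A u) (funext fun j => h₁ _)

/-- One-dimensional interpretations with one component. -/
@[reducible]
def simple (U : ∀ A : Str L, (β → A) → A → Prop)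
    (V : ∀ {n : ℕ}, L'.Relations n → ∀ A : Str L, (β → A) → (Fin n → A) → Prop)
    (foU : FO fun A (z : β ⊕ Unit → A) => U A (fun b => z (Sum.inl b)) (z (Sum.inr ())))
    (foV : ∀ (n : ℕ) (R : L'.Relations n), FO fun A (z : β ⊕ Fin n → A) =>
      V R A (fun b => z (Sum.inl b)) fun j => z (Sum.inr j)) : Interp L L' β where
  I := Unit
  D := Unit
  finI := inferInstance
  finD := inferInstance
  U := fun _ A u z => U A u (z ())
  V := fun R _ A u z => V R A u fun j => z j ()
  foU := fun _ => foU
  foV := fun R _ => (foV _ R).relabel (Sum.map id fun j => (j, ()))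

/-! ### Outputs of one-dimensional interpretations with one component -/

section Simple

variable {U : ∀ A : Str L, (β → A) → A → Prop}
    {V : ∀ {n : ℕ}, L'.Relations n → ∀ A : Str L, (β → A) → (Fin n → A) → Prop}
    {foU : FO fun A (z : β ⊕ Unit → A) => U A (fun b => z (Sum.inl b)) (z (Sum.inr ()))}
    {foV : ∀ (n : ℕ) (R : L'.Relations n), FO fun A (z : β ⊕ Fin n → A) =>
      V R A (fun b => z (Sum.inl b)) fun j => z (Sum.inr j)}
    {A : Str L} {u : β → A}

theorem simple_equiv {B : Str L'} (j : B → A) (inj : Function.Injective j)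
    (hU : ∀ x, U A u x ↔ ∃ b, j b = x)
    (hV : ∀ {n : ℕ} (R : L'.Relations n) (y : Fin n → B), V R A u (fun k => j (y k)) ↔ RelMap R y) :
    ∃ (e : B ≃[L'] (simple U V foU foV).out A u) (h : ∀ b, U A u (j b)), ∀ b,
      e b = (simple U V foU foV).elt () (fun _ => j b) (h b) := by
  obtain ⟨e, he⟩ := out_equiv_of_code (simple U V foU foV) (A := A) (u := u) (B := B)
    (fun b => ((), fun _ => j b)) (fun b b' h => inj (congrFun (Prod.mk.inj h).2 ()))
    (fun i x => (hU (x ())).trans (exists_congr fun b =>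
      ⟨fun h => Prod.ext rfl (funext fun _ => h), fun h => congrFun (Prod.mk.inj h).2 ()⟩)) hV
  exact ⟨e, fun b => (hU _).2 ⟨b, rfl⟩, fun b => Subtype.ext (he b)⟩

theorem simple_out {B : Str L'} (j : B → A) (inj : Function.Injective j)
    (hU : ∀ x, U A u x ↔ ∃ b, j b = x)
    (hV : ∀ {n : ℕ} (R : L'.Relations n) (y : Fin n → B), V R A u (fun k => j (y k)) ↔ RelMap R y) :
    ((simple U V foU foV).out A u).Iso B :=
  (simple_equiv j inj hU hV).elim fun e _ => ⟨e.symm⟩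

/-- In dimension one an output element is an input element, so a definable point of the output is
also one of the input. -/
theorem existsUnique_simple {P : ∀ B : Str L', B → Prop}
    (h : ∃! p, P ((simple U V foU foV).out A u) p) :
    ∃! z, ∃ hz : U A u z, P _ ((simple U V foU foV).elt () (fun _ => z) hz) := by
  obtain ⟨p, hp, hu⟩ := h
  refine ⟨p.1.2 (), ⟨p.2, hp⟩, fun z ⟨hz, hP⟩ => ?_⟩
  rw [← hu _ hP]
  rfl

end Simple

theorem fo_elt (F : Interp L L' β) {P : ∀ B : Str L', B → Prop}
    (foP : FO fun B (x : Unit → B) => P B (x ())) (i : F.I) :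
    FO fun A (z : β ⊕ F.D → A) => ∃ h : F.U i A (fun b => z (Sum.inl b)) fun d => z (Sum.inr d),
      P _ (F.elt i _ h) := by
  obtain ⟨Q', fo, h⟩ := F.pullback foP fun _ => i
  refine ((F.foU i).and (fo.relabel (Sum.map id Prod.snd))).congr fun A z => ?_
  rw [← exists_prop]
  exact exists_congr fun hz => h A _ _ fun _ => hz

end Interp

/-! ### Enumerations of multisets -/

/-- The multiset `s` consists of the elements `w i`, for all `i`. -/
def Enum {X ι : Type} (s : Multiset X) (w : ι → X) : Prop :=
  ∃ _ : Fintype ι, s = Finset.univ.val.map w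

namespace Enum

variable {X Y ι κ : Type} {s t : Multiset X} {w : ι → X}

theorem of_equiv (h : Enum s w) (e : κ ≃ ι) : Enum s fun k => w (e k) := by
  obtain ⟨_, rfl⟩ := h
  let _ : Fintype κ := Fintype.ofEquiv ι e.symm
  refine ⟨inferInstance, ?_⟩
  rw [← Finset.map_univ_equiv e, Finset.map_val, Multiset.map_map]
  rfl

theorem congr (h : Enum s w) {w' : ι → X} (e : ∀ i, w i = w' i) : Enum s w' := funext e ▸ h

theorem eq {w' : κ → X} (h : Enum s w) (h' : Enum t w') (e : ι ≃ κ) (hw : ∀ i, w' (e i) = w i) :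
    s = t := by
  obtain ⟨_, rfl⟩ := (h'.of_equiv e).congr hw
  obtain ⟨_, rfl⟩ := h
  congr!

theorem of_isEmpty [IsEmpty ι] : Enum 0 w := ⟨Fintype.ofIsEmpty, by simp⟩

theorem of_unique [Unique ι] : Enum {w default} w := ⟨inferInstance, by simp⟩

theorem add {w : ι ⊕ κ → X} (h : Enum s fun i => w (Sum.inl i)) (h' : Enum t fun i => w
    (Sum.inr i)) :
    Enum (s + t) w := by
  obtain ⟨_, rfl⟩ := h
  obtain ⟨_, rfl⟩ := h'
  refine ⟨inferInstance, ?_⟩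
  rw [← Finset.univ_disjSum_univ, Finset.val_disjSum, Multiset.disjSum, Multiset.map_add,
    Multiset.map_map, Multiset.map_map]
  rfl

theorem option {w : Option ι → X} (h : Enum s fun i => w (some i)) : Enum (w none ::ₘ s) w := by
  have := (add (w := Sum.elim (fun i => w (some i)) fun _ : Unit => w none) h of_unique).of_equiv
    (Equiv.optionEquivSumPUnit ι)
  rw [add_comm] at this
  exact this.congr fun i => by cases i <;> rfl

theorem map (h : Enum s w) (f : X → Y) : Enum (s.map f) fun i => f (w i) := by
  obtain ⟨_, rfl⟩ := h
  exact ⟨inferInstance, Multiset.map_map _ _ _⟩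

theorem join {κ : ι → Type} {s : Multiset (Multiset X)} {w : ι → Multiset X} (h : Enum s w)
    {v : ∀ i, κ i → X} (hv : ∀ i, Enum (w i) (v i)) :
    Enum s.join fun p : (i : ι) × κ i => v p.1 p.2 := by
  obtain ⟨_, rfl⟩ := h
  choose _ hv using hv
  refine ⟨inferInstance, ?_⟩
  change _ = ((Finset.univ : Finset ι).val.sigma fun i => (Finset.univ : Finset (κ i)).val).map _
  rw [Multiset.sigma, Multiset.map_bind, funext hv]
  simp only [Multiset.map_map]
  rfl

theorem filter (h : Enum s w) (p : X → Prop) [DecidablePred p] :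
    Enum (s.filter p) fun i : {i // p (w i)} => w i := by
  obtain ⟨_, rfl⟩ := h
  refine ⟨inferInstance, ?_⟩
  have : (Finset.univ.val.map fun i : {i // p (w i)} => (i : ι)) =
      (Finset.univ : Finset ι).val.filter fun i => p (w i) := by
    rw [← Finset.filter_val, ← Finset.subtype_univ, ← Finset.subtype_map]
    rfl
  rw [Multiset.filter_map]
  exact (congrArg (Multiset.map w) this.symm).trans (Multiset.map_map _ _ _)

theorem toType (s : Multiset X) [DecidableEq X] : Enum s fun k : s => k.1 :=
  ⟨inferInstance, s.map_univ_coe.symm⟩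

/-- Copies of equal value are interchangeable, so the copy that is erased may be taken to be the one
with index `i`. -/
theorem erase [DecidableEq X] (h : Enum s w) (i : ι) :
    Enum (s.erase (w i)) fun j : {j // j ≠ i} => w j := by
  classical
  obtain ⟨_, rfl⟩ := h
  refine ⟨inferInstance, ?_⟩
  have h₁ : (Finset.univ : Finset ι) = insert i ((Finset.univ : Finset {j // j ≠ i}).map
      (Function.Embedding.subtype _)) := by
    ext j
    by_cases h : j = i <;> simp [h]
  rw [h₁, Finset.insert_val_of_notMem (by simp), Multiset.map_cons, Finset.map_val,
    Multiset.map_map, Multiset.erase_cons_head]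
  rfl

/-- Compares an arbitrary enumeration with the type of occurrences that `MType.toStr` uses;
structures of multisets can then be indexed in whichever way is convenient. -/
theorem exists_equiv [DecidableEq X] (h : Enum s w) : ∃ e : ι ≃ s, ∀ i, (e i).1 = w i := by
  classical
  obtain ⟨_, rfl⟩ := h
  let c : ((Finset.univ : Finset ι).val) → ι := fun i => i
  have hc : Function.Bijective c := by
    -- `Finset.univ` has no duplicates, so each index occurs in its multiset with the single copy
    -- number `0`.
    refine ⟨fun i j hij => Multiset.coeEmbedding _ |>.injective (Prod.ext hij ?_), fun i => ?_⟩
    · have h₁ := i.2.2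
      have h₂ := j.2.2
      have h₃ := Multiset.nodup_iff_count_le_one.1 (Finset.univ : Finset ι).nodup i.1
      have h₄ := Multiset.nodup_iff_count_le_one.1 (Finset.univ : Finset ι).nodup j.1
      change (i.2 : ℕ) = (j.2 : ℕ)
      omega
    · exact ⟨⟨i, 0, Multiset.count_pos.2 (Finset.mem_univ i)⟩, rfl⟩
  refine ⟨(Equiv.ofBijective c hc).symm.trans ((Finset.univ : Finset ι).val.mapEquiv w),
    fun i => ?_⟩
  rw [Equiv.trans_apply, Multiset.mapEquiv_apply]
  exact congrArg w ((Equiv.ofBijective c hc).apply_symm_apply i)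

theorem exists_mem (h : Enum s w) (p : X → Prop) : (∃ a ∈ s, p a) ↔ ∃ i, p (w i) := by
  obtain ⟨_, rfl⟩ := h
  simp

end Enum

/-! ### Isomorphisms between composed structures -/

/-- The vocabulary of a sum. -/
abbrev sumL (L L' : FirstOrder.Language.{0, 0}) : FirstOrder.Language.{0, 0} :=
  ⟨fun _ => Empty, SumRel L L'⟩

/-- The vocabulary of a product. -/
abbrev prodL (L L' : FirstOrder.Language.{0, 0}) : FirstOrder.Language.{0, 0} :=
  ⟨fun _ => Empty, ProdRel L L'⟩

/-- The vocabulary of a multiset type. -/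
abbrev msetL (L : FirstOrder.Language.{0, 0}) : FirstOrder.Language.{0, 0} :=
  ⟨fun _ => Empty, MsetRel L⟩

instance (L L' : FirstOrder.Language.{0, 0}) : (sumL L L').IsRelational :=
  fun _ => inferInstanceAs (IsEmpty Empty)

instance (L L' : FirstOrder.Language.{0, 0}) : (prodL L L').IsRelational :=
  fun _ => inferInstanceAs (IsEmpty Empty)

instance (L : FirstOrder.Language.{0, 0}) : (msetL L).IsRelational :=
  fun _ => inferInstanceAs (IsEmpty Empty)

section Iso

variable {L L' : FirstOrder.Language.{0, 0}}

/-- The relation name `left R` of a sum. -/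
abbrev sumLeft (L' : FirstOrder.Language.{0, 0}) {n : ℕ} (R : L.Relations n) :
    (sumL L L').Relations n := SumRel.left R

/-- The relation name `right R` of a sum. -/
abbrev sumRight (L : FirstOrder.Language.{0, 0}) {n : ℕ} (R : L'.Relations n) :
    (sumL L L').Relations n := SumRel.right R

/-- The relation name `isLeft` of a sum. -/
abbrev sumIsLeft (L L' : FirstOrder.Language.{0, 0}) : (sumL L L').Relations 0 := SumRel.isLeft

/-- The relation name `left R` of a product. -/
abbrev prodLeft (L' : FirstOrder.Language.{0, 0}) {n : ℕ} (R : L.Relations n) :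
    (prodL L L').Relations n := ProdRel.left R

/-- The relation name `right R` of a product. -/
abbrev prodRight (L : FirstOrder.Language.{0, 0}) {n : ℕ} (R : L'.Relations n) :
    (prodL L L').Relations n := ProdRel.right R

/-- The relation name `fromLeft` of a product. -/
abbrev prodFromLeft (L L' : FirstOrder.Language.{0, 0}) : (prodL L L').Relations 1 :=
  ProdRel.fromLeft

/-- The unary relation name of a multiset type that comes from a `0`-ary one. -/
abbrev msetUnary (R : L.Relations 0) : (msetL L).Relations 1 := MsetRel.unary R

/-- The relation name of a multiset type that comes from one of nonzero arity. -/
abbrev msetKeep {n : ℕ} (R : L.Relations (n + 1)) : (msetL L).Relations (n + 1) := MsetRel.keep R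

/-- The relation name `sim` of a multiset type. -/
abbrev msetSim (L : FirstOrder.Language.{0, 0}) : (msetL L).Relations 2 := MsetRel.sim

/-- A bijection which preserves the relations is an isomorphism. -/
theorem Str.exists_equiv [L.IsRelational] {A B : Str L} (e : A ≃ B)
    (h : ∀ {n : ℕ} (R : L.Relations n) (x : Fin n → A),
      RelMap R (fun j => e (x j)) ↔ RelMap R x) : ∃ g : A ≃[L] B, ∀ x, g x = e x :=
  ⟨{ toEquiv := e
     map_fun' := fun f => isEmptyElim f
     map_rel' := h }, fun _ => rfl⟩

/-- Here and in the next lemmas the underlying map is part of the conclusion, because colours are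
later compared along these isomorphisms. -/
theorem Str.exists_inl_equiv {A B : Str L} (e : A ≃[L] B) :
    ∃ g : A.inl L' ≃[sumL L L'] B.inl L', ∀ x : A, g x = e x :=
  Str.exists_equiv (L := sumL L L') (A := A.inl L') (B := B.inl L') e.toEquiv fun R x => by
    cases R with
    | left R => exact e.map_rel R x
    | right R => exact Iff.rfl
    | isLeft => exact Iff.rfl

theorem Str.exists_inr_equiv {A B : Str L'} (e : A ≃[L'] B) :
    ∃ g : A.inr L ≃[sumL L L'] B.inr L, ∀ x : A, g x = e x :=
  Str.exists_equiv (L := sumL L L') (A := A.inr L) (B := B.inr L) e.toEquiv fun R x => by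
    cases R with
    | left R => exact Iff.rfl
    | right R => exact e.map_rel R x
    | isLeft => exact Iff.rfl

theorem Str.exists_prod_equiv {A A' : Str L} {B B' : Str L'} (e : A ≃[L] A') (f : B ≃[L'] B') :
    ∃ g : A.prod B ≃[prodL L L'] A'.prod B', ∀ x : A ⊕ B, g x = Sum.map e f x := by
  refine Str.exists_equiv (L := prodL L L') (A := A.prod B) (B := A'.prod B')
    (Equiv.sumCongr e.toEquiv f.toEquiv) fun {n} R x => ?_
  cases R with
  | left R =>
    constructor
    · rintro ⟨y, hy, hR⟩
      refine ⟨fun j => e.symm (y j), funext fun j => ?_, (e.symm.map_rel R y).2 hR⟩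
      have := congrFun hy j
      rcases hx : x j with a | b
      · rw [hx] at this
        exact congrArg Sum.inl ((e.symm_apply_apply a).symm.trans
          (congrArg e.symm (Sum.inl.inj this)))
      · rw [hx] at this
        cases (show (Sum.inr (f b) : A' ⊕ B') = Sum.inl (y j) from this)
    · rintro ⟨y, rfl, hR⟩
      exact ⟨fun j => e (y j), rfl, (e.map_rel R y).2 hR⟩
  | right R =>
    constructor
    · rintro ⟨y, hy, hR⟩
      refine ⟨fun j => f.symm (y j), funext fun j => ?_, (f.symm.map_rel R y).2 hR⟩
      have := congrFun hy j
      rcases hx : x j with a | b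
      · rw [hx] at this
        cases (show (Sum.inl (e a) : A' ⊕ B') = Sum.inr (y j) from this)
      · rw [hx] at this
        exact congrArg Sum.inr ((f.symm_apply_apply b).symm.trans
          (congrArg f.symm (Sum.inr.inj this)))
    · rintro ⟨y, rfl, hR⟩
      exact ⟨fun j => f (y j), rfl, (f.map_rel R y).2 hR⟩
  | fromLeft =>
    constructor
    · rintro ⟨a', ha⟩
      rcases hx : x 0 with a | b
      · exact ⟨a, hx⟩
      · have ha : (Equiv.sumCongr e.toEquiv f.toEquiv) (x 0) = Sum.inl a' := ha
        rw [hx] at ha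
        cases (show (Sum.inr (f b) : A' ⊕ B') = Sum.inl a' from ha)
    · rintro ⟨a, ha⟩
      exact ⟨e a, congrArg (Equiv.sumCongr e.toEquiv f.toEquiv) ha⟩

theorem Str.exists_mset_equiv {ι κ : Type} {A : ι → Str L} {B : κ → Str L} (e : ι ≃ κ)
    (f : ∀ i, A i ≃[L] B (e i)) : ∃ g : Str.mset A ≃[msetL L] Str.mset B,
      ∀ o : Option ((i : ι) × A i), g o = o.map (Sigma.map e fun i => f i) := by
  let g : Option ((i : ι) × A i) ≃ Option ((k : κ) × B k) :=
    Equiv.optionCongr (Equiv.sigmaCongr e fun i => (f i).toEquiv)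
  -- Only elements of the class `i` are mapped into the class `e i`; this recovers the preimages of
  -- tuples that satisfy a relation.
  have key : ∀ (o : Option ((i : ι) × A i)) (i : ι) (b : B (e i)), g o = some ⟨e i, b⟩ →
        o = some ⟨i, (f i).symm b⟩ := by
    rintro (_ | ⟨i', a⟩) i b h
    · cases h
    · have h := Option.some.inj h
      obtain rfl : i' = i := e.injective (congrArg Sigma.fst h)
      have h' : f i' a = b := eq_of_heq (Sigma.mk.inj h).2
      rw [← h', FirstOrder.Language.Equiv.symm_apply_apply]
  refine Str.exists_equiv (L := msetL L) (A := Str.mset A) (B := Str.mset B) g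
    fun {n} R x => ?_
  cases R with
  | unary R =>
    constructor
    · rintro ⟨k, b, hx, hR⟩
      obtain ⟨i, rfl⟩ := e.surjective k
      refine ⟨i, _, key _ i b hx, ?_⟩
      rw [← (f i).map_rel]
      convert hR
    · rintro ⟨i, a, hx, hR⟩
      refine ⟨e i, f i a, congrArg g hx, ?_⟩
      rw [← (f i).map_rel] at hR
      convert hR
  | keep R =>
    constructor
    · rintro ⟨k, y, hx, hR⟩
      obtain ⟨i, rfl⟩ := e.surjective k
      exact ⟨i, _, fun j => key _ i _ (hx j), ((f i).symm.map_rel R y).2 hR⟩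
    · rintro ⟨i, y, hx, hR⟩
      exact ⟨e i, fun j => f i (y j), fun j => congrArg g (hx j), ((f i).map_rel R y).2 hR⟩
  | sim =>
    constructor
    · rintro ⟨k, a, b, h₀, h₁⟩
      obtain ⟨i, rfl⟩ := e.surjective k
      exact ⟨i, _, _, key _ i _ h₀, key _ i _ h₁⟩
    · rintro ⟨i, a, b, h₀, h₁⟩
      exact ⟨e i, f i a, f i b, congrArg g h₀, congrArg g h₁⟩

theorem Str.Iso.inl {A B : Str L} (h : A.Iso B) : (A.inl L').Iso (B.inl L') :=
  h.elim fun e => (Str.exists_inl_equiv e).elim fun g _ => ⟨g⟩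

theorem Str.Iso.inr {A B : Str L'} (h : A.Iso B) : (A.inr L).Iso (B.inr L) :=
  h.elim fun e => (Str.exists_inr_equiv e).elim fun g _ => ⟨g⟩

theorem Str.Iso.prod {A A' : Str L} {B B' : Str L'} (h : A.Iso A') (h' : B.Iso B') :
    (A.prod B).Iso (A'.prod B') :=
  h.elim fun e => h'.elim fun f => (Str.exists_prod_equiv e f).elim fun g _ => ⟨g⟩

theorem Str.Iso.mset {ι κ : Type} {A : ι → Str L} {B : κ → Str L} (e : ι ≃ κ)
    (h : ∀ i, (A i).Iso (B (e i))) : (Str.mset A).Iso (Str.mset B) :=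
  (Str.exists_mset_equiv e fun i => Classical.choice (h i)).elim fun g _ => ⟨g⟩

end Iso

/-! ### Representing values -/

theorem Represents.of_iso {σ : MType} {A B : Str σ.voc} {a : σ.Val} (h : Represents σ A a)
    (e : B.Iso A) : Represents σ B a := e.trans h

theorem Represents.congr {σ : MType} {A : Str σ.voc} {a b : σ.Val} (h : Represents σ A a)
    (e : a = b) : Represents σ A b := e ▸ h

theorem represents_toStr (σ : MType) (a : σ.Val) : Represents σ (σ.toStr a) a := Str.Iso.refl _

theorem Represents.inl {σ τ : MType} {A : Str σ.voc} {a : σ.Val} (h : Represents σ A a) :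
    Represents (.sum σ τ) (A.inl τ.voc) (Sum.inl a : σ.Val ⊕ τ.Val) := Str.Iso.inl h

theorem Represents.inr {σ τ : MType} {A : Str τ.voc} {a : τ.Val} (h : Represents τ A a) :
    Represents (.sum σ τ) (A.inr σ.voc) (Sum.inr a : σ.Val ⊕ τ.Val) := Str.Iso.inr h

theorem Represents.prod {σ τ : MType} {A : Str σ.voc} {B : Str τ.voc} {a : σ.Val} {b : τ.Val}
    (h : Represents σ A a) (h' : Represents τ B b) :
    Represents (.prod σ τ) (A.prod B) ((a, b) : σ.Val × τ.Val) := Str.Iso.prod h h'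

theorem Represents.mset {σ : MType} {ι : Type} {s : Multiset σ.Val} {x : ι → σ.Val}
    {A : ι → Str σ.voc} (hs : Enum s x) (h : ∀ i, Represents σ (A i) (x i)) :
    Represents (.mset σ) (Str.mset A) s := by
  classical
  obtain ⟨e, he⟩ := hs.exists_equiv
  refine Str.Iso.mset e fun i => ?_
  have := h i
  rw [← he i] at this
  exact this

/-! ### Basic interpretations -/

namespace Interp

variable {L L' L'' : FirstOrder.Language.{0, 0}} {β : Type}

/-- The first component of a pair. -/
abbrev fst (L L' : FirstOrder.Language.{0, 0}) : Interp (prodL L L') L Empty :=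
  simple (fun _ _ x => RelMap (prodFromLeft L L') ![x]) (fun R _ _ x => RelMap (prodLeft L' R) x)
    (FO.rel_one _ _) fun _ R => FO.rel (prodLeft L' R) Sum.inr

/-- The second component of a pair. -/
abbrev snd (L L' : FirstOrder.Language.{0, 0}) : Interp (prodL L L') L' Empty :=
  simple (fun _ _ x => ¬ RelMap (prodFromLeft L L') ![x])
    (fun R _ _ x => RelMap (prodRight L R) x)
    (FO.rel_one _ _).not fun _ R => FO.rel (prodRight L R) Sum.inr

/-- The reduct to the left vocabulary of a sum. -/
abbrev outl (L L' : FirstOrder.Language.{0, 0}) : Interp (sumL L L') L Empty :=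
  simple (fun _ _ _ => True) (fun R _ _ x => RelMap (sumLeft L' R) x)
    FO.tru fun _ R => FO.rel (sumLeft L' R) Sum.inr

/-- The reduct to the right vocabulary of a sum. -/
abbrev outr (L L' : FirstOrder.Language.{0, 0}) : Interp (sumL L L') L' Empty :=
  simple (fun _ _ _ => True) (fun R _ _ x => RelMap (sumRight L R) x)
    FO.tru fun _ R => FO.rel (sumRight L R) Sum.inr

variable [L.IsRelational] [L'.IsRelational] [L''.IsRelational]

theorem fst_out (A : Str L) (B : Str L') (u) : ((fst L L').out (A.prod B) u).Iso A := by
  refine simple_out (A := A.prod B) (B := A) (Sum.inl : A → A ⊕ B) Sum.inl_injective ?_ ?_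
  · rintro x
    exact ⟨fun ⟨a, ha⟩ => ⟨a, ha.symm⟩, fun ⟨a, ha⟩ => ⟨a, ha.symm⟩⟩
  · intro n R y
    constructor
    · rintro ⟨z, hz, hR⟩
      obtain rfl : y = z := funext fun j => Sum.inl_injective (congrFun hz j)
      exact hR
    · exact fun h => ⟨y, rfl, h⟩

theorem snd_out (A : Str L) (B : Str L') (u) : ((snd L L').out (A.prod B) u).Iso B := by
  refine simple_out (A := A.prod B) (B := B) (Sum.inr : B → A ⊕ B) Sum.inr_injective ?_ ?_
  · rintro (a | b)
    · exact ⟨fun h => (h ⟨a, rfl⟩).elim, fun ⟨b, hb⟩ => by cases hb⟩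
    · exact ⟨fun _ => ⟨b, rfl⟩, fun _ ⟨a, ha⟩ => by cases ha⟩
  · intro n R y
    constructor
    · rintro ⟨z, hz, hR⟩
      obtain rfl : y = z := funext fun j => Sum.inr_injective (congrFun hz j)
      exact hR
    · exact fun h => ⟨y, rfl, h⟩

theorem outl_out (A : Str L) (u) : ((outl L L').out (A.inl L') u).Iso A :=
  simple_out (A := A.inl L') (B := A) (fun a => a) (fun _ _ h => h) (fun x => ⟨fun _ =>
      ⟨x, rfl⟩, fun _ => trivial⟩)
    fun _ _ => Iff.rfl

theorem outr_out (A : Str L') (u) : ((outr L L').out (A.inr L) u).Iso A :=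
  simple_out (A := A.inr L) (B := A) (fun a => a) (fun _ _ h => h) (fun x => ⟨fun _ =>
      ⟨x, rfl⟩, fun _ => trivial⟩)
    fun _ _ => Iff.rfl

/-- The element of a multiset that contains the parameter. -/
abbrev cls (L : FirstOrder.Language.{0, 0}) : Interp (msetL L) L Unit :=
  simple (fun _ u x => RelMap (msetSim L) ![u (), x])
    (fun {n} => match n with
      -- A former `0`-ary name is constant on a class, so its truth value is read off at the
      -- parameter.
      | 0 => fun R _ u _ => RelMap (msetUnary R) ![u ()]
      | _ + 1 => fun R _ _ x => RelMap (msetKeep R) x)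
    (FO.rel_two _ _ _)
    (fun n => match n with
      | 0 => fun R => FO.rel_one (msetUnary R) (Sum.inl ())
      | _ + 1 => fun R => FO.rel (msetKeep R) Sum.inr)

/-- What remains of a multiset after removal of the element that contains the parameter. -/
abbrev others (L : FirstOrder.Language.{0, 0}) : Interp (msetL L) (msetL L) Unit :=
  simple (fun _ u x => ¬ RelMap (msetSim L) ![u (), x]) (fun R _ _ x => RelMap R x)
    (FO.rel_two _ _ _).not fun _ R => FO.rel R Sum.inr

variable {ι : Type} {A : ι → Str L}

theorem relMap_sim_some {k : ι} {a : A k} {x : Option ((k : ι) × A k)} :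
    (@RelMap (msetL L) (Str.mset A) _ _ (msetSim L) ![some ⟨k, a⟩, x]) ↔ ∃ b : A k, x = some
        ⟨k, b⟩ := by
  constructor
  · rintro ⟨i, a', b, h₀, h₁⟩
    obtain rfl : k = i := congrArg Sigma.fst (Option.some.inj h₀)
    exact ⟨b, h₁⟩
  · rintro ⟨b, rfl⟩
    exact ⟨k, a, b, rfl, rfl⟩

theorem relMap_sim_self {x : Option ((k : ι) × A k)} :
    (@RelMap (msetL L) (Str.mset A) _ _ (msetSim L) ![x, x]) ↔ x ≠ none := by
  rcases x with _ | ⟨k, a⟩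
  · refine iff_of_false ?_ (by simp)
    rintro ⟨i, a', b, h₀, h₁⟩
    cases h₀
  · exact iff_of_true (relMap_sim_some.2 ⟨a, rfl⟩) (by simp)

/-- The map is made explicit so that a definable point of the member `A k` can be located inside the
multiset structure. -/
theorem cls_equiv (k : ι) (a : A k) :
    ∃ (e : A k ≃[L] (cls L).out (Str.mset A) (fun _ => some ⟨k, a⟩)) (h : ∀ _, _), ∀ b,
      e b = (cls L).elt () (fun _ => some ⟨k, b⟩) (h b) := by
  have inj : ∀ k, Function.Injective fun b : A k => (some ⟨k, b⟩ : Option ((k : ι) × A k)) :=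
    fun k b b' h => eq_of_heq (Sigma.mk.inj (Option.some.inj h)).2
  refine simple_equiv (A := Str.mset A) (fun b => some ⟨k, b⟩) (inj k) ?_ ?_
  · intro x
    exact relMap_sim_some.trans (exists_congr fun b => eq_comm)
  · rintro (_ | n) R y
    · constructor
      · rintro ⟨i, a', h, hR⟩
        obtain rfl : k = i := congrArg Sigma.fst (Option.some.inj h)
        convert hR
      · intro hR
        refine ⟨k, a, rfl, ?_⟩
        convert hR
    · constructor
      · rintro ⟨i, z, h, hR⟩
        obtain rfl : k = i := congrArg Sigma.fst (Option.some.inj (h 0))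
        obtain rfl : y = z := funext fun j => inj k (h j)
        exact hR
      · exact fun hR => ⟨k, y, fun _ => rfl, hR⟩

theorem cls_out (k : ι) (a : A k) :
    ((cls L).out (Str.mset A) (fun _ => some ⟨k, a⟩)).Iso (A k) :=
  (cls_equiv k a).elim fun e _ => ⟨e.symm⟩

/-- The root is `∼`-related to nothing, so the complement of one class consists of the other classes
and the root. -/
theorem others_out (k : ι) (a : A k) :
    ((others L).out (Str.mset A) (fun _ => some ⟨k, a⟩)).Iso
      (Str.mset fun i : {i // i ≠ k} => A i.1) := by
  let j : Option ((i : {i // i ≠ k}) × A i.1) → Option ((i : ι) × A i) :=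
    Option.map fun p => ⟨p.1.1, p.2⟩
  have hj : ∀ o (i : ι) (b : A i), j o = some ⟨i, b⟩ → ∃ h : i ≠ k, o = some ⟨⟨i, h⟩, b⟩ := by
    rintro (_ | ⟨⟨i', h⟩, b'⟩) i b e
    · cases e
    · cases e
      exact ⟨h, rfl⟩
  refine simple_out (A := Str.mset A) (B := Str.mset fun i : {i // i ≠ k} => A i.1) j ?_ ?_ ?_
  · rintro (_ | ⟨⟨i, h⟩, b⟩) o e
    · cases o with
      | none => rfl
      | some p => cases e
    · obtain ⟨_, h⟩ := hj o i b e.symm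
      exact h.symm
  · intro x
    refine (not_congr relMap_sim_some).trans ?_
    rcases x with _ | ⟨i, b⟩
    · exact iff_of_true (by simp) ⟨none, rfl⟩
    · constructor
      · intro h
        have hi : i ≠ k := by
          rintro rfl
          exact h ⟨b, rfl⟩
        exact ⟨some ⟨⟨i, hi⟩, b⟩, rfl⟩
      · rintro ⟨o, ho⟩ ⟨b', hb⟩
        obtain ⟨hi, -⟩ := hj o i b ho
        exact hi (congrArg Sigma.fst (Option.some.inj hb))
  · intro n R y
    cases R with
    | unary R =>
      constructor
      · rintro ⟨i, b, hx, hR⟩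
        obtain ⟨hi, hy⟩ := hj _ i b hx
        exact ⟨⟨i, hi⟩, b, hy, hR⟩
      · rintro ⟨i, b, hx, hR⟩
        exact ⟨i.1, b, congrArg j hx, hR⟩
    | keep R =>
      constructor
      · rintro ⟨i, b, hx, hR⟩
        have hi := (hj _ i _ (hx 0)).1
        exact ⟨⟨i, hi⟩, b, fun l => (hj _ i _ (hx l)).2, hR⟩
      · rintro ⟨i, b, hx, hR⟩
        exact ⟨i.1, b, fun l => congrArg j (hx l), hR⟩
    | sim =>
      constructor
      · rintro ⟨i, a, b, h₀, h₁⟩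
        have hi := (hj _ i _ h₀).1
        exact ⟨⟨i, hi⟩, a, b, (hj _ i _ h₀).2, (hj _ i _ h₁).2⟩
      · rintro ⟨i, a, b, h₀, h₁⟩
        exact ⟨i.1, a, b, congrArg j h₀, congrArg j h₁⟩

end Interp

/-! ### Pairing, case distinction and multiset formation for interpretations -/

namespace Interp

variable {L L₁ L₂ L' : FirstOrder.Language.{0, 0}} {β : Type}
  [L.IsRelational] [L₁.IsRelational] [L₂.IsRelational] [L'.IsRelational]

/-- The pairing of two interpretations of the same dimension. -/
def pair (F : Interp L L₁ β) (G : Interp L L₂ β) (h : G.D = F.D) : Interp L (prodL L₁ L₂) β where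
  I := F.I ⊕ G.I
  D := F.D
  finI := inferInstance
  finD := inferInstance
  U := fun i A u z => i.elim (fun i => F.U i A u z) fun i => G.U i A u fun d => z (h ▸ d)
  V := fun {n} R => match n, R with
    | _, .left R => fun i A u z => ∃ i' : _ → F.I, i = Sum.inl ∘ i' ∧ F.V R i' A u z
    | _, .right R => fun i A u z => ∃ i' : _ → G.I, i = Sum.inr ∘ i' ∧
        G.V R i' A u fun j d => z j (h ▸ d)
    | _, .fromLeft => fun i _ _ _ => ∃ i', i 0 = Sum.inl i'
  foU := by
    rintro (i | i)
    · exact F.foU i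
    · exact (G.foU i).relabel (Sum.map id fun d => h ▸ d)
  foV := by
    rintro n (R | R | _) i
    · exact FO.exists_index fun i' => (FO.const _).and (F.foV R i')
    · exact FO.exists_index fun i' => (FO.const _).and
        ((G.foV R i').relabel (Sum.map id (Prod.map id fun d => h ▸ d)))
    · exact FO.const _

theorem pair_out (F : Interp L L₁ β) (G : Interp L L₂ β) (h : G.D = F.D) (A : Str L) (u : β → A) :
    ((F.pair G h).out A u).Iso ((F.out A u).prod (G.out A u)) := by
  revert h
  -- Taking `G` apart turns the equality of dimensions into one with a variable; its substitution
  -- removes all casts.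
  obtain ⟨I, D, finI, finD, U, V, foU, foV⟩ := G
  rintro (h : D = F.D)
  subst h
  refine out_iso_of_code _ (B := (F.out A u).prod (out ⟨I, F.D, finI, finD, U, V, foU, foV⟩ A u))
    (Sum.elim (fun p => (Sum.inl p.1.1, p.1.2)) fun p => (Sum.inr p.1.1, p.1.2)) ?_ ?_ ?_
  · rintro (p | p) (q | q) e
    · obtain ⟨e₁, e₂⟩ := Prod.mk.inj e
      exact congrArg Sum.inl (Subtype.ext (Prod.ext (Sum.inl.inj e₁) e₂))
    · cases (Prod.mk.inj e).1
    · cases (Prod.mk.inj e).1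
    · obtain ⟨e₁, e₂⟩ := Prod.mk.inj e
      exact congrArg Sum.inr (Subtype.ext (Prod.ext (Sum.inr.inj e₁) e₂))
  · rintro (i | i) x
    · constructor
      · exact fun hx => ⟨Sum.inl ⟨(i, x), hx⟩, rfl⟩
      · rintro ⟨p | p, hp⟩
        · obtain ⟨e₁, e₂⟩ := Prod.mk.inj hp
          cases Sum.inl.inj e₁
          cases e₂
          exact p.2
        · cases (Prod.mk.inj hp).1
    · constructor
      · exact fun hx => ⟨Sum.inr ⟨(i, x), hx⟩, rfl⟩
      · rintro ⟨p | p, hp⟩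
        · cases (Prod.mk.inj hp).1
        · obtain ⟨e₁, e₂⟩ := Prod.mk.inj hp
          cases Sum.inr.inj e₁
          cases e₂
          exact p.2
  · intro n R y
    cases R with
    | left R =>
      constructor
      · rintro ⟨i', hi, hV⟩
        have : ∀ j, ∃ p, y j = Sum.inl p := by
          intro j
          have := congrFun hi j
          rcases hy : y j with p | p
          · exact ⟨p, rfl⟩
          · rw [hy] at this
            cases this
        choose p hp using this
        obtain rfl : y = Sum.inl ∘ p := funext hp
        obtain rfl : (fun j => (p j).1.1) = i' := funext fun j => Sum.inl.inj (congrFun hi j)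
        exact ⟨p, rfl, hV⟩
      · rintro ⟨p, rfl, hR⟩
        exact ⟨fun j => (p j).1.1, rfl, hR⟩
    | right R =>
      constructor
      · rintro ⟨i', hi, hV⟩
        have : ∀ j, ∃ p, y j = Sum.inr p := by
          intro j
          have := congrFun hi j
          rcases hy : y j with p | p
          · rw [hy] at this
            cases this
          · exact ⟨p, rfl⟩
        choose p hp using this
        obtain rfl : y = Sum.inr ∘ p := funext hp
        obtain rfl : (fun j => (p j).1.1) = i' := funext fun j => Sum.inr.inj (congrFun hi j)
        exact ⟨p, rfl, hV⟩
      · rintro ⟨p, rfl, hR⟩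
        exact ⟨fun j => (p j).1.1, rfl, hR⟩
    | fromLeft =>
      constructor
      · rintro ⟨i', hi⟩
        beta_reduce at hi
        rcases hy : y 0 with p | p
        · exact ⟨p, hy⟩
        · rw [hy] at hi
          cases hi
      · rintro ⟨p, hp⟩
        exact ⟨p.1.1, by beta_reduce; rw [hp]; rfl⟩

/-- The pairing of two interpretations, with padding. -/
theorem exists_pair (F : Interp L L₁ β) (G : Interp L L₂ β) {P : ∀ A : Str L, A → Prop}
    (foP : FO fun A (x : Unit → A) => P A (x ())) :
    ∃ H : Interp L (prodL L₁ L₂) β, ∀ A u, (∃! a, P A a) →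
      (H.out A u).Iso ((F.out A u).prod (G.out A u)) :=
  ⟨(F.pad (Sum.inl : F.D → F.D ⊕ G.D) P foP).pair (G.pad (Sum.inr : G.D → F.D ⊕ G.D) P foP) rfl,
    fun A u h => (pair_out _ _ _ A u).trans
      ((F.pad_out _ Sum.inl_injective P foP A u h).prod
          (G.pad_out _ Sum.inr_injective P foP A u h))⟩

/-- Case distinction between two interpretations of the same dimension. -/
def cond (S : ∀ _ : Str L, Prop) (foS : FO fun A (_ : Empty → A) => S A)
    (F G : Interp L L' β) (h : G.D = F.D) : Interp L L' β where
  I := F.I ⊕ G.I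
  D := F.D
  finI := inferInstance
  finD := inferInstance
  U := fun i A u z => i.elim (fun i => S A ∧ F.U i A u z) fun i => ¬ S A ∧
    G.U i A u fun d => z (h ▸ d)
  V := fun {n} R i A u z =>
    (∃ i' : _ → F.I, i = Sum.inl ∘ i' ∧ S A ∧ F.V R i' A u z) ∨
    ∃ i' : _ → G.I, i = Sum.inr ∘ i' ∧ ¬ S A ∧ G.V R i' A u fun j d => z j (h ▸ d)
  foU := by
    rintro (i | i)
    · exact (foS.relabel Empty.elim).and (F.foU i)
    · exact (foS.relabel Empty.elim).not.and
        ((G.foU i).relabel (Sum.map id fun d => h ▸ d))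
  foV := by
    intro n R i
    exact (FO.exists_index fun i' => (FO.const _).and
      ((foS.relabel Empty.elim).and (F.foV R i'))).or
      (FO.exists_index fun i' => (FO.const _).and ((foS.relabel Empty.elim).not.and
        ((G.foV R i').relabel (Sum.map id (Prod.map id fun d => h ▸ d)))))

theorem cond_out_pos (S : ∀ _ : Str L, Prop) (foS : FO fun A (_ : Empty → A) => S A)
    (F G : Interp L L' β) (h : G.D = F.D) (A : Str L) (u : β → A) (hS : S A) :
    ((cond S foS F G h).out A u).Iso (F.out A u) := by
  refine out_iso_of_code _ (fun p => (Sum.inl p.1.1, p.1.2)) ?_ ?_ ?_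
  · intro p q e
    obtain ⟨e₁, e₂⟩ := Prod.mk.inj e
    exact Subtype.ext (Prod.ext (Sum.inl.inj e₁) e₂)
  · rintro (i | i) x
    · constructor
      · exact fun hx => ⟨⟨(i, x), hx.2⟩, rfl⟩
      · rintro ⟨p, hp⟩
        obtain ⟨e₁, e₂⟩ := Prod.mk.inj hp
        cases Sum.inl.inj e₁
        cases e₂
        exact ⟨hS, p.2⟩
    · refine iff_of_false (fun hx => hx.1 hS) ?_
      rintro ⟨p, hp⟩
      cases (Prod.mk.inj hp).1
  · intro n R y
    constructor
    · rintro (⟨i', hi, -, hV⟩ | ⟨i', hi, hS', -⟩)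
      · obtain rfl : (fun j => (y j).1.1) = i' := funext fun j => Sum.inl.inj (congrFun hi j)
        exact hV
      · exact (hS' hS).elim
    · exact fun hR => Or.inl ⟨_, rfl, hS, hR⟩

theorem cond_out_neg (S : ∀ _ : Str L, Prop) (foS : FO fun A (_ : Empty → A) => S A)
    (F G : Interp L L' β) (h : G.D = F.D) (A : Str L) (u : β → A) (hS : ¬ S A) :
    ((cond S foS F G h).out A u).Iso (G.out A u) := by
  revert h
  obtain ⟨I, D, finI, finD, U, V, foU, foV⟩ := G
  rintro (h : D = F.D)
  subst h
  refine out_iso_of_code _ (fun p => (Sum.inr p.1.1, p.1.2)) ?_ ?_ ?_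
  · intro p q e
    obtain ⟨e₁, e₂⟩ := Prod.mk.inj e
    exact Subtype.ext (Prod.ext (Sum.inr.inj e₁) e₂)
  · rintro (i | i) x
    · refine iff_of_false (fun hx => hS hx.1) ?_
      rintro ⟨p, hp⟩
      cases (Prod.mk.inj hp).1
    · constructor
      · exact fun hx => ⟨⟨(i, x), hx.2⟩, rfl⟩
      · rintro ⟨p, hp⟩
        obtain ⟨e₁, e₂⟩ := Prod.mk.inj hp
        cases Sum.inr.inj e₁
        cases e₂
        exact ⟨hS, p.2⟩
  · intro n R y
    constructor
    · rintro (⟨i', hi, hS', -⟩ | ⟨i', hi, -, hV⟩)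
      · exact (hS hS').elim
      · obtain rfl : (fun j => (y j).1.1) = i' := funext fun j => Sum.inr.inj (congrFun hi j)
        exact hV
    · exact fun hR => Or.inr ⟨_, rfl, hS, hR⟩

/-- The case distinction of two interpretations, with padding. -/
theorem exists_cond {S : ∀ _ : Str L, Prop} (foS : FO fun A (_ : Empty → A) => S A)
    (F G : Interp L L' β) {P : ∀ A : Str L, A → Prop}
    (foP : FO fun A (x : Unit → A) => P A (x ())) :
    ∃ H : Interp L L' β, ∀ A u, (∃! a, P A a) →
      (S A → (H.out A u).Iso (F.out A u)) ∧ (¬ S A → (H.out A u).Iso (G.out A u)) :=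
  ⟨cond S foS (F.pad (Sum.inl : F.D → F.D ⊕ G.D) P foP) (G.pad
      (Sum.inr : G.D → F.D ⊕ G.D) P foP) rfl,
    fun A u h => ⟨
      fun hS => (cond_out_pos S foS _ _ _ A u hS).trans (F.pad_out _ Sum.inl_injective P foP A u h),
      fun hS => (cond_out_neg S foS _ _ _ A u hS).trans
          (G.pad_out _ Sum.inr_injective P foP A u h)⟩⟩

/-- The multiset of the outputs of `H`, for all values of the parameter that satisfy `S`. -/
def bag (H : Interp L L' Unit) (S P : ∀ A : Str L, A → Prop)
    (foS : FO fun A (x : Unit → A) => S A (x ())) (foP : FO fun A (x : Unit → A) => P A (x ())) :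
    Interp L (msetL L') Empty where
  -- The component `none` is the root. The coordinate `none` stores the parameter, which keeps the
  -- outputs for different parameters disjoint.
  I := Option H.I
  D := Option H.D
  finI := inferInstance
  finD := inferInstance
  U := fun i A _ z => match i with
    -- If `P` defines a single element, the constant tuple at that element is the only code of the
    -- root.
    | none => ∀ d, P A (z d)
    | some i => S A (z none) ∧ H.U i A (fun _ => z none) fun d => z (some d)
  V := fun {n} R => match n, R with
    -- The `0`-ary relation of `H` takes no arguments besides the parameter, so empty tuples are
    -- passed to it.
    | _, .unary R => fun i A _ z => (∃ i', i 0 = some i') ∧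
        H.V R Fin.elim0 A (fun _ => z 0 none) Fin.elim0
    | _, .keep R => fun i A _ z => (∀ j, z j none = z 0 none) ∧ ∃ i', i = some ∘ i' ∧
        H.V R i' A (fun _ => z 0 none) fun j d => z j (some d)
    | _, .sim => fun i _ _ z => (∃ i', i 0 = some i') ∧ (∃ i', i 1 = some i') ∧
        z 0 none = z 1 none
  foU := by
    rintro (_ | i)
    · exact FO.forall_index fun d => foP.relabel fun _ => Sum.inr d
    · exact (foS.relabel fun _ => Sum.inr none).and
        ((H.foU i).relabel (Sum.elim (fun _ => Sum.inr none) fun d => Sum.inr (some d)))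
  foV := by
    rintro n (R | R | _) i
    · refine (FO.const _).and (((H.foV R Fin.elim0).relabel (Sum.elim (fun _ => Sum.inr (0, none))
        fun p => p.1.elim0)).congr fun A z => ?_)
      apply iff_of_eq
      congr 1
      funext j
      exact j.elim0
    · exact (FO.forall_index fun j => FO.eq _ _).and
        (FO.exists_index fun i' => (FO.const _).and ((H.foV R i').relabel
          (Sum.elim (fun _ => Sum.inr (0, none)) fun p => Sum.inr (p.1, some p.2))))
    · exact (FO.const _).and ((FO.const _).and (FO.eq _ _))

theorem relMap_zero (F : Interp L L' β) {A : Str L} {u : β → A} (R : L'.Relations 0)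
    (x : Fin 0 → F.out A u) (i : Fin 0 → F.I) (z : Fin 0 → F.D → A) :
    RelMap R x ↔ F.V R i A u z := by
  obtain rfl : i = fun j => (x j).1.1 := Subsingleton.elim _ _
  obtain rfl : z = fun j => (x j).1.2 := Subsingleton.elim _ _
  exact Iff.rfl

theorem bag_out (H : Interp L L' Unit) {S P : ∀ A : Str L, A → Prop}
    (foS : FO fun A (x : Unit → A) => S A (x ())) (foP : FO fun A (x : Unit → A) => P A (x ()))
    (A : Str L) (u) (hP : ∃! a, P A a) :
    ((H.bag S P foS foP).out A u).Iso (Str.mset fun a : {a // S A a} => H.out A fun _ => a.1) := by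
  obtain ⟨r, hr, hu⟩ := hP
  let code : Option ((a : {a // S A a}) × H.out A fun _ => a.1) →
      Option H.I × (Option H.D → A) := fun o => match o with
    | none => (none, fun _ => r)
    | some p => (some p.2.1.1, fun d => d.elim p.1.1 p.2.1.2)
  refine out_iso_of_code _ (B := Str.mset fun a : {a // S A a} => H.out A fun _ => a.1)
    code ?_ ?_ ?_
  · rintro (_ | ⟨a, p⟩) (_ | ⟨b, q⟩) e
    · rfl
    · cases (Prod.mk.inj e).1
    · cases (Prod.mk.inj e).1
    · obtain ⟨e₁, e₂⟩ := Prod.mk.inj e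
      obtain rfl : a = b := Subtype.ext (congrFun e₂ none)
      obtain rfl : p = q := Subtype.ext (Prod.ext (Option.some.inj e₁)
        (funext fun d => congrFun e₂ (some d)))
      rfl
  · rintro (_ | i) x
    · constructor
      · exact fun hx => ⟨none, Prod.ext rfl (funext fun d => (hu _ (hx d)).symm)⟩
      · rintro ⟨_ | p, hp⟩
        · obtain ⟨-, e₂⟩ := Prod.mk.inj hp
          intro d
          have := congrFun e₂ d
          exact this ▸ hr
        · cases (Prod.mk.inj hp).1
    · constructor
      · rintro ⟨h₁, h₂⟩
        exact ⟨some ⟨⟨_, h₁⟩, ⟨(i, _), h₂⟩⟩, Prod.ext rfl (funext fun d => by cases d <;> rfl)⟩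
      · rintro ⟨_ | ⟨a, p⟩, hp⟩
        · cases (Prod.mk.inj hp).1
        · obtain ⟨e₁, e₂⟩ := Prod.mk.inj hp
          cases Option.some.inj e₁
          subst e₂
          exact ⟨a.2, p.2⟩
  · intro n R y
    cases R with
    | unary R =>
      constructor
      · rintro ⟨⟨i', hi⟩, hV⟩
        beta_reduce at hi hV
        rcases hy : y 0 with _ | ⟨a, p⟩
        · rw [hy] at hi
          cases hi
        · rw [hy] at hV
          refine ⟨a, p, hy, ?_⟩
          exact (H.relMap_zero R _ _ _).2 hV
      · rintro ⟨a, p, hy, hV⟩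
        have hy : y 0 = some ⟨a, p⟩ := hy
        refine ⟨⟨p.1.1, by beta_reduce; rw [hy]⟩, ?_⟩
        beta_reduce
        rw [hy]
        exact (H.relMap_zero R _ _ _).1 hV
    | keep R =>
      constructor
      · rintro ⟨hj, i', hi, hV⟩
        have : ∀ j, ∃ p, y j = some p := by
          intro j
          have := congrFun hi j
          rcases hy : y j with _ | p
          · beta_reduce at this
            rw [hy] at this
            cases this
          · exact ⟨p, rfl⟩
        choose p hp using this
        obtain rfl : y = fun j => some (p j) := funext hp
        have hj : ∀ j, (p j).1 = (p 0).1 := fun j => Subtype.ext (hj j)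
        -- All arguments have the same parameter by `hj`, so they can be transported into one fibre.
        obtain ⟨a, q, rfl⟩ : ∃ (a : {a // S A a}) (q : Fin _ → H.out A fun _ => a.1),
            p = fun j => ⟨a, q j⟩ :=
          ⟨(p 0).1, fun j => hj j ▸ (p j).2, funext fun j => Sigma.ext (hj j) (by simp)⟩
        obtain rfl : (fun j => (q j).1.1) = i' :=
          funext fun j => Option.some.inj (congrFun hi j)
        exact ⟨a, q, fun _ => rfl, hV⟩
      · rintro ⟨a, q, hy, hV⟩
        obtain rfl : y = fun j => some ⟨a, q j⟩ := funext hy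
        exact ⟨fun _ => rfl, _, rfl, hV⟩
    | sim =>
      constructor
      · rintro ⟨⟨i, hi⟩, ⟨j, hj⟩, h⟩
        beta_reduce at hi hj h
        rcases h₀ : y 0 with _ | ⟨a, p⟩
        · rw [h₀] at hi
          cases hi
        rcases h₁ : y 1 with _ | ⟨b, q⟩
        · rw [h₁] at hj
          cases hj
        rw [h₀, h₁] at h
        obtain rfl : a = b := Subtype.ext h
        exact ⟨a, p, q, h₀, h₁⟩
      · rintro ⟨a, p, q, h₀, h₁⟩
        have h₀ : y 0 = some ⟨a, p⟩ := h₀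
        have h₁ : y 1 = some ⟨a, q⟩ := h₁
        change (∃ i, (code (y 0)).1 = _) ∧ (∃ i, (code (y 1)).1 = _) ∧
          (code (y 0)).2 _ = (code (y 1)).2 _
        rw [h₀, h₁]
        exact ⟨⟨_, rfl⟩, ⟨_, rfl⟩, rfl⟩

end Interp

/-! ### Every structure of a multiset type has a definable element -/

theorem FO.existsUnique_iso {L : FirstOrder.Language.{0, 0}} {P : ∀ A : Str L, A → Prop}
    (foP : FO fun A (x : Unit → A) => P A (x ())) {A B : Str L} (h : A.Iso B)
    (hB : ∃! b, P B b) : ∃! a, P A a := by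
  obtain ⟨e⟩ := h
  obtain ⟨b, hb, hu⟩ := hB
  have key : ∀ a, P B (e a) ↔ P A a := fun a => foP.iso e fun _ => a
  refine ⟨e.symm b, (key _).1 (by rwa [FirstOrder.Language.Equiv.apply_symm_apply]), fun a ha => ?_⟩
  rw [← hu _ ((key a).2 ha), FirstOrder.Language.Equiv.symm_apply_apply]

theorem Interp.fo_elt_empty {L L' : FirstOrder.Language.{0, 0}} [L'.IsRelational]
    (F : Interp L L' Empty) {P : ∀ B : Str L', B → Prop}
    (foP : FO fun B (x : Unit → B) => P B (x ())) (i : F.I) :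
    FO fun A (z : F.D → A) => ∃ h : F.U i A Empty.elim z, P _ (F.elt i z h) := by
  refine ((F.fo_elt foP i).relabel (Sum.elim Empty.elim id)).congr fun A z => ?_
  have : ∀ u : Empty → A, (∃ h : F.U i A u z, P _ (F.elt i z h)) ↔
      ∃ h : F.U i A Empty.elim z, P _ (F.elt i z h) := by
    intro u
    rw [Subsingleton.elim u Empty.elim]
  exact this _

theorem relMap_isLeft_inl {L L' : FirstOrder.Language.{0, 0}} (A : Str L) (x : Fin 0 → A) :
    @RelMap (sumL L L') (A.inl L') _ _ (sumIsLeft L L') x := trivial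

theorem not_relMap_isLeft_inr {L L' : FirstOrder.Language.{0, 0}} (A : Str L') (x : Fin 0 → A) :
    ¬ @RelMap (sumL L L') (A.inr L) _ _ (sumIsLeft L L') x := fun h => h

theorem fo_isLeft (L L' : FirstOrder.Language.{0, 0}) (α : Type) :
    FO fun (A : Str (sumL L L')) (_ : α → A) => RelMap (sumIsLeft L L')
        (Fin.elim0 : Fin 0 → A) := by
  refine (FO.rel (α := α) (sumIsLeft L L') Fin.elim0).congr fun A x => ?_
  rw [Subsingleton.elim (fun j => x (Fin.elim0 j)) Fin.elim0]

/-- `P` defines exactly one element in every structure of the type `σ`. -/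
structure DefinesPoint (σ : MType) (P : ∀ A : Str σ.voc, A → Prop) : Prop where
  fo : FO fun A (x : Unit → A) => P A (x ())
  existsUnique : ∀ (a : σ.Val) (A : Str σ.voc), Represents σ A a → ∃! z, P A z

/-- The root of a multiset. -/
def IsRoot {L : FirstOrder.Language.{0, 0}} (A : Str (msetL L)) (x : A) : Prop :=
  ¬ RelMap (msetSim L) ![x, x]

theorem isRoot_iff {L : FirstOrder.Language.{0, 0}} [L.IsRelational] {ι : Type} {A : ι → Str L}
    {x : Option ((k : ι) × A k)} : IsRoot (Str.mset A) x ↔ x = none :=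
  (not_congr Interp.relMap_sim_self).trans not_not

theorem definesPoint_root (σ : MType) : DefinesPoint (.mset σ) (IsRoot (L := σ.voc)) := by
  have fo : FO fun (A : Str (msetL σ.voc)) (x : Unit → A) => IsRoot A (x ()) :=
    (FO.rel_two (msetSim σ.voc) () ()).not
  exact ⟨fo, fun a A h => fo.existsUnique_iso h ⟨none, isRoot_iff.2 rfl,
      fun x hx => isRoot_iff.1 hx⟩⟩

/-- For `1` there is only one element, and a multiset has its root. In a pair the point of the first
component is taken, and in a sum the name `isLeft` tells which of the two formulas to use. -/
theorem exists_definesPoint (σ : MType) : ∃ P, DefinesPoint σ P := by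
  induction σ with
  | one =>
    refine ⟨fun _ _ => True, FO.tru, fun a A h => ?_⟩
    exact FO.existsUnique_iso (P := fun _ _ => True) FO.tru h ⟨(), trivial, fun _ _ => rfl⟩
  | mset σ _ => exact ⟨_, definesPoint_root σ⟩
  | prod σ τ ih _ =>
    obtain ⟨P, hP⟩ := ih
    have fo := (Interp.fst σ.voc τ.voc).fo_elt_empty hP.fo ()
    let P' : ∀ A : Str (prodL σ.voc τ.voc), A → Prop := fun A z =>
      ∃ h : (Interp.fst σ.voc τ.voc).U () A Empty.elim fun _ => z,
        P _ ((Interp.fst σ.voc τ.voc).elt () _ h)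
    refine ⟨P', fo, fun p A h => FO.existsUnique_iso (P := P') fo h ?_⟩
    have := Interp.existsUnique_simple (hP.existsUnique p.1 _
      (Interp.fst_out (L' := τ.voc) (σ.toStr p.1) (τ.toStr p.2) Empty.elim))
    exact this
  | sum σ τ ih₁ ih₂ =>
    obtain ⟨P, hP⟩ := ih₁
    obtain ⟨Q, hQ⟩ := ih₂
    have foP := (Interp.outl σ.voc τ.voc).fo_elt_empty hP.fo ()
    have foQ := (Interp.outr σ.voc τ.voc).fo_elt_empty hQ.fo ()
    have fo := ((fo_isLeft σ.voc τ.voc Unit).and foP).or ((fo_isLeft σ.voc τ.voc Unit).not.and foQ)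
    let P' : ∀ A : Str (sumL σ.voc τ.voc), A → Prop := fun A z =>
      (RelMap (sumIsLeft σ.voc τ.voc) (Fin.elim0 : Fin 0 → A) ∧
        ∃ h : (Interp.outl σ.voc τ.voc).U () A Empty.elim fun _ => z,
          P _ ((Interp.outl σ.voc τ.voc).elt () _ h)) ∨
      (¬ RelMap (sumIsLeft σ.voc τ.voc) (Fin.elim0 : Fin 0 → A) ∧
        ∃ h : (Interp.outr σ.voc τ.voc).U () A Empty.elim fun _ => z,
          Q _ ((Interp.outr σ.voc τ.voc).elt () _ h))
    refine ⟨P', fo, fun p A h => FO.existsUnique_iso (P := P') fo h ?_⟩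
    rcases p with a | b
    · obtain ⟨z, hz, hu⟩ := Interp.existsUnique_simple
        (hP.existsUnique a _ (Interp.outl_out (L' := τ.voc) (σ.toStr a) Empty.elim))
      refine ⟨z, Or.inl ⟨relMap_isLeft_inl _ _, hz⟩, ?_⟩
      rintro w (⟨-, hw⟩ | ⟨hl, -⟩)
      · exact hu w hw
      · exact (hl (relMap_isLeft_inl _ _)).elim
    · obtain ⟨z, hz, hu⟩ := Interp.existsUnique_simple
        (hQ.existsUnique b _ (Interp.outr_out (L := σ.voc) (τ.toStr b) Empty.elim))
      refine ⟨z, Or.inr ⟨not_relMap_isLeft_inr _ _, hz⟩, ?_⟩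
      rintro w (⟨hl, -⟩ | ⟨-, hw⟩)
      · exact (not_relMap_isLeft_inr _ _ hl).elim
      · exact hu w hw

/-! ### Functions given by interpretations of uniform dimension -/

/-- `f` is given by an interpretation of uniform dimension. -/
def FOFun {σ τ : MType} (f : σ.Val → τ.Val) : Prop :=
  ∃ F : Interp σ.voc τ.voc Empty, ∀ (a : σ.Val) (A : Str σ.voc) (u : Empty → A),
    Represents σ A a → Represents τ (F.out A u) (f a)

/-- All structures that represent the same value are isomorphic and outputs respect isomorphism, so
one convenient structure for each value suffices. -/
theorem FOFun.intro {σ τ : MType} {f : σ.Val → τ.Val} (F : Interp σ.voc τ.voc Empty)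
    (h : ∀ a : σ.Val, ∃ A, Represents σ A a ∧ ∀ u : Empty → A, Represents τ (F.out A u) (f a)) :
    FOFun f := by
  refine ⟨F, fun a A u hA => ?_⟩
  obtain ⟨B, hB, h⟩ := h a
  obtain ⟨e⟩ := Str.Iso.trans hA (Str.Iso.symm hB)
  exact (h _).of_iso (F.out_iso e u)

theorem FOFun.isFOInterpretation {σ τ : MType} {f : σ.Val → τ.Val} (h : FOFun f) :
    IsFOInterpretation f := by
  obtain ⟨F, hF⟩ := h
  obtain ⟨n, ⟨e⟩⟩ := Finite.exists_equiv_fin F.D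
  choose φ hφ using F.foU
  choose ψ hψ using fun (n : ℕ) (R : τ.voc.Relations n) (i : Fin n → F.I) => F.foV R i
  let G : Interpretation σ.voc τ.voc :=
    { I := F.I
      finite_I := F.finI
      dim := fun _ => n
      univ := fun i => (φ i).relabel (Sum.elim Empty.elim e)
      rel := fun R i => (ψ _ R i).relabel (Sum.elim Empty.elim fun p => ⟨p.1, e p.2⟩) }
  refine ⟨G, fun a A hA => (hF a A Empty.elim hA).of_iso (Str.Iso.symm ?_)⟩
  have hU : ∀ i z, (G.univ i).Realize z ↔ F.U i A Empty.elim fun d => z (e d) := by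
    intro i z
    have aux : ∀ u : Empty → A, F.U i A u (fun d => z (e d)) ↔ F.U i A Empty.elim fun d => z
        (e d) :=
      fun u => by rw [Subsingleton.elim u Empty.elim]
    exact (Formula.realize_relabel.trans (hφ i A _)).trans (aux _)
  refine F.out_iso_of_code (B := G.out A) (fun b => (b.1, fun d => b.2.1 (e d))) ?_ ?_ ?_
  · rintro ⟨i, x, hx⟩ ⟨j, y, hy⟩ h
    obtain ⟨h₁, h₂⟩ := Prod.mk.inj h
    cases h₁
    obtain rfl : x = y := funext fun k => by
      have := congrFun h₂ (e.symm k)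
      simpa using this
    rfl
  · intro i x
    constructor
    · intro hx
      refine ⟨⟨i, fun k => x (e.symm k), (hU _ _).2 (by simpa using hx)⟩, ?_⟩
      simp
    · rintro ⟨⟨j, y, hy⟩, h⟩
      obtain ⟨h₁, h₂⟩ := Prod.mk.inj h
      cases h₁
      cases h₂
      exact (hU _ _).1 hy
  · intro k R y
    have aux : ∀ (u : Empty → A) (i : Fin k → F.I) z, F.V R i A u z ↔ F.V R i A Empty.elim z :=
      fun u i z => by rw [Subsingleton.elim u Empty.elim]
    exact Iff.symm ((Formula.realize_relabel.trans (hψ _ R _ A _)).trans (aux _ _ _))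

theorem FOFun.comp {σ₁ σ₂ σ₃ : MType} {f : σ₁.Val → σ₂.Val} {g : σ₂.Val → σ₃.Val}
    (hf : FOFun f) (hg : FOFun g) : FOFun fun a => g (f a) := by
  obtain ⟨F, hF⟩ := hf
  obtain ⟨G, hG⟩ := hg
  exact ⟨G.comp F, fun a A u hA => (hG _ _ _ (hF a A u hA)).of_iso (G.comp_out F A u)⟩

theorem FOFun.fst (σ τ : MType) :
    FOFun (σ := .prod σ τ) (τ := σ) (Prod.fst : σ.Val × τ.Val → σ.Val) :=
  FOFun.intro (σ := .prod σ τ) (Interp.fst σ.voc τ.voc) fun _ =>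
    ⟨_, represents_toStr _ _, fun u => Interp.fst_out _ _ u⟩

theorem FOFun.snd (σ τ : MType) :
    FOFun (σ := .prod σ τ) (τ := τ) (Prod.snd : σ.Val × τ.Val → τ.Val) :=
  FOFun.intro (σ := .prod σ τ) (Interp.snd σ.voc τ.voc) fun _ =>
    ⟨_, represents_toStr _ _, fun u => Interp.snd_out _ _ u⟩

theorem FOFun.id (σ : MType) : FOFun (σ := σ) (τ := σ) fun a => a :=
  FOFun.intro (Interp.simple (fun _ _ _ => True) (fun R _ _ x => RelMap R x) FO.tru
    fun _ R => FO.rel R Sum.inr) fun a => ⟨_, represents_toStr σ a, fun _ =>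
      Interp.simple_out (A := σ.toStr a) (B := σ.toStr a) (fun x => x) (fun _ _ h => h)
        (fun x => ⟨fun _ => ⟨x, rfl⟩, fun _ => trivial⟩) fun _ _ => Iff.rfl⟩

theorem FOFun.pairing {σ γ₁ γ₂ : MType} {f₁ : σ.Val → γ₁.Val} {f₂ : σ.Val → γ₂.Val}
    (h₁ : FOFun f₁) (h₂ : FOFun f₂) : FOFun (σ := σ) (τ := .prod γ₁ γ₂) fun a => (f₁ a, f₂ a) := by
  obtain ⟨F, hF⟩ := h₁
  obtain ⟨G, hG⟩ := h₂
  obtain ⟨P, hP⟩ := exists_definesPoint σ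
  obtain ⟨H, hH⟩ := F.exists_pair G hP.fo
  exact ⟨H, fun a A u hA =>
    (Represents.prod (hF a A u hA) (hG a A u hA)).of_iso (hH A u (hP.existsUnique a A hA))⟩

theorem FOFun.copairing {σ₁ σ₂ γ : MType} {f₁ : σ₁.Val → γ.Val} {f₂ : σ₂.Val → γ.Val}
    (h₁ : FOFun f₁) (h₂ : FOFun f₂) : FOFun (σ := .sum σ₁ σ₂) (τ := γ) (Sum.elim f₁ f₂) := by
  obtain ⟨F, hF⟩ := h₁
  obtain ⟨G, hG⟩ := h₂
  obtain ⟨P, hP⟩ := exists_definesPoint (.sum σ₁ σ₂)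
  obtain ⟨H, hH⟩ := Interp.exists_cond (fo_isLeft σ₁.voc σ₂.voc Empty)
    (F.comp (Interp.outl σ₁.voc σ₂.voc)) (G.comp (Interp.outr σ₁.voc σ₂.voc)) hP.fo
  refine FOFun.intro H fun a => ⟨_, represents_toStr _ a, fun u => ?_⟩
  obtain ⟨hl, hr⟩ := hH _ u (hP.existsUnique a _ (represents_toStr _ a))
  rcases a with a | b
  · exact (hF a _ _ (Interp.outl_out (σ₁.toStr a) u)).of_iso
      ((hl (relMap_isLeft_inl _ _)).trans (F.comp_out _ _ u))
  · exact (hG b _ _ (Interp.outr_out (σ₂.toStr b) u)).of_iso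
      ((hr (not_relMap_isLeft_inr _ _)).trans (G.comp_out _ _ u))

/-! ### Multisets indexed by their elements -/

section Bag

variable {σ τ : MType}

/-- Chooses one representative in each class: `S` says that `x` is the definable point of the
structure that `cls` extracts with `x` itself as the parameter. -/
theorem exists_fo_class_point {P : ∀ A : Str σ.voc, A → Prop} (hP : DefinesPoint σ P) :
    ∃ S : ∀ A : Str (msetL σ.voc), A → Prop, (FO fun A (x : Unit → A) => S A (x ())) ∧
      ∀ (ι : Type) (A : ι → Str σ.voc) (x : Option ((k : ι) × A k)),
        S (Str.mset A) x ↔ ∃ k a, x = some ⟨k, a⟩ ∧ P (A k) a := by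
  have fo := ((Interp.cls σ.voc).fo_elt hP.fo ()).relabel (γ := Unit) fun _ => ()
  refine ⟨fun A x => ∃ h : (Interp.cls σ.voc).U () A (fun _ => x) fun _ => x,
    P _ ((Interp.cls σ.voc).elt () _ h), fo, fun ι A x => ?_⟩
  rcases x with _ | ⟨k, a⟩
  · constructor
    · rintro ⟨h, -⟩
      exact (Interp.relMap_sim_self.1 h rfl).elim
    · rintro ⟨k, a, h, -⟩
      cases h
  · obtain ⟨e, h, he⟩ := Interp.cls_equiv k a
    have := hP.fo.iso e fun _ => a
    beta_reduce at this
    rw [he] at this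
    constructor
    · rintro ⟨_, h'⟩
      exact ⟨k, a, rfl, this.1 h'⟩
    · rintro ⟨k', a', e', ha⟩
      obtain rfl : k = k' := congrArg Sigma.fst (Option.some.inj e')
      obtain rfl : a = a' := eq_of_heq (Sigma.mk.inj (Option.some.inj e')).2
      exact ⟨h a, this.2 ha⟩

/-- The multiset of the outputs of `H` on all elements of a multiset. -/
theorem exists_bag (H : Interp (msetL σ.voc) τ.voc Unit) :
    ∃ F : Interp (msetL σ.voc) (msetL τ.voc) Empty, ∀ (ι : Type) (x : ι → σ.Val) (u)
        (B : ι → Str τ.voc),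
      (∀ k a, (H.out (Str.mset fun k => σ.toStr (x k)) fun _ => some ⟨k, a⟩).Iso (B k)) →
        (F.out (Str.mset fun k => σ.toStr (x k)) u).Iso (Str.mset B) := by
  obtain ⟨P, hP⟩ := exists_definesPoint σ
  obtain ⟨S, foS, hS⟩ := exists_fo_class_point hP
  refine ⟨H.bag S _ foS (definesPoint_root σ).fo, fun ι x u B hB => ?_⟩
  choose p hp hu using fun k => hP.existsUnique (x k) _ (represents_toStr σ (x k))
  refine (H.bag_out foS (definesPoint_root σ).fo _ u
    ⟨none, isRoot_iff.2 rfl, fun x hx => isRoot_iff.1 hx⟩).trans ?_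
  -- The definable points of the members put the elements that satisfy `S` in bijection with the
  -- index set.
  · let c : ι → {a // S (Str.mset fun k => σ.toStr (x k)) a} :=
      fun k => ⟨some ⟨k, p k⟩, (hS _ _ _).2 ⟨k, p k, rfl, hp k⟩⟩
    have hc : Function.Bijective c := by
      constructor
      · intro k k' h
        exact congrArg Sigma.fst (Option.some.inj (congrArg Subtype.val h))
      · rintro ⟨o, ho⟩
        obtain ⟨k, a, rfl, ha⟩ := (hS _ _ _).1 ho
        obtain rfl : a = p k := hu k a ha
        exact ⟨k, rfl⟩
    exact (Str.Iso.mset (Equiv.ofBijective c hc) fun k => (hB k (p k)).symm).symm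

open scoped Classical in
-- The interpretation of `f` is applied to the class of the parameter, and `bag` collects the
-- results.
theorem FOFun.mapping {f : σ.Val → τ.Val} (h : FOFun f) :
    FOFun (σ := .mset σ) (τ := .mset τ) (Multiset.map f) := by
  obtain ⟨F, hF⟩ := h
  obtain ⟨G, hG⟩ := exists_bag (F.comp (Interp.cls σ.voc))
  refine FOFun.intro (σ := .mset σ) (τ := .mset τ) G fun (s : Multiset σ.Val) =>
    ⟨_, represents_toStr _ _, fun u => ?_⟩
  have := Represents.mset (σ := τ) ((Enum.toType s).map f)
    fun k => hF k.1 _ Empty.elim (represents_toStr σ k.1)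
  refine this.of_iso (hG s (fun k => k.1) u _ fun k a => ?_)
  refine (F.comp_out _ _ _).trans ?_
  obtain ⟨e⟩ := Interp.cls_out (A := fun k : s => σ.toStr k.1) k a
  convert F.out_iso e fun b => b.elim using 1
  congr 1
  exact Subsingleton.elim _ _

open scoped Classical in
-- For every parameter, its class is paired with what `others` leaves of the multiset.
theorem FOFun.choices (σ : MType) :
    FOFun (σ := .mset σ) (τ := .mset (.prod σ (.mset σ))) (choices (α := σ.Val)) := by
  obtain ⟨H, hH⟩ := (Interp.cls σ.voc).exists_pair (Interp.others σ.voc) (definesPoint_root σ).fo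
  obtain ⟨G, hG⟩ := exists_bag (τ := .prod σ (.mset σ)) H
  refine FOFun.intro (σ := .mset σ) (τ := .mset (.prod σ (.mset σ))) G fun (s : Multiset σ.Val) =>
    ⟨_, represents_toStr _ _, fun u => ?_⟩
  have hs : ∀ k : s, Represents (.mset σ) (Str.mset fun i : {i // i ≠ k} => σ.toStr i.1.1)
      (s.erase k.1) := fun k =>
    Represents.mset ((Enum.toType s).erase k) fun i => represents_toStr σ _
  have := Represents.mset (σ := .prod σ (.mset σ))
    ((Enum.toType s).map fun a => ((a, s.erase a) : σ.Val × Multiset σ.Val))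
    fun k => Represents.prod (τ := .mset σ) (represents_toStr σ k.1) (hs k)
  refine this.of_iso (hG s (fun k => k.1) u _ fun k a => ?_)
  refine (hH _ _ ?_).trans (Str.Iso.prod
    (Interp.cls_out (A := fun k : s => σ.toStr k.1) k a)
    (Interp.others_out (A := fun k : s => σ.toStr k.1) k a))
  exact (definesPoint_root σ).existsUnique s _ (represents_toStr (.mset σ) s)

end Bag

/-! ### The prime functions are first-order interpretations -/

namespace Interp

variable (L L' L'' : FirstOrder.Language.{0, 0})

/-- The left coprojection. -/
abbrev inl : Interp L (sumL L L') Empty :=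
  simple (fun _ _ _ => True)
    (fun {n} R => match n, R with
      | _, .left R => fun _ _ x => RelMap R x
      | _, .right _ => fun _ _ _ => False
      | _, .isLeft => fun _ _ _ => True)
    FO.tru (by
      rintro n (R | R | _)
      · exact FO.rel R Sum.inr
      · exact FO.fls
      · exact FO.tru)

/-- The right coprojection. -/
abbrev inr : Interp L' (sumL L L') Empty :=
  simple (fun _ _ _ => True)
    (fun {n} R => match n, R with
      | _, .left _ => fun _ _ _ => False
      | _, .right R => fun _ _ x => RelMap R x
      | _, .isLeft => fun _ _ _ => False)
    FO.tru (by
      rintro n (R | R | _)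
      · exact FO.fls
      · exact FO.rel R Sum.inr
      · exact FO.fls)

/-- Distributivity. -/
abbrev dist : Interp (prodL L (sumL L' L'')) (sumL (prodL L L') (prodL L L'')) Empty :=
  simple (fun _ _ _ => True)
    (fun {n} R => match n, R with
      -- Names of `L` are duplicated in the output, and the copy in the wrong summand has to be
      -- empty; hence the test of `isLeft`. Names of `L'` and `L''` need no guard, as the input
      -- structure already makes them empty in the other case.
      | _, .left (.left R) => fun A _ x => RelMap (prodLeft (sumL L' L'') R) x ∧
          RelMap (prodRight L (sumIsLeft L' L'')) (Fin.elim0 : Fin 0 → A)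
      | _, .left (.right R) => fun _ _ x => RelMap (prodRight L (sumLeft L'' R)) x
      | _, .left .fromLeft => fun A _ x => RelMap (prodFromLeft L (sumL L' L'')) x ∧
          RelMap (prodRight L (sumIsLeft L' L'')) (Fin.elim0 : Fin 0 → A)
      | _, .right (.left R) => fun A _ x => RelMap (prodLeft (sumL L' L'') R) x ∧
          ¬ RelMap (prodRight L (sumIsLeft L' L'')) (Fin.elim0 : Fin 0 → A)
      | _, .right (.right R) => fun _ _ x => RelMap (prodRight L (sumRight L' R)) x
      | _, .right .fromLeft => fun A _ x => RelMap (prodFromLeft L (sumL L' L'')) x ∧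
          ¬ RelMap (prodRight L (sumIsLeft L' L'')) (Fin.elim0 : Fin 0 → A)
      | _, .isLeft => fun _ _ x => RelMap (prodRight L (sumIsLeft L' L'')) x)
    FO.tru (by
      have h : ∀ α : Type, FO fun (A : Str (prodL L (sumL L' L''))) (_ : α → A) =>
          RelMap (prodRight L (sumIsLeft L' L'')) (Fin.elim0 : Fin 0 → A) := fun α => by
        refine (FO.rel (α := α) (prodRight L (sumIsLeft L' L'')) Fin.elim0).congr fun A x => ?_
        rw [Subsingleton.elim (fun j => x (Fin.elim0 j)) Fin.elim0]
      rintro n ((R | R | _) | (R | R | _) | _)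
      · exact (FO.rel (prodLeft (sumL L' L'') R) Sum.inr).and (h _)
      · exact FO.rel (prodRight L (sumLeft L'' R)) Sum.inr
      · exact (FO.rel (prodFromLeft L (sumL L' L'')) Sum.inr).and (h _)
      · exact (FO.rel (prodLeft (sumL L' L'') R) Sum.inr).and (h _).not
      · exact FO.rel (prodRight L (sumRight L' R)) Sum.inr
      · exact (FO.rel (prodFromLeft L (sumL L' L'')) Sum.inr).and (h _).not
      · exact FO.rel (prodRight L (sumIsLeft L' L'')) Sum.inr)

/-- The empty multiset. -/
abbrev empty [L.IsRelational] (P : ∀ A : Str L, A → Prop)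
    (foP : FO fun A (x : Unit → A) => P A (x ())) : Interp L (msetL L') Empty :=
  simple (fun A _ x => P A x) (fun _ _ _ _ => False) (foP.relabel fun _ => Sum.inr ())
    fun _ _ => FO.fls

/-- Adding an element to a multiset. -/
abbrev add : Interp (prodL L (msetL L)) (msetL L) Empty :=
  simple (fun _ _ _ => True)
    (fun {n} R => match n, R with
      -- A `0`-ary relation of the added member spreads over all its elements. The universe is
      -- unchanged: the old root serves as the root of the larger multiset.
      | _, .unary R => fun A _ x => (RelMap (prodFromLeft L (msetL L)) ![x 0] ∧
            RelMap (prodLeft (msetL L) R) (Fin.elim0 : Fin 0 → A)) ∨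
          RelMap (prodRight L (msetUnary R)) x
      | _, .keep R => fun _ _ x => RelMap (prodLeft (msetL L) R) x ∨
          RelMap (prodRight L (msetKeep R)) x
      | _, .sim => fun _ _ x => (RelMap (prodFromLeft L (msetL L)) ![x 0] ∧
            RelMap (prodFromLeft L (msetL L)) ![x 1]) ∨
          RelMap (prodRight L (msetSim L)) x)
    FO.tru (by
      rintro n (R | R | _)
      · refine ((FO.rel_one _ _).and ((FO.rel (prodLeft (msetL L) R) Fin.elim0).congr
          fun A x => ?_)).or (FO.rel (prodRight L (msetUnary R)) Sum.inr)
        rw [Subsingleton.elim (fun j => x (Fin.elim0 j)) Fin.elim0]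
      · exact (FO.rel (prodLeft (msetL L) R) Sum.inr).or (FO.rel (prodRight L (msetKeep R)) Sum.inr)
      · exact ((FO.rel_one _ _).and (FO.rel_one _ _)).or (FO.rel (prodRight L (msetSim L)) Sum.inr))

/-- The union of a multiset of multisets. -/
abbrev union : Interp (msetL (msetL L)) (msetL L) Empty :=
  -- Removes exactly the inner roots, which are self-related for the outer `∼` but not for the inner
  -- one; the outer root is self-related for neither and stays.
  simple (fun _ _ x => RelMap (msetSim (msetL L)) ![x, x] →
      RelMap (msetKeep (L := msetL L) (msetSim L)) ![x, x])
    (fun {n} R => match n, R with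
      | _, .unary R => fun _ _ x => RelMap (msetKeep (L := msetL L) (msetUnary R)) x
      | _, .keep R => fun _ _ x => RelMap (msetKeep (L := msetL L) (msetKeep R)) x
      | _, .sim => fun _ _ x => RelMap (msetKeep (L := msetL L) (msetSim L)) x)
    ((FO.rel_two _ _ _).imp (FO.rel_two _ _ _)) (by
      rintro n (R | R | _)
      · exact FO.rel (msetKeep (L := msetL L) (msetUnary R)) Sum.inr
      · exact FO.rel (msetKeep (L := msetL L) (msetKeep R)) Sum.inr
      · exact FO.rel (msetKeep (L := msetL L) (msetSim L)) Sum.inr)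

/-- The multiset has exactly one element. -/
def IsSingleton {L : FirstOrder.Language.{0, 0}} (A : Str (msetL L)) : Prop :=
  ∃ x : A, RelMap (msetSim L) ![x, x] ∧
    ∀ y, RelMap (msetSim L) ![y, y] → RelMap (msetSim L) ![x, y]

theorem fo_isSingleton (α : Type) : FO fun (A : Str (msetL L)) (_ : α → A) => IsSingleton A :=
  FO.ex ((FO.rel_two _ _ _).and (FO.all ((FO.rel_two _ _ _).imp (FO.rel_two _ _ _))))

/-- The elements of the elements of a multiset. -/
abbrev content : Interp (msetL L) L Empty :=
  simple (fun _ _ x => RelMap (msetSim L) ![x, x])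
    (fun {n} => match n with
      | 0 => fun R A _ _ => ∃ x : A, RelMap (msetUnary R) ![x]
      | _ + 1 => fun R _ _ x => RelMap (msetKeep R) x)
    (FO.rel_two _ _ _)
    (fun n => match n with
      | 0 => fun R => FO.ex (FO.rel_one (msetUnary R) none)
      | _ + 1 => fun R => FO.rel (msetKeep R) Sum.inr)

variable {L L' L''} [L.IsRelational] [L'.IsRelational] [L''.IsRelational]

theorem inl_out (A : Str L) (u) : ((inl L L').out A u).Iso (A.inl L') := by
  refine simple_out (A := A) (B := A.inl L') (fun a => a) (fun _ _ h => h)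
    (fun x => ⟨fun _ => ⟨x, rfl⟩, fun _ => trivial⟩) ?_
  rintro _ (_ | _ | _) _ <;> exact Iff.rfl

theorem inr_out (A : Str L') (u) : ((inr L L').out A u).Iso (A.inr L) := by
  refine simple_out (A := A) (B := A.inr L) (fun a => a) (fun _ _ h => h)
    (fun x => ⟨fun _ => ⟨x, rfl⟩, fun _ => trivial⟩) ?_
  rintro _ (_ | _ | _) _ <;> exact Iff.rfl

theorem dist_out_inl (A : Str L) (B : Str L') (u) :
    ((dist L L' L'').out (A.prod (B.inl L'')) u).Iso ((A.prod B).inl (prodL L L'')) := by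
  refine simple_out (A := A.prod (B.inl L'')) (B := (A.prod B).inl (prodL L L''))
    (fun a => a) (fun _ _ h => h) (fun x => ⟨fun _ => ⟨x, rfl⟩, fun _ => trivial⟩) ?_
  have hl : @RelMap (prodL L (sumL L' L'')) (A.prod (B.inl L'')) _ _
      (prodRight L (sumIsLeft L' L'')) Fin.elim0 :=
    ⟨Fin.elim0, Subsingleton.elim _ _, trivial⟩
  rintro _ ((_ | _ | _) | (_ | _ | _) | _) x
  · exact ⟨fun h => h.1, fun h => ⟨h, hl⟩⟩
  · exact Iff.rfl
  · exact ⟨fun h => h.1, fun h => ⟨h, hl⟩⟩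
  · exact ⟨fun h => (h.2 hl).elim, fun h => h.elim⟩
  · exact ⟨fun ⟨_, _, h⟩ => h, fun h => h.elim⟩
  · exact ⟨fun h => (h.2 hl).elim, fun h => h.elim⟩
  · exact ⟨fun _ => trivial, fun _ => ⟨Fin.elim0, Subsingleton.elim _ _, trivial⟩⟩

theorem dist_out_inr (A : Str L) (B : Str L'') (u) :
    ((dist L L' L'').out (A.prod (B.inr L')) u).Iso ((A.prod B).inr (prodL L L')) := by
  refine simple_out (A := A.prod (B.inr L')) (B := (A.prod B).inr (prodL L L'))
    (fun a => a) (fun _ _ h => h) (fun x => ⟨fun _ => ⟨x, rfl⟩, fun _ => trivial⟩) ?_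
  have hl : ∀ x, ¬ @RelMap (prodL L (sumL L' L'')) (A.prod (B.inr L')) _ _
      (prodRight L (sumIsLeft L' L'')) x := by
    rintro x ⟨_, _, h⟩
    exact h
  rintro _ ((_ | _ | _) | (_ | _ | _) | _) x
  · exact ⟨fun h => (hl _ h.2).elim, fun h => h.elim⟩
  · exact ⟨fun ⟨_, _, h⟩ => h, fun h => h.elim⟩
  · exact ⟨fun h => (hl _ h.2).elim, fun h => h.elim⟩
  · exact ⟨fun h => h.1, fun h => ⟨h, hl _⟩⟩
  · exact Iff.rfl
  · exact ⟨fun h => h.1, fun h => ⟨h, hl _⟩⟩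
  · exact ⟨fun h => (hl _ h).elim, fun h => h.elim⟩

theorem empty_out {P : ∀ A : Str L, A → Prop} (foP : FO fun A (x : Unit → A) => P A (x ()))
    (A : Str L) (u) (h : ∃! a, P A a) {ι : Type} [IsEmpty ι] (B : ι → Str L') :
    ((empty L L' P foP).out A u).Iso (Str.mset B) := by
  obtain ⟨a, ha, hu⟩ := h
  have hB : ∀ o : Option ((i : ι) × B i), o = none := by
    rintro (_ | p)
    · rfl
    · exact isEmptyElim p.1
  refine simple_out (A := A) (B := Str.mset B) (fun _ => a) ?_ ?_ ?_
  · exact fun x y _ => (hB x).trans (hB y).symm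
  · exact fun x => ⟨fun h => ⟨none, (hu x h).symm⟩, fun ⟨_, h⟩ => h ▸ ha⟩
  · intro n R y
    refine ⟨False.elim, fun h => ?_⟩
    cases R with
    | unary R => exact isEmptyElim h.choose
    | keep R => exact isEmptyElim h.choose
    | sim => exact isEmptyElim h.choose

theorem add_out {ι : Type} (A : Str L) (B : ι → Str L) (u) :
    ((add L).out (A.prod (Str.mset B)) u).Iso (Str.mset fun o : Option ι => o.elim A B) := by
  let j : Option ((o : Option ι) × (o.elim A B : Str L)) → A ⊕ Option ((i : ι) × B i) :=
    fun x => match x with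
    | none => Sum.inr none
    | some ⟨none, a⟩ => Sum.inl a
    | some ⟨some i, b⟩ => Sum.inr (some ⟨i, b⟩)
  have h₁ : ∀ x a, j x = Sum.inl a → x = some ⟨none, a⟩ := by
    rintro (_ | ⟨_ | i, b⟩) a h
    · cases h
    · cases h
      rfl
    · cases h
  have h₂ : ∀ x i b, j x = Sum.inr (some ⟨i, b⟩) → x = some ⟨some i, b⟩ := by
    rintro (_ | ⟨_ | i, b⟩) i' b' h
    · cases h
    · cases h
    · cases h
      rfl
  have h₃ : ∀ x, j x = Sum.inr none → x = none := by
    rintro (_ | ⟨_ | i, b⟩) h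
    · rfl
    · cases h
    · cases h
  refine simple_out (A := A.prod (Str.mset B)) (B := Str.mset fun o : Option ι => o.elim A B)
    j ?_ ?_ ?_
  · rintro (_ | ⟨_ | i, b⟩) y h
    · exact (h₃ y h.symm).symm
    · exact (h₁ y _ h.symm).symm
    · exact (h₂ y _ _ h.symm).symm
  · rintro (a | _ | ⟨i, b⟩)
    · exact ⟨fun _ => ⟨some ⟨none, a⟩, rfl⟩, fun _ => trivial⟩
    · exact ⟨fun _ => ⟨none, rfl⟩, fun _ => trivial⟩
    · exact ⟨fun _ => ⟨some ⟨some i, b⟩, rfl⟩, fun _ => trivial⟩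
  · intro n R y
    cases R with
    | unary R =>
      constructor
      · rintro (⟨⟨a, ha⟩, z, -, hR⟩ | ⟨z, hz, i, b, hb, hR⟩)
        · obtain rfl : z = Fin.elim0 := Subsingleton.elim _ _
          exact ⟨none, a, h₁ _ _ ha, hR⟩
        · exact ⟨some i, b, h₂ _ _ _ ((congrFun hz 0).trans (congrArg Sum.inr hb)), hR⟩
      · rintro ⟨_ | i, b, hb, hR⟩
        · exact Or.inl ⟨⟨b, congrArg j hb⟩, Fin.elim0, Subsingleton.elim _ _, hR⟩
        · exact Or.inr ⟨fun _ => some ⟨i, b⟩, funext fun k => (congrArg (fun k => j (y k))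
            (Subsingleton.elim k 0)).trans (congrArg j hb), i, b, rfl, hR⟩
    | keep R =>
      constructor
      · rintro (⟨z, hz, hR⟩ | ⟨z, hz, i, b, hb, hR⟩)
        · exact ⟨none, z, fun k => h₁ _ _ (congrFun hz k), hR⟩
        · exact ⟨some i, b, fun k => h₂ _ _ _ ((congrFun hz k).trans (congrArg Sum.inr (hb k))), hR⟩
      · rintro ⟨_ | i, b, hb, hR⟩
        · exact Or.inl ⟨b, funext fun k => congrArg j (hb k), hR⟩
        · exact Or.inr ⟨fun k => some ⟨i, b k⟩, funext fun k => congrArg j (hb k),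
            i, b, fun _ => rfl, hR⟩
    | sim =>
      constructor
      · rintro (⟨⟨a, ha⟩, a', ha'⟩ | ⟨z, hz, i, b, b', hb, hb'⟩)
        · exact ⟨none, a, a', h₁ _ _ ha, h₁ _ _ ha'⟩
        · exact ⟨some i, b, b', h₂ _ _ _ ((congrFun hz 0).trans (congrArg Sum.inr hb)),
            h₂ _ _ _ ((congrFun hz 1).trans (congrArg Sum.inr hb'))⟩
      · rintro ⟨_ | i, b, b', hb, hb'⟩
        · exact Or.inl ⟨⟨b, congrArg j hb⟩, b', congrArg j hb'⟩
        · refine Or.inr ⟨![some ⟨i, b⟩, some ⟨i, b'⟩], funext fun k => ?_, i, b, b', rfl, rfl⟩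
          fin_cases k
          · exact congrArg j hb
          · exact congrArg j hb'

theorem union_out {ι : Type} {κ : ι → Type} (A : ∀ i, κ i → Str L) (u) :
    ((union L).out (Str.mset fun i => Str.mset (A i)) u).Iso
      (Str.mset fun p : (i : ι) × κ i => A p.1 p.2) := by
  let j : Option ((p : (i : ι) × κ i) × A p.1 p.2) →
      Option ((i : ι) × Option ((k : κ i) × A i k)) :=
    Option.map fun q => ⟨q.1.1, some ⟨q.1.2, q.2⟩⟩
  let w (i : ι) : Option ((k : κ i) × A i k) → Option ((i : ι) × Option ((k : κ i) × A i k)) :=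
    fun q => some ⟨i, q⟩
  have hj : ∀ x i k a, j x = some ⟨i, some ⟨k, a⟩⟩ → x = some ⟨⟨i, k⟩, a⟩ := by
    rintro (_ | ⟨⟨i, k⟩, a⟩) i' k' a' h
    · cases h
    · cases h
      rfl
  refine simple_out (A := Str.mset fun i => Str.mset (A i))
    (B := Str.mset fun p : (i : ι) × κ i => A p.1 p.2) j ?_ ?_ ?_
  · rintro (_ | ⟨⟨i, k⟩, a⟩) y h
    · cases y with
      | none => rfl
      | some q => cases h
    · exact (hj y _ _ _ h.symm).symm
  · rintro (_ | ⟨i, _ | ⟨k, a⟩⟩)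
    · exact ⟨fun _ => ⟨none, rfl⟩, fun _ h => (relMap_sim_self.1 h rfl).elim⟩
    · constructor
      · intro h
        obtain ⟨i', y, hy, h'⟩ := h (relMap_sim_self.2 (by simp))
        obtain ⟨k, a, -, h₀, -⟩ := h'
        have h₁ := hy 0
        rw [h₀] at h₁
        cases h₁
      · rintro ⟨_ | q, h⟩
        · cases h
        · cases h
    · refine ⟨fun _ => ⟨some ⟨⟨i, k⟩, a⟩, rfl⟩, fun _ _ => ⟨i, fun _ => some ⟨k, a⟩, fun l => ?_,
        k, a, a, rfl, rfl⟩⟩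
      fin_cases l <;> rfl
  · intro n R y
    cases R with
    | unary R =>
      constructor
      · rintro ⟨i, z, hz, k, a, ha, hR⟩
        exact ⟨⟨i, k⟩, a, hj _ _ _ _ ((hz 0).trans (congrArg (w i) ha)), hR⟩
      · rintro ⟨⟨i, k⟩, a, ha, hR⟩
        refine ⟨i, fun _ => some ⟨k, a⟩, fun l => ?_, k, a, rfl, hR⟩
        fin_cases l
        exact congrArg j ha
    | keep R =>
      constructor
      · rintro ⟨i, z, hz, k, a, ha, hR⟩
        exact ⟨⟨i, k⟩, a, fun l => hj _ _ _ _ ((hz l).trans (congrArg (w i) (ha l))), hR⟩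
      · rintro ⟨⟨i, k⟩, a, ha, hR⟩
        exact ⟨i, fun l => some ⟨k, a l⟩, fun l => congrArg j (ha l), k, a, fun _ => rfl, hR⟩
    | sim =>
      constructor
      · rintro ⟨i, z, hz, k, a, b, ha, hb⟩
        exact ⟨⟨i, k⟩, a, b, hj _ _ _ _ ((hz 0).trans (congrArg (w i) ha)), hj _ _ _ _
            ((hz 1).trans (congrArg (w i) hb))⟩
      · rintro ⟨⟨i, k⟩, a, b, ha, hb⟩
        refine ⟨i, ![some ⟨k, a⟩, some ⟨k, b⟩], fun l => ?_, k, a, b, rfl, rfl⟩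
        fin_cases l
        · exact congrArg j ha
        · exact congrArg j hb

/-- Nonemptiness provides an element at which a true `0`-ary relation of the only member can be
observed. -/
theorem content_out {ι : Type} [Unique ι] (A : ι → Str L) (h : ∀ i, Nonempty (A i)) (u) :
    ((content L).out (Str.mset A) u).Iso (A default) := by
  have inj : Function.Injective fun b : A default => (some ⟨default, b⟩ : Option ((k : ι) × A k)) :=
    fun b b' h => eq_of_heq (Sigma.mk.inj (Option.some.inj h)).2
  refine simple_out (A := Str.mset A) (B := A default) (fun b => some ⟨default, b⟩) inj ?_ ?_
  · rintro (_ | ⟨k, a⟩)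
    · refine iff_of_false (fun h => relMap_sim_self.1 h rfl) ?_
      rintro ⟨b, h⟩
      cases h
    · obtain rfl : k = default := Subsingleton.elim _ _
      exact iff_of_true (relMap_sim_self.2 (by simp)) ⟨a, rfl⟩
  · rintro (_ | n) R y
    · constructor
      · rintro ⟨_, k, a, -, hR⟩
        obtain rfl : k = default := Subsingleton.elim _ _
        convert hR
      · intro hR
        obtain ⟨a⟩ := h default
        refine ⟨some ⟨default, a⟩, default, a, rfl, ?_⟩
        convert hR
    · constructor
      · rintro ⟨k, z, h, hR⟩
        obtain rfl : k = default := Subsingleton.elim _ _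
        obtain rfl : y = z := funext fun j => inj (h j)
        exact hR
      · exact fun hR => ⟨default, y, fun _ => rfl, hR⟩

/-- Every member is nonempty and thus visible as a class, so the number of classes is the number of
occurrences. -/
theorem isSingleton_mset_iff {ι : Type} (A : ι → Str L) (h : ∀ i, Nonempty (A i)) :
    IsSingleton (Str.mset A) ↔ Nonempty (Unique ι) := by
  constructor
  · rintro ⟨_ | ⟨k, a⟩, h₁, h₂⟩
    · exact (relMap_sim_self.1 h₁ rfl).elim
    · refine ⟨⟨⟨k⟩, fun i => ?_⟩⟩
      obtain ⟨b⟩ := h i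
      obtain ⟨c, hc⟩ := relMap_sim_some.1 (h₂ (some ⟨i, b⟩) (relMap_sim_self.2 (by simp)))
      exact congrArg Sigma.fst (Option.some.inj hc)
  · rintro ⟨_⟩
    obtain ⟨a⟩ := h default
    refine ⟨some ⟨default, a⟩, relMap_sim_self.2 (by simp), ?_⟩
    rintro (_ | ⟨i, b⟩) h
    · exact (relMap_sim_self.1 h rfl).elim
    · obtain rfl : i = default := Subsingleton.elim _ _
      exact relMap_sim_some.2 ⟨b, rfl⟩

/-- The only element of `1`. -/
abbrev unit (P : ∀ A : Str L, A → Prop) (foP : FO fun A (x : Unit → A) => P A (x ())) :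
    Interp L FirstOrder.Language.empty Empty :=
  simple (fun A _ x => P A x) (fun _ _ _ _ => False) (foP.relabel fun _ => Sum.inr ())
    fun _ _ => FO.fls

theorem unit_out {P : ∀ A : Str L, A → Prop} (foP : FO fun A (x : Unit → A) => P A (x ()))
    (A : Str L) (u) (h : ∃! a, P A a) : ((unit P foP).out A u).Iso Str.unit := by
  obtain ⟨a, ha, hu⟩ := h
  exact simple_out (A := A) (B := Str.unit) (fun _ => a) (fun _ _ _ => rfl)
    (fun x => ⟨fun h => ⟨(), (hu x h).symm⟩, fun ⟨_, h⟩ => h ▸ ha⟩) fun R => isEmptyElim R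

end Interp

/-! ### Prime functions on values, and the induction over derivations -/

theorem nonempty_toStr (σ : MType) (a : σ.Val) : Nonempty (σ.toStr a) := by
  obtain ⟨P, hP⟩ := exists_definesPoint σ
  exact ⟨(hP.existsUnique a _ (represents_toStr σ a)).choose⟩

theorem FOFun.inl (σ τ : MType) :
    FOFun (σ := σ) (τ := .sum σ τ) (Sum.inl : σ.Val → σ.Val ⊕ τ.Val) :=
  FOFun.intro (τ := .sum σ τ) (Interp.inl σ.voc τ.voc) fun a =>
    ⟨_, represents_toStr σ a, fun u => Interp.inl_out _ u⟩

theorem FOFun.inr (σ τ : MType) :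
    FOFun (σ := τ) (τ := .sum σ τ) (Sum.inr : τ.Val → σ.Val ⊕ τ.Val) :=
  FOFun.intro (τ := .sum σ τ) (Interp.inr σ.voc τ.voc) fun a =>
    ⟨_, represents_toStr τ a, fun u => Interp.inr_out _ u⟩

theorem FOFun.dist (σ σ₁ σ₂ : MType) :
    FOFun (σ := .prod σ (.sum σ₁ σ₂)) (τ := .sum (.prod σ σ₁) (.prod σ σ₂))
      (dist (α := σ.Val) (β := σ₁.Val) (γ := σ₂.Val)) := by
  refine FOFun.intro (σ := .prod σ (.sum σ₁ σ₂)) (τ := .sum (.prod σ σ₁) (.prod σ σ₂))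
    (Interp.dist σ.voc σ₁.voc σ₂.voc) fun p => ⟨_, represents_toStr _ p, fun u => ?_⟩
  rcases p with ⟨a, b | c⟩
  · exact Interp.dist_out_inl _ _ u
  · exact Interp.dist_out_inr _ _ u

theorem FOFun.empty : FOFun (σ := .one) (τ := .mset .one) empty := by
  obtain ⟨P, hP⟩ := exists_definesPoint .one
  refine FOFun.intro (σ := .one) (τ := .mset .one)
    (Interp.empty (MType.voc .one) (MType.voc .one) P hP.fo) fun a =>
    ⟨_, represents_toStr .one a, fun u => ?_⟩
  exact (Represents.mset (σ := .one) (ι := Empty) (x := Empty.elim) (A := Empty.elim)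
    Enum.of_isEmpty fun i => i.elim).of_iso
      (Interp.empty_out hP.fo _ u (hP.existsUnique a _ (represents_toStr .one a)) _)

open scoped Classical in
theorem FOFun.add (σ : MType) :
    FOFun (σ := .prod σ (.mset σ)) (τ := .mset σ) (add (α := σ.Val)) := by
  refine FOFun.intro (σ := .prod σ (.mset σ)) (τ := .mset σ) (Interp.add σ.voc)
    fun (p : σ.Val × Multiset σ.Val) =>
    ⟨_, represents_toStr (.prod σ (.mset σ)) p, fun u => ?_⟩
  have := Represents.mset (σ := σ) (A := fun o => o.elim (σ.toStr p.1) fun k => σ.toStr k.1)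
    (Enum.option (w := fun o : Option p.2 => o.elim p.1 fun k => k.1) (Enum.toType p.2)) fun o => by
      cases o <;> exact represents_toStr σ _
  exact this.of_iso (Interp.add_out _ _ u)

open scoped Classical in
theorem FOFun.union (σ : MType) :
    FOFun (σ := .mset (.mset σ)) (τ := .mset σ) (union (α := σ.Val)) := by
  refine FOFun.intro (σ := .mset (.mset σ)) (τ := .mset σ) (Interp.union σ.voc)
    fun (s : Multiset (MType.mset σ).Val) =>
    ⟨_, represents_toStr (.mset (.mset σ)) s, fun u => ?_⟩
  have := Represents.mset (σ := σ) ((Enum.toType s).join fun k => Enum.toType (X := σ.Val) k.1)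
    fun p => represents_toStr σ p.2.1
  exact this.of_iso
    (Interp.union_out (κ := fun k : s => Multiset.ToType (α := σ.Val) k.1)
        (fun k l => σ.toStr l.1) _)

open scoped Classical in
theorem FOFun.deSingleton (σ : MType) :
    FOFun (σ := .mset σ) (τ := .sum .one σ) (deSingleton (α := σ.Val)) := by
  obtain ⟨H, hH⟩ := Interp.exists_cond (Interp.fo_isSingleton σ.voc Empty)
    ((Interp.inr (MType.voc .one) σ.voc).comp (Interp.content σ.voc))
    ((Interp.inl (MType.voc .one) σ.voc).comp (Interp.unit _ (definesPoint_root σ).fo))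
    (definesPoint_root σ).fo
  refine FOFun.intro (σ := .mset σ) (τ := .sum .one σ) H fun (s : Multiset σ.Val) =>
    ⟨_, represents_toStr (.mset σ) s, fun u => ?_⟩
  have hr := (definesPoint_root σ).existsUnique s _ (represents_toStr (.mset σ) s)
  obtain ⟨h₁, h₂⟩ := hH _ u hr
  have ne : ∀ k : s, Nonempty (σ.toStr k.1) := fun k => nonempty_toStr σ k.1
  have hs := Interp.isSingleton_mset_iff (fun k : s => σ.toStr k.1) ne
  by_cases h : ∃ a, s = {a}
  · have e : MultisetTypes.deSingleton s = Sum.inr h.choose := dif_pos h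
    have hc := h.choose_spec
    have hn : Nonempty (Unique s) := by
      rw [← Fintype.card_eq_one_iff_nonempty_unique, Multiset.card_coe, hc, Multiset.card_singleton]
    have := Classical.choice hn
    -- The unique occurrence in `s` carries the value that `deSingleton` selects.
    have hd : (default : s).1 = h.choose := by
      have := Multiset.coe_mem (x := (default : s))
      exact Multiset.mem_singleton.1 (hc ▸ this)
    refine Represents.congr (σ := .sum .one σ) ?_ e.symm
    refine Represents.of_iso ?_ ((h₁ (hs.2 hn)).trans (Interp.comp_out _ _ _ _))
    refine Represents.of_iso (Represents.inr (σ := .one) ?_) (Interp.inr_out _ _)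
    exact (hd ▸ represents_toStr σ _ : Represents σ (σ.toStr (default : s).1) h.choose).of_iso
      (Interp.content_out (fun k : s => σ.toStr k.1) ne u)
  · have e : MultisetTypes.deSingleton s = Sum.inl () := dif_neg h
    have hn : ¬ Nonempty (Unique s) := by
      intro hn
      have := Classical.choice hn
      exact h ⟨(default : s).1, (Enum.toType s).eq Enum.of_unique (Equiv.refl s) fun _ => rfl⟩
    refine Represents.congr (σ := .sum .one σ) ?_ e.symm
    refine Represents.of_iso ?_ ((h₂ fun h => hn (hs.1 h)).trans (Interp.comp_out _ _ _ _))
    refine Represents.of_iso (Represents.inl (σ := .one) (A := Str.unit) (represents_toStr .one ()))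
      ((Interp.inl_out _ _).trans (Str.Iso.inl ?_))
    exact Interp.unit_out _ _ _ hr

theorem Derivable.foFun {σ τ : MType} {f : σ.Val → τ.Val} (h : Derivable f) : FOFun f := by
  induction h with
  | union σ => exact FOFun.union σ
  | add σ => exact FOFun.add σ
  | choices σ => exact FOFun.choices σ
  | deSingleton σ => exact FOFun.deSingleton σ
  | empty => exact FOFun.empty
  | id σ => exact FOFun.id σ
  | fst σ τ => exact FOFun.fst σ τ
  | snd σ τ => exact FOFun.snd σ τ
  | inl σ τ => exact FOFun.inl σ τ
  | inr σ τ => exact FOFun.inr σ τ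
  | dist σ σ₁ σ₂ => exact FOFun.dist σ σ₁ σ₂
  | pairing _ _ h₁ h₂ => exact h₁.pairing h₂
  | copairing _ _ h₁ h₂ => exact h₁.copairing h₂
  | mapping _ h => exact h.mapping
  | comp _ _ h₁ h₂ => exact h₁.comp h₂

/-! ### Derived operations on derivable functions -/

section Toolkit

variable {ρ σ τ γ : MType}

theorem Derivable.congr {f g : σ.Val → τ.Val} (h : Derivable f) (e : ∀ a, f a = g a) :
    Derivable g := funext e ▸ h

/-- No prime function maps an arbitrary type to `1`. On multisets, mapping to `M1` followed by
de-singleton lands in `1 + 1`, which co-pairing collapses. -/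
theorem Derivable.terminal : ∀ σ : MType, Derivable (σ := σ) (τ := .one) fun _ => ()
  | .one => .id _
  | .sum σ τ => (Derivable.copairing (terminal σ) (terminal τ)).congr fun a => by
      rcases a with a | a <;> rfl
  | .prod σ τ => (Derivable.fst σ τ).comp (terminal σ)
  | .mset σ => ((terminal σ).mapping.comp (Derivable.deSingleton .one)).comp
      (Derivable.copairing (Derivable.id .one) (Derivable.id .one))

theorem exists_derivable_const : ∀ τ : MType, ∃ d : τ.Val, ∀ σ, Derivable (σ := σ) (τ := τ)
    fun _ => d
  | .one => ⟨(), Derivable.terminal⟩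
  | .sum τ τ' => by
    obtain ⟨d, hd⟩ := exists_derivable_const τ
    exact ⟨(Sum.inl d : τ.Val ⊕ τ'.Val), fun σ => (hd σ).comp (Derivable.inl τ τ')⟩
  | .prod τ τ' => by
    obtain ⟨d, hd⟩ := exists_derivable_const τ
    obtain ⟨d', hd'⟩ := exists_derivable_const τ'
    exact ⟨((d, d') : τ.Val × τ'.Val), fun σ => (hd σ).pairing (hd' σ)⟩
  | .mset τ => by
    obtain ⟨d, hd⟩ := exists_derivable_const τ
    exact ⟨(0 : Multiset τ.Val), fun σ =>
      ((Derivable.terminal σ).comp Derivable.empty).comp (hd .one).mapping⟩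

/-- The empty multiset is a prime function only over `1`; mapping any derivable constant over it
changes its type. -/
theorem Derivable.zero (σ τ : MType) :
    Derivable (σ := σ) (τ := .mset τ) fun _ => (0 : Multiset τ.Val) := by
  obtain ⟨d, hd⟩ := exists_derivable_const τ
  exact ((Derivable.terminal σ).comp Derivable.empty).comp (hd .one).mapping

theorem Derivable.cons {f : σ.Val → τ.Val} {g : σ.Val → Multiset τ.Val} (hf : Derivable f)
    (hg : Derivable (σ := σ) (τ := .mset τ) g) :
    Derivable (σ := σ) (τ := .mset τ) fun a => (f a ::ₘ g a : Multiset τ.Val) :=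
  (hf.pairing hg).comp (Derivable.add τ)

theorem Derivable.singleton {f : σ.Val → τ.Val} (hf : Derivable f) :
    Derivable (σ := σ) (τ := .mset τ) fun a => ({f a} : Multiset τ.Val) :=
  hf.cons (Derivable.zero σ τ)

theorem Derivable.join {f : σ.Val → Multiset (Multiset τ.Val)}
    (hf : Derivable (σ := σ) (τ := .mset (.mset τ)) f) :
    Derivable (σ := σ) (τ := .mset τ) fun a => (f a).join :=
  hf.comp (Derivable.union τ)

theorem Derivable.plus {f g : σ.Val → Multiset τ.Val} (hf : Derivable (σ := σ) (τ := .mset τ) f)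
    (hg : Derivable (σ := σ) (τ := .mset τ) g) :
    Derivable (σ := σ) (τ := .mset τ) fun a => f a + g a :=
  (Derivable.join (Derivable.cons (τ := .mset τ) hf (Derivable.singleton (τ := .mset τ) hg))).congr
    fun a => by
      change Multiset.join (f a ::ₘ g a ::ₘ 0) = _
      simp

/-- Distributivity carries the context `ρ` into both branches. -/
theorem Derivable.cases {g : ρ.Val → σ.Val ⊕ τ.Val} {f₁ : ρ.Val × σ.Val → γ.Val}
    {f₂ : ρ.Val × τ.Val → γ.Val} (hg : Derivable (σ := ρ) (τ := .sum σ τ) g)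
    (h₁ : Derivable (σ := .prod ρ σ) (τ := γ) f₁) (h₂ : Derivable (σ := .prod ρ τ) (τ := γ) f₂) :
    Derivable fun a => Sum.elim (fun b => f₁ (a, b)) (fun c => f₂ (a, c)) (g a) :=
  ((((Derivable.id ρ).pairing hg).comp (Derivable.dist ρ σ τ)).comp (h₁.copairing h₂)).congr
    fun a => by
      change Sum.elim f₁ f₂ (MultisetTypes.dist (a, g a)) = _
      rcases g a with b | c <;> rfl

/-- The type of truth values. -/
abbrev two : MType := .sum .one .one

open Classical in
/-- The truth value of a proposition. -/
noncomputable def truth (p : Prop) : Unit ⊕ Unit := if p then Sum.inl () else Sum.inr ()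

theorem truth_eq_inl {p : Prop} : truth p = Sum.inl () ↔ p := by
  by_cases h : p <;> simp [truth, h]

/-- A property of values whose truth value is derivable. -/
def DPred (p : σ.Val → Prop) : Prop := Derivable (σ := σ) (τ := two) fun a => truth (p a)

open scoped Classical in
theorem DPred.ite {p : σ.Val → Prop} {f g : σ.Val → τ.Val} (hp : DPred p) (hf : Derivable f)
    (hg : Derivable g) : Derivable fun a => if p a then f a else g a :=
  (Derivable.cases (σ := .one) (τ := .one) hp ((Derivable.fst σ .one).comp hf)
    ((Derivable.fst σ .one).comp hg)).congr fun a => by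
      by_cases h : p a <;> simp only [truth, h, if_true, if_false] <;> rfl

theorem DPred.congr {p q : σ.Val → Prop} (h : DPred p) (e : ∀ a, p a ↔ q a) : DPred q :=
  Derivable.congr (τ := two) h fun a => congrArg truth (propext (e a))

theorem DPred.comp {p : τ.Val → Prop} {f : σ.Val → τ.Val} (h : DPred p) (hf : Derivable f) :
    DPred fun a => p (f a) := Derivable.comp hf h

theorem DPred.tru : DPred fun _ : σ.Val => True :=
  Derivable.congr (τ := two) ((Derivable.terminal σ).comp (Derivable.inl .one .one))
    fun _ => (truth_eq_inl.2 trivial).symm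

theorem DPred.of_ite {p q r : σ.Val → Prop} (hp : DPred p) (hq : DPred q) (hr : DPred r) :
    DPred fun a => (p a → q a) ∧ (¬ p a → r a) :=
  (hp.ite hq hr).congr fun a => by
    by_cases h : p a
    · exact (if_pos h).trans (congrArg truth (propext (by simp [h])))
    · exact (if_neg h).trans (congrArg truth (propext (by simp [h])))

theorem DPred.fls : DPred fun _ : σ.Val => False :=
  Derivable.congr (τ := two) ((Derivable.terminal σ).comp (Derivable.inr .one .one))
    fun _ => (if_neg not_false).symm

theorem DPred.const (p : Prop) : DPred fun _ : σ.Val => p := by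
  by_cases h : p
  · exact DPred.tru.congr fun _ => by simp [h]
  · exact DPred.fls.congr fun _ => by simp [h]

theorem DPred.imp {p q : σ.Val → Prop} (hp : DPred p) (hq : DPred q) : DPred fun a => p a → q a :=
  (hp.of_ite hq DPred.tru).congr fun a => by tauto

theorem DPred.not {p : σ.Val → Prop} (hp : DPred p) : DPred fun a => ¬ p a := hp.imp DPred.fls

theorem DPred.and {p q : σ.Val → Prop} (hp : DPred p) (hq : DPred q) : DPred fun a => p a ∧ q a :=
  (hp.of_ite hq DPred.fls).congr fun a => by tauto

theorem DPred.or {p q : σ.Val → Prop} (hp : DPred p) (hq : DPred q) : DPred fun a => p a ∨ q a :=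
  (hp.of_ite DPred.tru hq).congr fun a => by tauto

theorem DPred.sum {p : σ.Val → Prop} {q : τ.Val → Prop} (hp : DPred p) (hq : DPred q) :
    DPred (σ := .sum σ τ) fun a : σ.Val ⊕ τ.Val => Sum.elim p q a :=
  Derivable.congr (σ := .sum σ τ) (τ := two) (Derivable.copairing hp hq) fun a => by
    rcases a with a | a <;> rfl

/-- A multiset is empty exactly if it becomes a singleton after one element is added, and
de-singleton detects this. -/
theorem DPred.eq_zero (σ : MType) : DPred (σ := .mset σ) fun s : Multiset σ.Val => s = 0 := by
  obtain ⟨d, hd⟩ := exists_derivable_const σ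
  refine Derivable.congr (σ := .mset σ) (τ := two)
    (((hd _).cons (Derivable.id (.mset σ))).comp (Derivable.deSingleton σ) |>.comp
    (Derivable.copairing (DPred.fls (σ := .one)) (DPred.tru (σ := σ)))) fun
        (s : Multiset σ.Val) => ?_
  have : (∃ a, d ::ₘ s = {a}) ↔ s = 0 := by
    constructor
    · rintro ⟨a, h⟩
      have := congrArg Multiset.card h
      simpa using this
    · rintro rfl
      exact ⟨d, rfl⟩
  change Sum.elim (fun _ => truth False) (fun _ => truth True) (deSingleton (d ::ₘ s)) = _
  unfold deSingleton
  by_cases h : s = 0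
  · rw [dif_pos (this.2 h)]
    simp [h]
  · rw [dif_neg (this.not.2 h)]
    simp [h]

/-- Mapping with a context. -/
theorem Derivable.map {f : ρ.Val × σ.Val → τ.Val} {g : ρ.Val → Multiset σ.Val}
    (hf : Derivable (σ := .prod ρ σ) (τ := τ) f) (hg : Derivable (σ := ρ) (τ := .mset σ) g) :
    Derivable (σ := ρ) (τ := .mset τ) fun a => (g a).map fun b => f (a, b) := by
  classical
  -- The context is added to the multiset as one more element `inl a`, and `choices` is applied.
  -- Beside a chosen `inr b` the remainder contains exactly one left element, so `pick` and
  -- de-singleton recover `a`; the choice of `inl a` contributes nothing.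
  let pick : Multiset (ρ.Val ⊕ σ.Val) → Multiset ρ.Val := fun s =>
    (s.map (Sum.elim (fun a => {a}) fun _ => 0)).join
  have hpick : Derivable (σ := .mset (.sum ρ σ)) (τ := .mset ρ) pick :=
    Derivable.join (σ := .mset (.sum ρ σ)) (τ := ρ)
      (Derivable.mapping (σ := .sum ρ σ) (γ := .mset ρ)
        (Derivable.copairing (γ := .mset ρ) (Derivable.id ρ).singleton (Derivable.zero σ ρ)))
  let body : (ρ.Val ⊕ σ.Val) × Multiset (ρ.Val ⊕ σ.Val) → Multiset τ.Val := fun p =>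
    Sum.elim (fun _ => 0)
      (fun b => Sum.elim (fun _ => 0) (fun a => {f (a, b)}) (MultisetTypes.deSingleton
          (pick p.2))) p.1
  have hbody : Derivable (σ := .prod (.sum ρ σ) (.mset (.sum ρ σ))) (τ := .mset τ) body := by
    refine Derivable.cases (ρ := .prod (.sum ρ σ) (.mset (.sum ρ σ))) (σ := ρ) (τ := σ)
        (γ := .mset τ)
      (Derivable.fst _ _) (Derivable.zero _ _) (f₂ := fun q =>
        Sum.elim (fun _ => (0 : Multiset τ.Val)) (fun a => ({f (a, q.2)} : Multiset τ.Val))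
            (MultisetTypes.deSingleton (pick q.1.2))) ?_
    refine Derivable.cases (ρ := .prod (.prod (.sum ρ σ) (.mset (.sum ρ σ))) σ) (σ := .one) (τ := ρ)
      (γ := .mset τ) (f₂ := fun q => ({f (q.2, q.1.2)} : Multiset τ.Val))
      ((((Derivable.fst _ _).comp (Derivable.snd _ _)).comp hpick).comp (Derivable.deSingleton ρ))
      (Derivable.zero _ _) ?_
    exact Derivable.singleton ((Derivable.pairing (Derivable.snd _ ρ)
      ((Derivable.fst _ _).comp (Derivable.snd _ _))).comp hf)
  have h₁ : Derivable (σ := ρ) (τ := .mset (.sum ρ σ))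
      fun a => ((Sum.inl a : ρ.Val ⊕ σ.Val) ::ₘ (g a).map Sum.inr : Multiset (ρ.Val ⊕ σ.Val)) :=
    (Derivable.inl ρ σ).cons (hg.comp (Derivable.inr ρ σ).mapping)
  refine ((h₁.comp (Derivable.choices (.sum ρ σ))).comp hbody.mapping).join.congr fun a => ?_
  change Multiset.join (Multiset.map body
    (MultisetTypes.choices ((Sum.inl a : ρ.Val ⊕ σ.Val) ::ₘ (g a).map Sum.inr))) = _
  have h₂ : ∀ s : Multiset σ.Val, pick ((Sum.inl a : ρ.Val ⊕ σ.Val) ::ₘ s.map Sum.inr) = {a} := by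
    intro s
    simp only [pick, Multiset.map_cons, Multiset.join_cons, Multiset.map_map, Function.comp_def,
      Sum.elim_inl, Sum.elim_inr]
    induction s using Multiset.induction <;> simp_all
  have h₃ : MultisetTypes.deSingleton ({a} : Multiset ρ.Val) = Sum.inr a := by
    have : ∃ b, ({a} : Multiset ρ.Val) = {b} := ⟨a, rfl⟩
    unfold MultisetTypes.deSingleton
    rw [dif_pos this]
    exact congrArg Sum.inr (Multiset.singleton_inj.1 this.choose_spec).symm
  have h₄ : ∀ b ∈ g a, body (Sum.inr b,
      ((Sum.inl a : ρ.Val ⊕ σ.Val) ::ₘ (g a).map Sum.inr).erase (Sum.inr b)) = {f (a, b)} := by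
    intro b hb
    rw [Multiset.erase_cons_tail _ (by simp), ← Multiset.map_erase _ Sum.inr_injective]
    simp only [body, h₂, h₃, Sum.elim_inr]
  simp only [MultisetTypes.choices, Multiset.map_cons, Multiset.map_map, Multiset.join_cons,
    Function.comp_def]
  have h₅ : ∀ r, body (Sum.inl a, r) = 0 := fun r => rfl
  rw [h₅, zero_add]
  refine (congrArg Multiset.join (Multiset.map_congr rfl fun b hb => ?_)).trans
    (Multiset.bind_singleton (g a) fun b => f (a, b))
  convert h₄ b hb

open scoped Classical in
-- Each element becomes its singleton or the empty multiset, and the results are united.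
theorem Derivable.filter {p : σ.Val → Prop} (hp : DPred p) :
    Derivable (σ := .mset σ) (τ := .mset σ) (Multiset.filter p : Multiset σ.Val → Multiset σ.Val) :=
  (Derivable.mapping (γ := .mset σ)
    (hp.ite (τ := .mset σ) (Derivable.id σ).singleton (Derivable.zero _ _))).join.congr
      fun (s : Multiset σ.Val) => by
        change (s.map fun a => if p a then ({a} : Multiset σ.Val) else 0).join = s.filter p
        induction s using Multiset.induction with
        | empty => simp
        | cons a s ih => by_cases h : p a <;> simp [h, ih]

theorem DPred.exists_mem {p : σ.Val → Prop} (hp : DPred p) :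
    DPred (σ := .mset σ) fun s : Multiset σ.Val => ∃ a ∈ s, p a := by
  classical
  exact ((DPred.eq_zero σ).comp (Derivable.filter hp)).not.congr fun (s : Multiset σ.Val) => by
    simp [Multiset.filter_eq_nil]

end Toolkit

/-! ### Values with coloured elements -/

/-- The type of values of `σ` such that each element of their structures has a colour in `C`. -/
def lab (C : MType) : MType → MType
  | .one => C
  | .sum σ τ => .sum (lab C σ) (lab C τ)
  | .prod σ τ => .prod (lab C σ) (lab C τ)
  -- The additional factor `C` is the colour of the root.
  | .mset σ => .prod C (.mset (lab C σ))

open scoped Classical in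
/-- The coloured structure of a value with coloured elements. -/
noncomputable def lstr (C : MType) : (σ : MType) → (lab C σ).Val → (A : Str σ.voc) × (A → C.Val)
  | .one => fun c => ⟨Str.unit, fun _ => c⟩
  | .sum σ τ => Sum.elim (fun v => ⟨(lstr C σ v).1.inl τ.voc, (lstr C σ v).2⟩)
      fun v => ⟨(lstr C τ v).1.inr σ.voc, (lstr C τ v).2⟩
  | .prod σ τ => fun p : (lab C σ).Val × (lab C τ).Val =>
      ⟨(lstr C σ p.1).1.prod (lstr C τ p.2).1, Sum.elim (lstr C σ p.1).2 (lstr C τ p.2).2⟩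
  | .mset σ => fun p : C.Val × Multiset (lab C σ).Val =>
      ⟨Str.mset fun k : p.2 => (lstr C σ k.1).1,
        fun o : Option ((k : p.2) × (lstr C σ k.1).1) => o.elim p.1 fun q => (lstr C σ q.1.1).2 q.2⟩

/-- The structure `A`, coloured by `c`, is that of the value `v`. -/
def LRep {C σ : MType} (v : (lab C σ).Val) (A : Str σ.voc) (c : A → C.Val) : Prop :=
  ∃ e : A ≃[σ.voc] (lstr C σ v).1, ∀ x, (lstr C σ v).2 (e x) = c x

namespace LRep

variable {C C' σ τ : MType}

theorem of_lstr (v : (lab C σ).Val) : LRep v (lstr C σ v).1 (lstr C σ v).2 :=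
  ⟨FirstOrder.Language.Equiv.refl _ _, fun _ => rfl⟩

theorem of_equiv {v : (lab C σ).Val} {A B : Str σ.voc} {c : A → C.Val} {d : B → C.Val}
    (h : LRep v A c) (e : B ≃[σ.voc] A) (hd : ∀ x, c (e x) = d x) : LRep v B d := by
  obtain ⟨g, hg⟩ := h
  exact ⟨g.comp e, fun x => (hg _).trans (hd x)⟩

theorem congr {v : (lab C σ).Val} {A : Str σ.voc} {c d : A → C.Val}
    (h : LRep v A c) (hd : ∀ x, c x = d x) : LRep v A d :=
  h.of_equiv (FirstOrder.Language.Equiv.refl _ _) hd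

theorem inl {v : (lab C σ).Val} {A : Str σ.voc} {c : A → C.Val} (h : LRep v A c) :
    LRep (σ := .sum σ τ) (Sum.inl v : (lab C σ).Val ⊕ (lab C τ).Val) (A.inl τ.voc) c := by
  obtain ⟨e, he⟩ := h
  obtain ⟨g, hg⟩ := Str.exists_inl_equiv (L' := τ.voc) e
  exact ⟨g, fun x => (congrArg (lstr C σ v).2 (hg x)).trans (he x)⟩

theorem inr {v : (lab C τ).Val} {A : Str τ.voc} {c : A → C.Val} (h : LRep v A c) :
    LRep (σ := .sum σ τ) (Sum.inr v : (lab C σ).Val ⊕ (lab C τ).Val) (A.inr σ.voc) c := by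
  obtain ⟨e, he⟩ := h
  obtain ⟨g, hg⟩ := Str.exists_inr_equiv (L := σ.voc) e
  exact ⟨g, fun x => (congrArg (lstr C τ v).2 (hg x)).trans (he x)⟩

theorem prod {v : (lab C σ).Val} {w : (lab C τ).Val} {A : Str σ.voc} {B : Str τ.voc}
    {c : A → C.Val} {d : B → C.Val} (h : LRep v A c) (h' : LRep w B d) :
    LRep (σ := .prod σ τ) ((v, w) : (lab C σ).Val × (lab C τ).Val) (A.prod B)
      (Sum.elim c d : A ⊕ B → C.Val) := by
  obtain ⟨e, he⟩ := h
  obtain ⟨f, hf⟩ := h'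
  obtain ⟨g, hg⟩ := Str.exists_prod_equiv e f
  refine ⟨g, fun x => (congrArg (Sum.elim (lstr C σ v).2 (lstr C τ w).2) (hg x)).trans ?_⟩
  rcases x with x | x
  · exact he x
  · exact hf x

theorem mset {ι : Type} {c₀ : C.Val} {s : Multiset (lab C σ).Val} {w : ι → (lab C σ).Val}
    {A : ι → Str σ.voc} {c : ∀ i, A i → C.Val} (hs : Enum s w) (h : ∀ i, LRep (w i) (A i) (c i)) :
    LRep (σ := .mset σ) ((c₀, s) : C.Val × Multiset (lab C σ).Val) (Str.mset A)
      fun o : Option ((i : ι) × A i) => o.elim c₀ fun p => c p.1 p.2 := by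
  classical
  obtain ⟨e, he⟩ := hs.exists_equiv
  have : ∀ i, ∃ f : A i ≃[σ.voc] (lstr C σ (e i).1).1, ∀ x, (lstr C σ (e i).1).2 (f x) = c i x := by
    intro i
    rw [he i]
    exact h i
  choose f hf using this
  obtain ⟨g, hg⟩ := Str.exists_mset_equiv (B := fun k : s => (lstr C σ k.1).1) e f
  refine ⟨g, fun o => (congrArg (fun o : Option ((k : s) × (lstr C σ k.1).1) =>
    o.elim c₀ fun q => (lstr C σ q.1.1).2 q.2) (hg o)).trans ?_⟩
  rcases o with _ | ⟨i, x⟩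
  · rfl
  · exact hf i x

/-- Constructions on coloured structures need to be checked only on canonical structures. -/
theorem map {v : (lab C σ).Val} {w : (lab C' σ).Val} {f : C.Val → C'.Val}
    (h : LRep w (lstr C σ v).1 fun x => f ((lstr C σ v).2 x)) {A : Str σ.voc} {c : A → C.Val}
    (hv : LRep v A c) : LRep w A fun x => f (c x) := by
  obtain ⟨e, he⟩ := hv
  exact h.of_equiv e fun x => congrArg f (he x)

end LRep

section Colour

variable {C C' σ τ : MType}

theorem exists_recolour {f : C.Val → C'.Val} (hf : Derivable f) (σ : MType) :
    ∃ g : (lab C σ).Val → (lab C' σ).Val, Derivable g ∧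
      ∀ v A c, LRep v A c → LRep (g v) A fun x => f (c x) := by
  suffices h : ∃ g : (lab C σ).Val → (lab C' σ).Val, Derivable g ∧
      ∀ v, LRep (g v) (lstr C σ v).1 fun x => f ((lstr C σ v).2 x) by
    obtain ⟨g, hg, h⟩ := h
    exact ⟨g, hg, fun v A c hv => (h v).map hv⟩
  induction σ with
  | one => exact ⟨f, hf, fun c => ⟨FirstOrder.Language.Equiv.refl _ _, fun _ => rfl⟩⟩
  | sum σ τ ih₁ ih₂ =>
    obtain ⟨g₁, hg₁, h₁⟩ := ih₁
    obtain ⟨g₂, hg₂, h₂⟩ := ih₂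
    refine ⟨_, (hg₁.comp (Derivable.inl _ (lab C' τ))).copairing
      (hg₂.comp (Derivable.inr (lab C' σ) _)), fun v => ?_⟩
    rcases v with v | v
    · exact (h₁ v).inl
    · exact (h₂ v).inr
  | prod σ τ ih₁ ih₂ =>
    obtain ⟨g₁, hg₁, h₁⟩ := ih₁
    obtain ⟨g₂, hg₂, h₂⟩ := ih₂
    refine ⟨_, ((Derivable.fst _ (lab C τ)).comp hg₁).pairing
      ((Derivable.snd (lab C σ) _).comp hg₂), fun v => ?_⟩
    refine ((h₁ v.1).prod (h₂ v.2)).congr fun x => ?_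
    rcases x with x | x <;> rfl
  | mset σ ih =>
    classical
    obtain ⟨g, hg, h⟩ := ih
    refine ⟨_, ((Derivable.fst C (.mset (lab C σ))).comp hf).pairing
      ((Derivable.snd C (.mset (lab C σ))).comp hg.mapping), fun v => ?_⟩
    refine (LRep.mset ((Enum.toType (X := (lab C σ).Val) v.2).map g) fun k => h k.1).congr
        fun x => ?_
    rcases x with _ | x <;> rfl

/-- The trivial colouring, from which every sequence of markings starts. -/
theorem exists_colour (σ : MType) : ∃ g : σ.Val → (lab .one σ).Val, Derivable g ∧
    ∀ a, LRep (g a) (σ.toStr a) fun _ => () := by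
  induction σ with
  | one => exact ⟨_, Derivable.id .one, fun c => ⟨FirstOrder.Language.Equiv.refl _ _, fun _ => rfl⟩⟩
  | sum σ τ ih₁ ih₂ =>
    obtain ⟨g₁, hg₁, h₁⟩ := ih₁
    obtain ⟨g₂, hg₂, h₂⟩ := ih₂
    refine ⟨_, (hg₁.comp (Derivable.inl _ (lab .one τ))).copairing
      (hg₂.comp (Derivable.inr (lab .one σ) _)), fun v => ?_⟩
    rcases v with v | v
    · exact (h₁ v).inl
    · exact (h₂ v).inr
  | prod σ τ ih₁ ih₂ =>
    obtain ⟨g₁, hg₁, h₁⟩ := ih₁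
    obtain ⟨g₂, hg₂, h₂⟩ := ih₂
    exact ⟨_, ((Derivable.fst _ τ).comp hg₁).pairing
      ((Derivable.snd σ _).comp hg₂), fun v => ((h₁ v.1).prod (h₂ v.2)).congr fun _ => rfl⟩
  | mset σ ih =>
    classical
    obtain ⟨g, hg, h⟩ := ih
    exact ⟨_, (Derivable.terminal (.mset σ)).pairing hg.mapping, fun v =>
      (LRep.mset (C := .one) (c₀ := ()) ((Enum.toType (X := σ.Val) v).map g)
          fun k => h k.1).congr fun _ => rfl⟩

/-- The search runs through the parts of the type, including the root of a multiset. It serves as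
the equality test: two variables are equal if some element bears both marks. -/
theorem exists_some_colour {p : C.Val → Prop} (hp : DPred p) (σ : MType) :
    ∃ q : (lab C σ).Val → Prop, DPred q ∧ ∀ v A c, LRep v A c → (q v ↔ ∃ x, p (c x)) := by
  suffices h : ∃ q : (lab C σ).Val → Prop, DPred q ∧
      ∀ v, q v ↔ ∃ x : (lstr C σ v).1, p ((lstr C σ v).2 x) by
    obtain ⟨q, hq, h⟩ := h
    refine ⟨q, hq, fun v A c ⟨e, he⟩ => (h v).trans ?_⟩
    simp only [← he]
    exact (e.toEquiv.exists_congr_right (q := fun x => p ((lstr C σ v).2 x))).symm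
  induction σ with
  | one => exact ⟨p, hp, fun c => ⟨fun h => ⟨(), h⟩, fun ⟨_, h⟩ => h⟩⟩
  | sum σ τ ih₁ ih₂ =>
    obtain ⟨q₁, hq₁, h₁⟩ := ih₁
    obtain ⟨q₂, hq₂, h₂⟩ := ih₂
    refine ⟨_, hq₁.sum hq₂, fun v => ?_⟩
    rcases v with v | v
    · exact h₁ v
    · exact h₂ v
  | prod σ τ ih₁ ih₂ =>
    obtain ⟨q₁, hq₁, h₁⟩ := ih₁
    obtain ⟨q₂, hq₂, h₂⟩ := ih₂
    exact ⟨_, (hq₁.comp (Derivable.fst _ _)).or (hq₂.comp (Derivable.snd _ _)), fun v =>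
      (or_congr (h₁ v.1) (h₂ v.2)).trans
        (Sum.exists (p := fun x => p (Sum.elim (lstr C σ v.1).2 (lstr C τ v.2).2 x))).symm⟩
  | mset σ ih =>
    classical
    obtain ⟨q, hq, h⟩ := ih
    refine ⟨_, (hp.comp (Derivable.fst C (.mset (lab C σ)))).or
      (hq.exists_mem.comp (Derivable.snd C (.mset (lab C σ)))), fun v => ?_⟩
    refine Iff.trans (or_congr Iff.rfl (((Enum.toType (X := (lab C σ).Val) v.2).exists_mem q).trans
      (exists_congr fun k => h k.1))) ?_
    constructor
    · rintro (h | ⟨k, x, hx⟩)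
      · exact ⟨none, h⟩
      · exact ⟨some ⟨k, x⟩, hx⟩
    · rintro ⟨_ | ⟨k, x⟩, h⟩
      · exact Or.inl h
      · exact Or.inr ⟨k, x, h⟩

/-- The arguments of an atom are given by their colours. Apart from the names added by a
constructor, a relation lives inside one summand, factor or member, so the test descends along the
type. -/
theorem exists_atom (σ : MType) : ∀ {n : ℕ} (R : σ.voc.Relations n) {p : Fin n → C.Val → Prop},
    (∀ j, DPred (p j)) → ∃ q : (lab C σ).Val → Prop, DPred q ∧
      ∀ v A c, LRep v A c → (q v ↔ ∃ y : Fin n → A, RelMap R y ∧ ∀ j, p j (c (y j))) := by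
  suffices h : ∀ {n : ℕ} (R : σ.voc.Relations n) {p : Fin n → C.Val → Prop},
    (∀ j, DPred (p j)) → ∃ q : (lab C σ).Val → Prop, DPred q ∧
      ∀ v, q v ↔ ∃ y : Fin n → (lstr C σ v).1, RelMap R y ∧ ∀ j, p j ((lstr C σ v).2 (y j)) by
    intro n R p hp
    obtain ⟨q, hq, h⟩ := h R hp
    refine ⟨q, hq, fun v A c ⟨e, he⟩ => (h v).trans ?_⟩
    constructor
    · rintro ⟨y, hR, hy⟩
      refine ⟨fun j => e.symm (y j), (e.symm.map_rel R y).2 hR, fun j => ?_⟩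
      rw [← he, FirstOrder.Language.Equiv.apply_symm_apply]
      exact hy j
    · rintro ⟨y, hR, hy⟩
      refine ⟨fun j => e (y j), (e.map_rel R y).2 hR, fun j => ?_⟩
      rw [he]
      exact hy j
  induction σ with
  | one => exact fun {n} R => isEmptyElim (α := FirstOrder.Language.empty.Relations n) R
  | sum σ τ ih₁ ih₂ =>
    rintro n (R | R | _) p hp
    · obtain ⟨q, hq, h⟩ := ih₁ R hp
      refine ⟨_, hq.sum DPred.fls, fun v => ?_⟩
      rcases v with v | v
      · exact h v
      · exact iff_of_false (fun h => h) fun ⟨_, h, _⟩ => h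
    · obtain ⟨q, hq, h⟩ := ih₂ R hp
      refine ⟨_, (DPred.fls).sum hq, fun v => ?_⟩
      rcases v with v | v
      · exact iff_of_false (fun h => h) fun ⟨_, h, _⟩ => h
      · exact h v
    · refine ⟨_, (DPred.tru).sum DPred.fls, fun v => ?_⟩
      rcases v with v | v
      · exact iff_of_true trivial ⟨Fin.elim0, trivial, fun j => j.elim0⟩
      · exact iff_of_false (fun h => h) fun ⟨_, h, _⟩ => h
  | prod σ τ ih₁ ih₂ =>
    rintro n (R | R | _) p hp
    · obtain ⟨q, hq, h⟩ := ih₁ R hp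
      refine ⟨_, hq.comp (Derivable.fst _ (lab C τ)), fun v => (h v.1).trans ?_⟩
      constructor
      · rintro ⟨y, hR, hy⟩
        exact ⟨Sum.inl ∘ y, ⟨y, rfl, hR⟩, hy⟩
      · rintro ⟨_, ⟨y, rfl, hR⟩, hy⟩
        exact ⟨y, hR, hy⟩
    · obtain ⟨q, hq, h⟩ := ih₂ R hp
      refine ⟨_, hq.comp (Derivable.snd (lab C σ) _), fun v => (h v.2).trans ?_⟩
      constructor
      · rintro ⟨y, hR, hy⟩
        exact ⟨Sum.inr ∘ y, ⟨y, rfl, hR⟩, hy⟩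
      · rintro ⟨_, ⟨y, rfl, hR⟩, hy⟩
        exact ⟨y, hR, hy⟩
    · obtain ⟨q, hq, h⟩ := exists_some_colour (hp 0) σ
      refine ⟨_, hq.comp (Derivable.fst _ (lab C τ)), fun v =>
        (h v.1 _ _ (LRep.of_lstr v.1)).trans ?_⟩
      constructor
      · rintro ⟨x, hx⟩
        exact ⟨fun _ => Sum.inl x, ⟨x, rfl⟩, fun j => by obtain rfl := Subsingleton.elim j 0; exact
            hx⟩
      · rintro ⟨y, ⟨x, hy⟩, h⟩
        refine ⟨x, ?_⟩
        have := h 0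
        rw [hy] at this
        exact this
  | mset σ ih =>
    classical
    have key : ∀ {q : (lab C σ).Val → Prop}, DPred q → ∀ {Q : ∀ w : (lab C σ).Val, Prop}
        (h : ∀ w, q w ↔ Q w), ∃ q' : (lab C (.mset σ)).Val → Prop, DPred q' ∧
          ∀ v : C.Val × Multiset (lab C σ).Val, q' v ↔ ∃ k : v.2, Q k.1 := by
      intro q hq Q h
      exact ⟨_, hq.exists_mem.comp (Derivable.snd C (.mset (lab C σ))), fun v =>
        ((Enum.toType (X := (lab C σ).Val) v.2).exists_mem q).trans (exists_congr fun k => h k.1)⟩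
    rintro n (R | R | _) p hp
    -- A former `0`-ary relation must be true in a member that also contains the coloured argument.
    · obtain ⟨q, hq, h⟩ := ih R (p := fun j => j.elim0) fun j => j.elim0
      obtain ⟨q', hq', h'⟩ := exists_some_colour (hp 0) σ
      obtain ⟨r, hr, hr'⟩ := key (hq.and hq')
        fun w => and_congr (h w) (h' w _ _ (LRep.of_lstr w))
      refine ⟨r, hr, fun v => (hr' v).trans ?_⟩
      constructor
      · rintro ⟨k, ⟨y, hR, -⟩, x, hx⟩
        obtain rfl : y = Fin.elim0 := Subsingleton.elim _ _
        exact ⟨fun _ => some ⟨k, x⟩, ⟨k, x, rfl, hR⟩,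
          fun j => by obtain rfl := Subsingleton.elim j 0; exact hx⟩
      · rintro ⟨y, ⟨k, x, hy, hR⟩, h⟩
        refine ⟨k, ⟨Fin.elim0, hR, fun j => j.elim0⟩, x, ?_⟩
        have := h 0
        rw [hy] at this
        exact this
    · obtain ⟨q, hq, h⟩ := ih R hp
      obtain ⟨r, hr, hr'⟩ := key hq h
      refine ⟨r, hr, fun v => (hr' v).trans ?_⟩
      constructor
      · rintro ⟨k, y, hR, hy⟩
        exact ⟨fun j => some ⟨k, y j⟩, ⟨k, y, fun _ => rfl, hR⟩, hy⟩
      · rintro ⟨y, ⟨k, x, hy, hR⟩, h⟩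
        refine ⟨k, x, hR, fun j => ?_⟩
        have := h j
        rw [hy] at this
        exact this
    -- Two marked elements are `∼`-related exactly if one occurrence in the multiset contains both
    -- marks.
    · obtain ⟨q, hq, h⟩ := exists_some_colour (hp 0) σ
      obtain ⟨q', hq', h'⟩ := exists_some_colour (hp 1) σ
      obtain ⟨r, hr, hr'⟩ := key (hq.and hq')
        fun w => and_congr (h w _ _ (LRep.of_lstr w)) (h' w _ _ (LRep.of_lstr w))
      refine ⟨r, hr, fun v => (hr' v).trans ?_⟩
      constructor
      · rintro ⟨k, ⟨x, hx⟩, y, hy⟩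
        exact ⟨![some ⟨k, x⟩, some ⟨k, y⟩], ⟨k, x, y, rfl, rfl⟩, Fin.forall_fin_two.2 ⟨hx, hy⟩⟩
      · rintro ⟨y, ⟨k, a, b, h₀, h₁⟩, h⟩
        refine ⟨k, ⟨a, ?_⟩, b, ?_⟩
        · have := h 0
          rw [h₀] at this
          exact this
        · have := h 1
          rw [h₁] at this
          exact this

end Colour

/-! ### Marking elements -/

theorem truth_congr {p q : Prop} (h : p ↔ q) : truth p = truth q := congrArg truth (propext h)

theorem DPred.eq_inl : DPred (σ := two) fun t : Unit ⊕ Unit => t = Sum.inl () :=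
  Derivable.congr (σ := two) (τ := two) (Derivable.id two) fun t : Unit ⊕ Unit => by
    rcases t with ⟨⟨⟩⟩ | ⟨⟨⟩⟩
    · exact (truth_eq_inl.2 rfl).symm
    · exact (if_neg (by simp)).symm

theorem exists_unmark (C σ : MType) :
    ∃ g : (lab C σ).Val → (lab (.prod C two) σ).Val, Derivable g ∧ ∀ v A c, LRep v A c →
      LRep (C := .prod C two) (g v) A fun x => ((c x, truth False) : C.Val × (Unit ⊕ Unit)) :=
  exists_recolour (C' := .prod C two) (f := fun c => ((c, truth False) : C.Val × (Unit ⊕ Unit)))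
    ((Derivable.id C).pairing (γ₂ := two) DPred.fls) σ

/-- All ways to mark one element. -/
theorem exists_marks (C σ : MType) :
    ∃ m : (lab C σ).Val → Multiset (lab (.prod C two) σ).Val,
      Derivable (σ := lab C σ) (τ := .mset (lab (.prod C two) σ)) m ∧
      ∀ v A c, LRep v A c → ∃ w : A → (lab (.prod C two) σ).Val, Enum (m v) w ∧
        ∀ x, LRep (C := .prod C two) (w x) A
          fun y => ((c y, truth (y = x)) : C.Val × (Unit ⊕ Unit)) := by
  suffices h : ∃ m : (lab C σ).Val → Multiset (lab (.prod C two) σ).Val,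
      Derivable (σ := lab C σ) (τ := .mset (lab (.prod C two) σ)) m ∧
      ∀ v, ∃ w : (lstr C σ v).1 → (lab (.prod C two) σ).Val, Enum (m v) w ∧
        ∀ x, LRep (C := .prod C two) (w x) (lstr C σ v).1
          fun y => (((lstr C σ v).2 y, truth (y = x)) : C.Val × (Unit ⊕ Unit)) by
    obtain ⟨m, hm, h⟩ := h
    refine ⟨m, hm, fun v A c ⟨e, he⟩ => ?_⟩
    obtain ⟨w, hw, h⟩ := h v
    refine ⟨fun x => w (e x), hw.of_equiv e.toEquiv, fun x => (h (e x)).of_equiv e fun y => ?_⟩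
    exact Prod.ext (he y) (truth_congr e.injective.eq_iff)
  induction σ with
  | one =>
    refine ⟨_, Derivable.singleton (τ := .prod C two)
      ((Derivable.id C).pairing (γ₂ := two) DPred.tru), fun v => 
      ⟨fun _ => (v, truth True), Enum.of_unique (ι := Unit)
        (w := fun _ => ((v, truth True) : C.Val × (Unit ⊕ Unit))), ?_⟩⟩
    intro x
    refine ⟨FirstOrder.Language.Equiv.refl _ _, fun y => ?_⟩
    exact Prod.ext rfl (truth_congr (iff_of_true trivial rfl))
  | sum σ τ ih₁ ih₂ =>
    obtain ⟨m₁, hm₁, h₁⟩ := ih₁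
    obtain ⟨m₂, hm₂, h₂⟩ := ih₂
    refine ⟨_, (hm₁.comp (Derivable.inl _ (lab (.prod C two) τ)).mapping).copairing
      (hm₂.comp (Derivable.inr (lab (.prod C two) σ) _).mapping), fun v => ?_⟩
    rcases v with v | v
    · obtain ⟨w, hw, h⟩ := h₁ v
      exact ⟨_, hw.map _, fun x => (h x).inl⟩
    · obtain ⟨w, hw, h⟩ := h₂ v
      exact ⟨_, hw.map _, fun x => (h x).inr⟩
  | prod σ τ ih₁ ih₂ =>
    obtain ⟨m₁, hm₁, h₁⟩ := ih₁
    obtain ⟨m₂, hm₂, h₂⟩ := ih₂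
    obtain ⟨g₁, hg₁, hg₁'⟩ := exists_unmark C σ
    obtain ⟨g₂, hg₂, hg₂'⟩ := exists_unmark C τ
    have d₁ := Derivable.map (ρ := .prod (lab C σ) (lab C τ)) (σ := lab (.prod C two) σ)
      (τ := .prod (lab (.prod C two) σ) (lab (.prod C two) τ))
      (f := fun q => (q.2, g₂ q.1.2)) (g := fun p => m₁ p.1)
      ((Derivable.snd _ _).pairing (((Derivable.fst _ _).comp (Derivable.snd _ _)).comp hg₂))
      ((Derivable.fst _ _).comp hm₁)
    have d₂ := Derivable.map (ρ := .prod (lab C σ) (lab C τ)) (σ := lab (.prod C two) τ)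
      (τ := .prod (lab (.prod C two) σ) (lab (.prod C two) τ))
      (f := fun q => (g₁ q.1.1, q.2)) (g := fun p => m₂ p.2)
      ((((Derivable.fst _ _).comp (Derivable.fst _ _)).comp hg₁).pairing (Derivable.snd _ _))
      ((Derivable.snd _ _).comp hm₂)
    -- The mark lies in one factor, while the elements of the other factor all receive the mark
    -- `False`.
    refine ⟨_, d₁.plus d₂, fun v => ?_⟩
    obtain ⟨w₁, hw₁, h₁⟩ := h₁ v.1
    obtain ⟨w₂, hw₂, h₂⟩ := h₂ v.2
    refine ⟨Sum.elim (fun x => (w₁ x, g₂ v.2)) fun x => (g₁ v.1, w₂ x),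
      (hw₁.map _).add (hw₂.map _), fun x => ?_⟩
    rcases x with x | x
    · refine ((h₁ x).prod (hg₂' _ _ _ (LRep.of_lstr v.2))).congr fun y => ?_
      rcases y with y | y
      · exact Prod.ext rfl (truth_congr Sum.inl_injective.eq_iff.symm)
      · exact Prod.ext rfl (truth_congr (iff_of_false (fun h => h) Sum.inr_ne_inl))
    · refine ((hg₁' _ _ _ (LRep.of_lstr v.1)).prod (h₂ x)).congr fun y => ?_
      rcases y with y | y
      · exact Prod.ext rfl (truth_congr (iff_of_false (fun h => h) Sum.inl_ne_inr))
      · exact Prod.ext rfl (truth_congr Sum.inr_injective.eq_iff.symm)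
  | mset σ ih =>
    classical
    obtain ⟨m, hm, h⟩ := ih
    obtain ⟨g, hg, hg'⟩ := exists_unmark C σ
    let T : MType := lab (.prod C two) σ
    let S : MType := lab C σ
    have root : ∀ b : Prop, Derivable (σ := .prod C (.mset S)) (τ := .prod C two)
        fun v => ((v.1, truth b) : C.Val × (Unit ⊕ Unit)) := fun b =>
      (Derivable.fst C (.mset S)).pairing (γ₂ := two) (DPred.const b)
    have d₁ : Derivable (σ := .prod C (.mset S)) (τ := .prod (.prod C two) (.mset T))
        fun v => (((v.1, truth True), v.2.map g) : (C.Val × (Unit ⊕ Unit)) × Multiset T.Val) :=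
      (root True).pairing ((Derivable.snd C (.mset S)).comp hg.mapping)
    -- Marks below the root: `choices` selects a member, the mark is placed inside it in all ways,
    -- and it is put back among the unmarked remaining members. The root itself is marked by `d₁`.
    let F : (C.Val × Multiset S.Val) × (S.Val × Multiset S.Val) →
        Multiset ((C.Val × (Unit ⊕ Unit)) × Multiset T.Val) := fun q =>
      (m q.2.1).map fun a => ((q.1.1, truth False), a ::ₘ q.2.2.map g)
    have dF : Derivable (σ := .prod (.prod C (.mset S)) (.prod S (.mset S)))
        (τ := .mset (.prod (.prod C two) (.mset T))) F := by
      refine Derivable.map (ρ := .prod (.prod C (.mset S)) (.prod S (.mset S))) (σ := T)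
        (τ := .prod (.prod C two) (.mset T))
        (f := fun r => ((r.1.1.1, truth False), r.2 ::ₘ r.1.2.2.map g))
        (g := fun q => m q.2.1) ?_ (((Derivable.snd _ _).comp (Derivable.fst _ _)).comp hm)
      refine Derivable.pairing (γ₁ := .prod C two) (γ₂ := .mset T)
        (((Derivable.fst _ _).comp (Derivable.fst _ _)).comp (root False)) ?_
      exact (Derivable.snd _ _).cons ((((Derivable.fst _ _).comp (Derivable.snd _ _)).comp
        (Derivable.snd _ _)).comp hg.mapping)
    have d₂ := Derivable.map (ρ := .prod C (.mset S)) (σ := .prod S (.mset S))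
      (τ := .mset (.prod (.prod C two) (.mset T))) dF
      ((Derivable.snd C (.mset S)).comp (Derivable.choices S))
    refine ⟨_, Derivable.cons (σ := .prod C (.mset S)) (τ := .prod (.prod C two) (.mset T))
      d₁ d₂.join, fun (v : C.Val × Multiset S.Val) => ?_⟩
    choose w hw hw' using fun k : v.2 => h k.1
    let W : Option ((k : v.2) × (lstr C σ k.1).1) → (C.Val × (Unit ⊕ Unit)) × Multiset T.Val :=
      fun o => o.elim ((v.1, truth True), v.2.map g)
        fun p => ((v.1, truth False), w p.1 p.2 ::ₘ (v.2.erase p.1.1).map g)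
    refine ⟨W, ?_, ?_⟩
    · exact Enum.option (w := W) (Enum.join (((Enum.toType v.2).map
        fun a => (a, v.2.erase a)).map fun b => F (v, b)) fun k => (hw k).map _)
    · rintro (_ | ⟨k, x⟩)
      · refine (LRep.mset (C := .prod C two) (σ := σ) ((Enum.toType v.2).map g)
          fun k => hg' _ _ _ (LRep.of_lstr k.1)).congr fun y => ?_
        rcases y with _ | ⟨k, y⟩
        · exact Prod.ext rfl (truth_congr (iff_of_true trivial rfl))
        · exact Prod.ext rfl (truth_congr (iff_of_false (fun h => h) (by rintro ⟨⟩)))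
      -- The rebuilt multiset consists of one marked member and the unmarked others; it is reindexed
      -- by the old occurrences with `none` in the place of `k`.
      · have e := (Enum.option (w := fun o : Option {j // j ≠ k} =>
          o.elim (w k x) fun j => g j.1.1) (((Enum.toType v.2).erase k).map g)).of_equiv
            (Equiv.optionSubtypeNe k).symm
        have hk : ∀ j : v.2, LRep (C := .prod C two) (σ := σ)
            (((Equiv.optionSubtypeNe k).symm j).elim (w k x) fun j => g j.1.1)
            (lstr C σ j.1).1 fun y => (((lstr C σ j.1).2 y,
              truth ((some ⟨j, y⟩ : Option ((k : v.2) × (lstr C σ k.1).1)) = some ⟨k, x⟩)) :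
                C.Val × (Unit ⊕ Unit)) := by
          intro j
          by_cases hj : j = k
          · subst hj
            rw [Equiv.optionSubtypeNe_symm_self]
            refine (hw' j x).congr fun y => Prod.ext rfl (truth_congr ?_)
            exact ⟨fun h => by rw [h], fun h => eq_of_heq (Sigma.mk.inj (Option.some.inj h)).2⟩
          · rw [Equiv.optionSubtypeNe_symm_of_ne hj]
            refine (hg' _ _ _ (LRep.of_lstr j.1)).congr fun y => Prod.ext rfl (truth_congr ?_)
            exact iff_of_false (fun h => h) fun h => hj (congrArg Sigma.fst (Option.some.inj h))
        refine (LRep.mset (C := .prod C two) (σ := σ) (c₀ := (v.1, truth False)) e hk).congr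
          fun y => ?_
        rcases y with _ | ⟨j, y⟩
        · exact Prod.ext rfl (truth_congr (iff_of_false (fun h => h) (by rintro ⟨⟩)))
        · rfl

/-- All ways to mark a tuple of elements. -/
theorem exists_tuple_marks (C σ : MType) (D : Type) [Finite D] :
    ∃ (C' : MType) (f : C'.Val → C.Val) (p : D → C'.Val → Prop)
      (m : (lab C σ).Val → Multiset (lab C' σ).Val),
      Derivable f ∧ (∀ d, DPred (p d)) ∧ Derivable (σ := lab C σ) (τ := .mset (lab C' σ)) m ∧
      ∀ v A c, LRep v A c → ∃ (w : (D → A) → (lab C' σ).Val) (c' : (D → A) → A → C'.Val),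
        Enum (m v) w ∧ ∀ z, LRep (w z) A (c' z) ∧ (∀ y, f (c' z y) = c y) ∧
          ∀ d y, p d (c' z y) ↔ y = z d := by
  induction D using Finite.induction_empty_option with
  | @of_equiv D D' e ih =>
    obtain ⟨C', f, p, m, hf, hp, hm, h⟩ := ih
    refine ⟨C', f, fun d => p (e.symm d), m, hf, fun d => hp _, hm, fun v A c hv => ?_⟩
    obtain ⟨w, c', hw, h⟩ := h v A c hv
    refine ⟨fun z => w fun d => z (e d), fun z => c' fun d => z (e d),
      hw.of_equiv (e.arrowCongr (Equiv.refl A)).symm, fun z => ⟨(h _).1, (h _).2.1, fun d y => ?_⟩⟩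
    refine ((h _).2.2 _ _).trans ?_
    rw [e.apply_symm_apply]
  | h_empty =>
    refine ⟨C, fun a => a, fun d => d.elim, fun v => {v}, Derivable.id C, fun d => d.elim,
      (Derivable.id _).singleton, fun v A c hv => ?_⟩
    exact ⟨fun _ => v, fun _ => c, Enum.of_unique (w := fun _ => v),
      fun z => ⟨hv, fun _ => rfl, fun d => d.elim⟩⟩
  | @h_option D _ ih =>
    obtain ⟨C', f, p, m, hf, hp, hm, h⟩ := ih
    obtain ⟨m', hm', h'⟩ := exists_marks C' σ
    -- One more coordinate costs one more bit in the colours: `none` reads the new bit, and the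
    -- earlier coordinates read the old colours.
    refine ⟨.prod C' two, fun b => f b.1, fun o b => o.elim (b.2 = Sum.inl ()) fun d => p d b.1,
      fun v => ((m v).map m').join, (Derivable.fst C' two).comp hf, fun o => ?_,
      (hm.comp hm'.mapping).join, fun v A c hv => ?_⟩
    · cases o with
      | none => exact DPred.eq_inl.comp (Derivable.snd C' two)
      | some d => exact (hp d).comp (Derivable.fst C' two)
    · obtain ⟨w, c', hw, h⟩ := h v A c hv
      choose w' hw' h' using fun z => h' _ _ _ (h z).1
      let e : (Option D → A) ≃ (_ : D → A) × A :=
        { toFun := fun z => ⟨fun d => z (some d), z none⟩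
          invFun := fun q o => o.elim q.2 q.1
          left_inv := fun z => by funext o; cases o <;> rfl
          right_inv := fun q => rfl }
      refine ⟨_, fun z y => (c' (fun d => z (some d)) y, truth (y = z none)),
        ((hw.map m').join hw').of_equiv e, fun z => ⟨h' _ _, fun y => (h _).2.1 y, fun o y => ?_⟩⟩
      cases o with
      | none => exact truth_eq_inl
      | some d => exact (h _).2.2 d y

/-- First-order queries are derivable properties. -/
theorem exists_dpred_of_fo {σ : MType} {β : Type} {Q : Query σ.voc β} (hQ : FO Q) :
    ∀ {C : MType} {p : β → C.Val → Prop}, (∀ b, DPred (p b)) →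
      ∃ q : (lab C σ).Val → Prop, DPred q ∧ ∀ v A c, LRep v A c → ∀ x : β → A,
        (∀ b y, p b (c y) ↔ y = x b) → (q v ↔ Q A x) := by
  -- The colours `C` and the predicates `p` are quantified inside the induction, since a quantifier
  -- passes from `C` to `C × two`.
  refine FO.induction (P := fun {β} Q => ∀ {C : MType} {p : β → C.Val → Prop}, (∀ b, DPred (p b)) →
      ∃ q : (lab C σ).Val → Prop, DPred q ∧ ∀ v A c, LRep v A c → ∀ x : β → A,
        (∀ b y, p b (c y) ↔ y = x b) → (q v ↔ Q A x)) ?_ ?_ ?_ ?_ ?_ ?_ hQ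
  · exact fun β C p hp => ⟨_, DPred.fls, fun _ _ _ _ _ _ => Iff.rfl⟩
  · intro β a b C p hp
    obtain ⟨q, hq, h⟩ := exists_some_colour ((hp a).and (hp b)) σ
    refine ⟨q, hq, fun v A c hv x hx => (h v A c hv).trans ?_⟩
    simp only [hx]
    exact ⟨fun ⟨y, h₁, h₂⟩ => h₁.symm.trans h₂, fun h => ⟨x a, rfl, h⟩⟩
  · intro β n R u C p hp
    obtain ⟨q, hq, h⟩ := exists_atom σ R fun j => hp (u j)
    refine ⟨q, hq, fun v A c hv x hx => (h v A c hv).trans ?_⟩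
    simp only [hx]
    exact ⟨fun ⟨y, h₁, h₂⟩ => funext h₂ ▸ h₁, fun h => ⟨_, h, fun _ => rfl⟩⟩
  · intro β Q Q' h₁ h₂ C p hp
    obtain ⟨q₁, hq₁, h₁⟩ := h₁ hp
    obtain ⟨q₂, hq₂, h₂⟩ := h₂ hp
    exact ⟨_, hq₁.imp hq₂, fun v A c hv x hx =>
      imp_congr (h₁ v A c hv x hx) (h₂ v A c hv x hx)⟩
  · intro β Q h C p hp
    obtain ⟨m, hm, h'⟩ := exists_marks C σ
    obtain ⟨q, hq, h⟩ := h (C := .prod C two)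
      (p := fun o b => o.elim (b.2 = Sum.inl ()) fun d => p d b.1) fun o => by
        cases o with
        | none => exact DPred.eq_inl.comp (Derivable.snd C two)
        | some d => exact (hp d).comp (Derivable.fst C two)
    -- A universal quantifier says that no way to mark the quantified element violates the body.
    refine ⟨_, (hq.not.exists_mem.comp hm).not, fun v A c hv x hx => ?_⟩
    obtain ⟨w, hw, h'⟩ := h' v A c hv
    rw [hw.exists_mem fun b => ¬ q b, not_exists]
    refine forall_congr' fun y => not_not.trans (h _ _ _ (h' y) _ fun o z => ?_)
    cases o with
    | none => exact truth_eq_inl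
    | some b => exact hx b z
  · intro β γ Q s h C p hp
    obtain ⟨q, hq, h⟩ := h fun b => hp (s b)
    exact ⟨q, hq, fun v A c hv x hx => h v A c hv _ fun b y => hx (s b) y⟩

/-! ### First-order interpretations are derivable -/

namespace Interp

variable {L L' : FirstOrder.Language.{0, 0}} {β : Type} [L'.IsRelational]

/-- The element, of the multiset defined by `F`, that contains the element of the component `i`
given by new parameters. -/
@[reducible]
def clsAt (F : Interp L (msetL L') β) (i : F.I) : Interp L L' (β ⊕ F.D) where
  I := F.I
  D := F.D
  finI := inferInstance
  finD := inferInstance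
  U := fun j A u x => F.U j A (fun b => u (Sum.inl b)) x ∧
    F.V (msetSim L') ![i, j] A (fun b => u (Sum.inl b)) ![fun d => u (Sum.inr d), x]
  V := fun {n} => match n with
    | 0 => fun R _ A u _ =>
      F.V (msetUnary R) ![i] A (fun b => u (Sum.inl b)) ![fun d => u (Sum.inr d)]
    | _ + 1 => fun R j A u x => F.V (msetKeep R) j A (fun b => u (Sum.inl b)) x
  foU := fun j => by
    refine ((F.foU j).relabel (Sum.map Sum.inl id)).and
      (((F.foV (msetSim L') ![i, j]).relabel (Sum.elim (fun b => Sum.inl (Sum.inl b))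
        fun q : Fin 2 × F.D => ![Sum.inl (Sum.inr q.2), Sum.inr q.2] q.1)).congr fun A z => ?_)
    apply iff_of_eq
    congr 1
    funext k d
    fin_cases k <;> rfl
  foV := by
    rintro (_ | n) R j
    · refine ((F.foV (msetUnary R) ![i]).relabel (Sum.elim (fun b => Sum.inl (Sum.inl b))
        fun q : Fin 1 × F.D => Sum.inl (Sum.inr q.2))).congr fun A z => ?_
      apply iff_of_eq
      congr 1
      funext k d
      fin_cases k
      rfl
    · exact (F.foV (msetKeep R) j).relabel (Sum.map Sum.inl id)

/-- A substitute for composition with `cls`: `Interp.comp` needs a parameter-free outer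
interpretation, so the element of the output that serves as the parameter is here written out as a
tuple of input parameters. -/
theorem clsAt_out (F : Interp L (msetL L') β) {A : Str L} {u : β → A} {i : F.I} {z : F.D → A}
    (h : F.U i A u z) :
    ((F.clsAt i).out A (Sum.elim u z)).Iso ((cls L').out (F.out A u) fun _ => F.elt i z h) := by
  have h₂ : ∀ y : F.out A u, F.V (msetSim L') ![i, y.1.1] A u ![z, y.1.2] ↔
      RelMap (msetSim L') ![F.elt i z h, y] := by
    intro y
    change _ ↔ F.V (msetSim L') (fun j => (![F.elt i z h, y] j).1.1) A u
      fun j => (![F.elt i z h, y] j).1.2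
    apply iff_of_eq
    congr 1 <;> funext j <;> fin_cases j <;> rfl
  refine out_iso_of_code (F.clsAt i) (B := (cls L').out (F.out A u) fun _ => F.elt i z h)
    (fun q => (q.1.2 ()).1) ?_ ?_ ?_
  · intro q q' e
    exact Subtype.ext (Prod.ext rfl (funext fun _ => Subtype.ext e))
  · intro j x
    constructor
    · rintro ⟨hx, hs⟩
      exact ⟨(cls L').elt () (fun _ => F.elt j x hx) ((h₂ (F.elt j x hx)).1 hs), rfl⟩
    · rintro ⟨q, hq⟩
      have := (h₂ (q.1.2 ())).2 q.2
      have hU := (q.1.2 ()).2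
      rw [hq] at this hU
      exact ⟨hU, this⟩
  · rintro (_ | n) R y
    · change _ ↔ F.V (msetUnary R) (fun j => (![F.elt i z h] j).1.1) A u
        fun j => (![F.elt i z h] j).1.2
      apply iff_of_eq
      change F.V (msetUnary R) ![i] A u ![z] = _
      congr 1 <;> funext j <;> fin_cases j <;> rfl
    · exact Iff.rfl

end Interp

/-! ### Computing the output value by recursion on its type -/

theorem exists_derivable_join {σ τ : MType} {I : Type} [Finite I]
    {h : I → σ.Val → Multiset τ.Val} (hh : ∀ i, Derivable (σ := σ) (τ := .mset τ) (h i)) :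
    ∃ H : σ.Val → Multiset τ.Val, Derivable (σ := σ) (τ := .mset τ) H ∧
      ∀ (v : σ.Val) (ι : I → Type) (w : ∀ i, ι i → τ.Val), (∀ i, Enum (h i v) (w i)) →
        Enum (H v) fun q : (i : I) × ι i => w q.1 q.2 := by
  have := Fintype.ofFinite I
  have key : ∀ s : Multiset I, Derivable (σ := σ) (τ := .mset τ)
      fun v => (s.map fun i => h i v).join := by
    intro s
    induction s using Multiset.induction with
    | empty => exact Derivable.zero σ τ
    | cons i s ih =>
      refine ((hh i).plus ih).congr fun v => ?_
      rw [Multiset.map_cons, Multiset.join_cons]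
  exact ⟨_, key Finset.univ.val, fun v ι w hw => Enum.join ⟨inferInstance, rfl⟩ hw⟩

/-- Parameters are allowed because the multiset case needs the induction hypothesis for the members
of the output, which are named by tuples. The conclusion speaks of every `b` that the output
represents, so no separate proof that a structure determines its value is required. -/
theorem exists_derivable_out (σ τ : MType) : ∀ {β : Type} (F : Interp σ.voc τ.voc β) {C : MType}
    {p : β → C.Val → Prop}, (∀ b, DPred (p b)) →
      ∃ g : (lab C σ).Val → τ.Val, Derivable g ∧ ∀ v A c, LRep v A c → ∀ u : β → A,
        (∀ b y, p b (c y) ↔ y = u b) → ∀ b, Represents τ (F.out A u) b → g v = b := by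
  induction τ with
  | one => exact fun _ _ _ _ => ⟨_, Derivable.terminal _, fun _ _ _ _ _ _ _ _ => rfl⟩
  | sum τ τ' ih₁ ih₂ =>
    classical
    intro β (F : Interp σ.voc (sumL τ.voc τ'.voc) β) C p hp
    obtain ⟨q, hq, h⟩ := exists_dpred_of_fo ((F.foV (sumIsLeft τ.voc τ'.voc) Fin.elim0).relabel
      (Sum.elim (fun b => b) fun d => d.1.elim0)) hp
    obtain ⟨g₁, hg₁, h₁⟩ := ih₁ ((Interp.outl τ.voc τ'.voc).comp F) hp
    obtain ⟨g₂, hg₂, h₂⟩ := ih₂ ((Interp.outr τ.voc τ'.voc).comp F) hp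
    refine ⟨_, hq.ite (hg₁.comp (Derivable.inl τ τ')) (hg₂.comp (Derivable.inr τ τ')),
      fun v A c hv u hu b hb => ?_⟩
    have hq' : q v ↔ RelMap (sumIsLeft τ.voc τ'.voc) (Fin.elim0 : Fin 0 → F.out A u) := by
      refine (h v A c hv u hu).trans ?_
      change _ ↔ F.V (sumIsLeft τ.voc τ'.voc) (fun j : Fin 0 => (Fin.elim0 j : F.out A u).1.1) A u
        fun j : Fin 0 => (Fin.elim0 j : F.out A u).1.2
      apply iff_of_eq
      congr 1 <;> exact Subsingleton.elim _ _
    obtain ⟨e⟩ := hb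
    have he := e.map_rel (sumIsLeft τ.voc τ'.voc) (Fin.elim0 : Fin 0 → F.out A u)
    rcases b with b | b
    · refine (if_pos (hq'.2 (he.1 trivial))).trans (congrArg Sum.inl (h₁ v A c hv u hu b ?_))
      exact (Interp.comp_out _ _ _ _).trans (((Interp.outl τ.voc τ'.voc).out_iso e _).trans
        (Interp.outl_out (τ.toStr b) _))
    · refine (if_neg fun hn => he.2 (hq'.1 hn)).trans (congrArg Sum.inr (h₂ v A c hv u hu b ?_))
      exact (Interp.comp_out _ _ _ _).trans (((Interp.outr τ.voc τ'.voc).out_iso e _).trans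
        (Interp.outr_out (τ'.toStr b) _))
  | prod τ τ' ih₁ ih₂ =>
    intro β (F : Interp σ.voc (prodL τ.voc τ'.voc) β) C p hp
    obtain ⟨g₁, hg₁, h₁⟩ := ih₁ ((Interp.fst τ.voc τ'.voc).comp F) hp
    obtain ⟨g₂, hg₂, h₂⟩ := ih₂ ((Interp.snd τ.voc τ'.voc).comp F) hp
    refine ⟨_, hg₁.pairing hg₂, fun v A c hv u hu b ⟨e⟩ => Prod.ext (h₁ v A c hv u hu b.1 ?_)
      (h₂ v A c hv u hu b.2 ?_)⟩
    · exact (Interp.comp_out _ _ _ _).trans (((Interp.fst τ.voc τ'.voc).out_iso e _).trans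
        (Interp.fst_out (τ.toStr b.1) (τ'.toStr b.2) _))
    · exact (Interp.comp_out _ _ _ _).trans (((Interp.snd τ.voc τ'.voc).out_iso e _).trans
        (Interp.snd_out (τ.toStr b.1) (τ'.toStr b.2) _))
  | mset τ ih =>
    classical
    intro β (F : Interp σ.voc (msetL τ.voc) β) C p hp
    obtain ⟨P, hP⟩ := exists_definesPoint τ
    obtain ⟨S, foS, hS⟩ := exists_fo_class_point hP
    obtain ⟨C', f, p', m, hf, hp', hm, hm'⟩ := exists_tuple_marks C σ F.D
    -- The old parameters are still legible through `f`; the marked tuple supplies the new ones.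
    let r : β ⊕ F.D → C'.Val → Prop := Sum.elim (fun b c => p b (f c)) p'
    have hr : ∀ b, DPred (r b) := by
      rintro (b | d)
      · exact (hp b).comp hf
      · exact hp' d
    -- `q i` accepts the tuples which represent, in the component `i`, the definable point of a
    -- class; `g i` computes the member that such a tuple names.
    choose q hq hq' using fun i => exists_dpred_of_fo (F.fo_elt foS i) hr
    choose g hg hg' using fun i => ih (F.clsAt i) hr
    obtain ⟨H, hH, hH'⟩ := exists_derivable_join fun i =>
      (hm.comp (Derivable.filter (hq i))).comp (hg i).mapping
    refine ⟨H, hH, fun v A c hv u hu (b : Multiset τ.Val) ⟨e⟩ => ?_⟩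
    obtain ⟨w, c', hw, hc⟩ := hm' v A c hv
    have hrz : ∀ z d y, r d (c' z y) ↔ y = Sum.elim u z d := by
      rintro z (d | d) y
      · change p d (f (c' z y)) ↔ _
        rw [(hc z).2.1]
        exact hu d y
      · exact (hc z).2.2 d y
    choose pt hpt hpt' using fun k : b => hP.existsUnique k.1 _ (represents_toStr τ k.1)
    let B : Str (msetL τ.voc) := Str.mset fun k : b => τ.toStr k.1
    let e : F.out A u ≃[msetL τ.voc] B := e
    have hqz : ∀ i z, q i (w z) ↔ ∃ (h : F.U i A u z) (k : b), e (F.elt i z h) = some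
        ⟨k, pt k⟩ := by
      intro i z
      refine (hq' i _ _ _ (hc z).1 _ (hrz z)).trans (exists_congr fun h => ?_)
      refine (foS.iso e fun _ => F.elt i z h).symm.trans ((hS _ _ _).trans ?_)
      refine exists_congr fun k => ⟨?_, fun h => ⟨_, h, hpt k⟩⟩
      rintro ⟨a, ha, haP⟩
      rwa [hpt' k a haP] at ha
    have hgz : ∀ i z (h : F.U i A u z) (k : b), e (F.elt i z h) = some ⟨k, pt k⟩ →
        g i (w z) = k.1 := by
      intro i z h k hk
      refine hg' i _ _ _ (hc z).1 _ (hrz z) _ ((F.clsAt_out h).trans ?_)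
      have h₁ := (Interp.cls τ.voc).out_iso e fun _ => F.elt i z h
      beta_reduce at h₁
      rw [hk] at h₁
      exact h₁.trans (Interp.cls_out (A := fun k : b => τ.toStr k.1) k (pt k))
    -- The element of the output that corresponds to the definable point of the occurrence `k`.
    let x : b → F.out A u := fun k => e.symm (some ⟨k, pt k⟩ : Option ((k : b) × τ.toStr k.1))
    have hx : ∀ k, e (F.elt (x k).1.1 (x k).1.2 (x k).2) = some ⟨k, pt k⟩ := fun k =>
      e.apply_symm_apply _
    let E : b → (i : F.I) × {z : F.D → A // q i (w z)} := fun k =>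
      ⟨(x k).1.1, (x k).1.2, (hqz _ _).2 ⟨(x k).2, k, hx k⟩⟩
    -- Occurrences in `b` correspond to accepted pairs of a component and a tuple, so the computed
    -- multiset has the right multiplicities.
    have hE : Function.Bijective E := by
      constructor
      · intro k k' h
        have h₁ : (x k).1 = (x k').1 := by
          have := congrArg (fun s : (i : F.I) × {z : F.D → A // q i (w z)} => (s.1, s.2.1)) h
          exact this
        have h₂ : (some ⟨k, pt k⟩ : Option ((k : b) × τ.toStr k.1)) = some ⟨k', pt k'⟩ :=
          e.symm.injective (Subtype.ext h₁)
        exact congrArg Sigma.fst (Option.some.inj h₂)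
      · rintro ⟨i, z, hz⟩
        obtain ⟨h, k, hk⟩ := (hqz i z).1 hz
        have h₁ : x k = F.elt i z h :=
          (congrArg e.symm hk).symm.trans (e.symm_apply_apply _)
        refine ⟨k, ?_⟩
        have h₂ : ∀ y : F.out A u, y = F.elt i z h → ∀ hy : q y.1.1 (w y.1.2),
            (⟨y.1.1, y.1.2, hy⟩ : (i : F.I) × {z : F.D → A // q i (w z)}) = ⟨i, z, hz⟩ := by
          rintro _ rfl hy
          rfl
        exact h₂ _ h₁ _
    have h₁ := hH' v _ _ fun i => (hw.filter (q i)).map (g i)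
    exact ((Enum.toType b).eq h₁ (Equiv.ofBijective E hE) fun k => hgz _ _ (x k).2 k (hx k)).symm

theorem FOFun.derivable {σ τ : MType} {f : σ.Val → τ.Val} (h : FOFun f) : Derivable f := by
  obtain ⟨F, hF⟩ := h
  obtain ⟨l, hl, hl'⟩ := exists_colour σ
  obtain ⟨g, hg, hg'⟩ := exists_derivable_out σ τ F (C := .one) (p := Empty.elim) fun b => b.elim
  exact (hl.comp hg).congr fun a => hg' _ _ _ (hl' a) Empty.elim (fun b => b.elim) _
    (hF a _ _ (represents_toStr σ a))

/-- All components share the disjoint union of their coordinate sets as a common dimension.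
Coordinates that belong to another component are forced to be the definable point. -/
theorem IsFOInterpretation.foFun {σ τ : MType} {f : σ.Val → τ.Val} (h : IsFOInterpretation f) :
    FOFun f := by
  obtain ⟨F, hF⟩ := h
  obtain ⟨P, hP⟩ := exists_definesPoint σ
  have := F.finite_I
  have := Fintype.ofFinite F.I
  let G : Interp σ.voc τ.voc Empty :=
    { I := F.I
      D := (i : F.I) × Fin (F.dim i)
      finI := inferInstance
      finD := inferInstance
      U := fun i A _ z => (F.univ i).Realize (fun d => z ⟨i, d⟩) ∧
        ∀ d : (i : F.I) × Fin (F.dim i), d.1 ≠ i → P A (z d)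
      V := fun R i A _ z => (F.rel R i).Realize fun d => z d.1 ⟨i d.1, d.2⟩
      foU := fun i => by
        refine FO.and ?_ (FO.forall_index fun d => (FO.const _).imp (hP.fo.relabel
            fun _ => Sum.inr d))
        exact FO.relabel (Q := fun A z => (F.univ i).Realize z) ⟨F.univ i, fun _ _ => Iff.rfl⟩
          fun d => Sum.inr (⟨i, d⟩ : (i : F.I) × Fin (F.dim i))
      foV := fun R i => FO.relabel (Q := fun A z => (F.rel R i).Realize z)
        ⟨F.rel R i, fun _ _ => Iff.rfl⟩ fun d =>
          Sum.inr (d.1, (⟨i d.1, d.2⟩ : (i : F.I) × Fin (F.dim i))) }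
  refine ⟨G, fun a A u hA => (hF a A hA).of_iso ?_⟩
  obtain ⟨o, ho, ho'⟩ := hP.existsUnique a A hA
  classical
  let ext (i : F.I) (z : Fin (F.dim i) → A) : ((i : F.I) × Fin (F.dim i)) → A := fun d =>
    if h : d.1 = i then z (h ▸ d.2) else o
  have ext_self : ∀ i z d, ext i z ⟨i, d⟩ = z d := fun i z d => dif_pos rfl
  refine G.out_iso_of_code (B := F.out A) (fun b => (b.1, ext b.1 b.2.1)) ?_ ?_ ?_
  · rintro ⟨i, z, hz⟩ ⟨j, y, hy⟩ h
    obtain ⟨h₁, h₂⟩ := Prod.mk.inj h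
    cases h₁
    obtain rfl : z = y := funext fun d => by
      rw [← ext_self i z d, ← ext_self i y d]
      exact congrFun h₂ _
    rfl
  · intro i x
    constructor
    · rintro ⟨hx, hx'⟩
      refine ⟨⟨i, fun d => x ⟨i, d⟩, hx⟩, Prod.ext rfl (funext ?_)⟩
      rintro ⟨j, d⟩
      by_cases hj : j = i
      · subst hj
        exact ext_self _ _ _
      · exact (dif_neg hj).trans (ho' _ (hx' ⟨j, d⟩ hj)).symm
    · rintro ⟨⟨j, z, hz⟩, h⟩
      obtain ⟨h₁, h₂⟩ := Prod.mk.inj h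
      subst h₁ h₂
      refine ⟨?_, fun d hd => ?_⟩
      · have : (fun d => ext j z ⟨j, d⟩) = z := funext (ext_self j z)
        exact this.symm ▸ hz
      · have : ext j z d = o := dif_neg hd
        exact this.symm ▸ ho
  · intro n R y
    have : ∀ d : (j : Fin n) × Fin (F.dim (y j).1),
        ext (y d.1).1 (y d.1).2.1 ⟨(y d.1).1, d.2⟩ = (y d.1).2.1 d.2 := fun d => ext_self _ _ _
    exact iff_of_eq (congrArg (F.rel R fun j => (y j).1).Realize (funext this))

end MultisetTypes

theorem mainTheorem5 (σ τ : MultisetTypes.MType) (f : σ.Val → τ.Val) :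
    MultisetTypes.IsFOInterpretation f ↔ MultisetTypes.Derivable f :=
  ⟨fun h => h.foFun.derivable, fun h => h.foFun.isFOInterpretation⟩
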